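/- Let $R$ be a nonzero associative ring with identity, let $M$ be an $R$-bimodule, and set $M^{\otimes_R 0}=R$, $M^{\otimes_R (i+1)}=M\otimes_R M^{\otimes_R i}$. Assume that $M$ is nilpotent, i.e. $M^{\otimes_R(N+1)}=0$ for some $N\geq 0$, and let $T_R(M)=\bigoplus_{i\ge 0}M^{\otimes_R i}$ be the tensor ring. Modules are left modules. A $T_R(M)$-module is viewed as a pair $(X,u)$, where $X$ is its underlying $R$-module and $u\colon M\otimes_R X\to X$ is the $R$-homomorphism given by the action of $M\subseteq T_R(M)$. Let $U$ be the forgetful functor $(X,u)\mapsto X$, and let $\mathrm{Ind}=T_R(M)\otimes_R-$ be its left adjoint. For a class $\mathcal X$ of $R$-modules put $$\mathrm{Ind}(\mathcal X)=\{\mathrm{Ind}(X)\mid X\in\mathcal X\},\qquad \Phi(\mathcal X)=\{(X,u)\mid u\text{ is a monomorphism and }\operatorname{coker}(u)\in\mathcal X\}.$$ For a ring $S$ and a class $\mathcal Y$ of $S$-modules, a $\mathcal Y$-complete projective resolution is an exact complex $P^\bullet=\cdots\to P^{-1}\to P^0\to P^1\to\cdots$ of projective $S$-modules such that $\operatorname{Hom}_S(P^\bullet,Y)$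 is exact for every $Y\in\mathcal Y$. An $S$-module $G$ is $\mathcal Y$-Gorenstein projective if $G\cong\operatorname{Im}(P^{-1}\to P^0)$ for some such $P^\bullet$. Write $\mathsf{Proj}(S)$ and $\mathsf{Flat}(S)$ for the classes of projective and of flat $S$-modules; let $\mathsf{GP}(S)$ be the class of Gorenstein projective modules (the case $\mathcal Y=\mathsf{Proj}(S)$) and $\mathsf{DP}(S)$ the class of Ding projective modules (the case $\mathcal Y=\mathsf{Flat}(S)$). Let $\mathcal X$ be a class of $R$-modules containing all projective ones. The bimodule $M$ is compatible with respect to $\mathcal X$ if for every $\mathrm{Ind}(\mathcal X)$-complete projective resolution $Q^\bullet$ of $T_R(M)$-modules the complex $M\otimes_R U(Q^\bullet)$ is exact and the complex $\operatorname{Hom}_{T_R(M)}(Q^\bullet,\mathrm{Ind}(M\otimes_R X))$ is exact for each $X\in\mathcal X$. It is admissible with respect to $\mathcal X$ if $$\operatorname{Ext}^1_R(G,M^{\otimes_R i}\otimes_R X)=0=\operatorname{Tor}_1^R(M,M^{\otimes_R i}\otimes_R G)$$ for every $\mathcal X$-Gorenstein projective $R$-module $G$, every $X\in\mathcal X$ and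 every $i\ge 0$. Then: (a) If $M$ is compatible and admissible with respect to $\mathsf{Proj}(R)$, then $\mathsf{GP}(T_R(M))=\Phi(\mathsf{GP}(R))$. (b) If $M$ is compatible and admissible with respect to $\mathsf{Flat}(R)$, then $\mathsf{DP}(T_R(M))=\Phi(\mathsf{DP}(R))$. -/

import Mathlib

open CategoryTheory TensorProduct DirectSum

universe u v w v' w' t

noncomputable section

/-! ## Tensor products over a noncommutative ring -/

/-- The relations `(a r) ⊗ x = a ⊗ (r x)` imposed on `A ⊗_ℤ X`. -/
def balancedRel (R : Type u) [Ring R] (A : Type v) [AddCommGroup A] [Module Rᵐᵒᵖ A]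
    (X : Type w) [AddCommGroup X] [Module R X] : AddSubgroup (A ⊗[ℤ] X) :=
  AddSubgroup.closure {z | ∃ (a : A) (r : R) (x : X),
    z = (MulOpposite.op r • a) ⊗ₜ[ℤ] x - a ⊗ₜ[ℤ] (r • x)}

/-- The tensor product `A ⊗_R X` of a right `R`-module `A` and a left `R`-module `X`
over an arbitrary ring `R`. -/
def BalancedTensor (R : Type u) [Ring R] (A : Type v) [AddCommGroup A] [Module Rᵐᵒᵖ A]
    (X : Type w) [AddCommGroup X] [Module R X] : Type (max v w) :=
  (A ⊗[ℤ] X) ⧸ balancedRel R A X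

namespace BalancedTensor

section Basic

variable {R : Type u} [Ring R] {A : Type v} [AddCommGroup A] [Module Rᵐᵒᵖ A]
  {X : Type w} [AddCommGroup X] [Module R X]
  {A' : Type v'} [AddCommGroup A'] [Module Rᵐᵒᵖ A']
  {X' : Type w'} [AddCommGroup X'] [Module R X']
  {B : Type t} [AddCommGroup B]

instance : AddCommGroup (BalancedTensor R A X) :=
  inferInstanceAs (AddCommGroup ((A ⊗[ℤ] X) ⧸ balancedRel R A X))

/-- The pure tensor `a ⊗ x`. -/
def tmul (R : Type u) [Ring R] {A : Type v} [AddCommGroup A] [Module Rᵐᵒᵖ A]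
    {X : Type w} [AddCommGroup X] [Module R X] (a : A) (x : X) : BalancedTensor R A X :=
  QuotientAddGroup.mk' (balancedRel R A X) (a ⊗ₜ[ℤ] x)

theorem tmul_add (a : A) (x y : X) : tmul R a (x + y) = tmul R a x + tmul R a y := by
  simp only [tmul, TensorProduct.tmul_add]
  exact map_add (QuotientAddGroup.mk' (balancedRel R A X)) _ _

theorem add_tmul (a b : A) (x : X) : tmul R (a + b) x = tmul R a x + tmul R b x := by
  simp only [tmul, TensorProduct.add_tmul]
  exact map_add (QuotientAddGroup.mk' (balancedRel R A X)) _ _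

theorem op_smul_tmul (a : A) (r : R) (x : X) :
    tmul R (MulOpposite.op r • a) x = tmul R a (r • x) := by
  refine (QuotientAddGroup.eq_iff_sub_mem (N := balancedRel R A X)).2 ?_
  exact AddSubgroup.subset_closure ⟨a, r, x, rfl⟩

@[elab_as_elim]
theorem induction_on {p : BalancedTensor R A X → Prop} (z : BalancedTensor R A X)
    (h0 : p 0) (ht : ∀ a x, p (tmul R a x)) (ha : ∀ y z, p y → p z → p (y + z)) : p z := by
  obtain ⟨z, rfl⟩ := QuotientAddGroup.mk'_surjective (balancedRel R A X) z
  induction z using TensorProduct.induction_on with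
  | zero => rw [map_zero]; exact h0
  | tmul a x => exact ht a x
  | add y z hy hz => rw [map_add]; exact ha _ _ hy hz

/-- The universal property: a balanced biadditive map factors through `A ⊗_R X`. -/
def lift (f : A →+ X →+ B) (hf : ∀ a (r : R) x, f (MulOpposite.op r • a) x = f a (r • x)) :
    BalancedTensor R A X →+ B :=
  QuotientAddGroup.lift (balancedRel R A X)
    (TensorProduct.liftAddHom f (fun n a x => by simp))
    ((AddSubgroup.closure_le _).2 (by
      rintro _ ⟨a, r, x, rfl⟩
      simp [hf]))

@[simp]
theorem lift_tmul (f : A →+ X →+ B)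
    (hf : ∀ a (r : R) x, f (MulOpposite.op r • a) x = f a (r • x)) (a : A) (x : X) :
    lift f hf (tmul R a x) = f a x := rfl

theorem addHom_ext {f g : BalancedTensor R A X →+ B}
    (h : ∀ a x, f (tmul R a x) = g (tmul R a x)) : f = g := by
  ext z
  induction z using induction_on with
  | h0 => simp
  | ht a x => exact h a x
  | ha y z hy hz => rw [map_add, map_add, hy, hz]

/-- The map `f ⊗ g`. -/
def map (f : A →ₗ[Rᵐᵒᵖ] A') (g : X →ₗ[R] X') :
    BalancedTensor R A X →+ BalancedTensor R A' X' :=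
  lift (AddMonoidHom.mk' (fun a => AddMonoidHom.mk' (fun x => tmul R (f a) (g x))
      (fun x y => by rw [map_add, tmul_add]))
      (fun a b => by ext x; simp [add_tmul]))
    (fun a r x => by simp [op_smul_tmul])

@[simp]
theorem map_tmul (f : A →ₗ[Rᵐᵒᵖ] A') (g : X →ₗ[R] X') (a : A) (x : X) :
    map f g (tmul R a x) = tmul R (f a) (g x) := rfl

end Basic

section LeftAction

variable {R : Type u} [Ring R] {S : Type t} [Ring S]
  {A : Type v} [AddCommGroup A] [Module S A] [Module Rᵐᵒᵖ A] [SMulCommClass S Rᵐᵒᵖ A]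
  {X : Type w} [AddCommGroup X] [Module R X]
  {X' : Type w'} [AddCommGroup X'] [Module R X']

/-- If `A` is an `S`-`R`-bimodule then `S` acts on `A ⊗_R X` by `s (a ⊗ x) = (s a) ⊗ x`. -/
instance : SMul S (BalancedTensor R A X) where
  smul s := map ⟨⟨fun a => s • a, smul_add s⟩, fun r a => smul_comm s r a⟩ LinearMap.id

@[simp]
theorem smul_tmul (s : S) (a : A) (x : X) : s • tmul R a x = tmul R (s • a) x := rfl

instance : Module S (BalancedTensor R A X) where
  smul_zero s := map_zero (map _ _)
  smul_add s := map_add (map _ _)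
  one_smul z := by
    induction z using induction_on with
    | h0 => exact map_zero (map _ _)
    | ht a x => simp
    | ha y z hy hz => exact (map_add (map _ _) y z).trans (congrArg₂ _ hy hz)
  mul_smul s s' z := by
    induction z using induction_on with
    | h0 => exact (map_zero (map _ _)).trans
              ((congrArg _ (map_zero (map _ _))).trans (map_zero (map _ _))).symm
    | ht a x => simp [mul_smul]
    | ha y z hy hz =>
      refine (map_add (map _ _) y z).trans ((congrArg₂ _ hy hz).trans ?_)
      exact ((congrArg _ (map_add (map _ _) y z)).trans (map_add (map _ _) _ _)).symm
  add_smul s s' z := by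
    induction z using induction_on with
    | h0 =>
      refine (map_zero (map _ _)).trans ?_
      exact ((congrArg₂ _ (map_zero (map _ _)) (map_zero (map _ _))).trans (add_zero _)).symm
    | ht a x => simp [add_smul, add_tmul]
    | ha y z hy hz =>
      refine (map_add (map _ _) y z).trans ((congrArg₂ _ hy hz).trans ?_)
      refine Eq.trans ?_ (congrArg₂ _ (map_add (map _ _) y z) (map_add (map _ _) y z)).symm
      exact add_add_add_comm _ _ _ _
  zero_smul z := by
    induction z using induction_on with
    | h0 => exact map_zero (map _ _)
    | ht a x =>
      rw [smul_tmul, zero_smul]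
      have := add_tmul (R := R) (0 : A) 0 x
      simpa using this
    | ha y z hy hz => exact (map_add (map _ _) y z).trans ((congrArg₂ _ hy hz).trans (add_zero _))

/-- The `S`-linear map `A ⊗ g`. -/
def lTensor (S : Type t) [Ring S] (A : Type v) [AddCommGroup A] [Module S A] [Module Rᵐᵒᵖ A]
    [SMulCommClass S Rᵐᵒᵖ A] (g : X →ₗ[R] X') :
    BalancedTensor R A X →ₗ[S] BalancedTensor R A X' where
  toFun := map LinearMap.id g
  map_add' := map_add _
  map_smul' s z := by
    induction z using induction_on with
    | h0 => simp
    | ht a x => simp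
    | ha y z hy hz => rw [smul_add, map_add, hy, hz, map_add]; exact (smul_add _ _ _).symm

@[simp]
theorem lTensor_tmul (g : X →ₗ[R] X') (a : A) (x : X) :
    lTensor S A g (tmul R a x) = tmul R a (g x) := rfl

theorem linearMap_ext {Y : Type w'} [AddCommGroup Y] [Module S Y]
    {f g : BalancedTensor R A X →ₗ[S] Y} (h : ∀ a x, f (tmul R a x) = g (tmul R a x)) :
    f = g := by
  ext z
  exact DFunLike.congr_fun (addHom_ext (f := f.toAddMonoidHom) (g := g.toAddMonoidHom) h) z

/-- The universal property, for maps which are `S`-linear in the first variable. -/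
def liftLinear {Y : Type w'} [AddCommGroup Y] [Module S Y] (f : A →ₗ[S] X →+ Y)
    (hf : ∀ a (r : R) x, f (MulOpposite.op r • a) x = f a (r • x)) :
    BalancedTensor R A X →ₗ[S] Y where
  toFun := lift f.toAddMonoidHom hf
  map_add' := map_add _
  map_smul' s z := by
    induction z using induction_on with
    | h0 => simp
    | ht a x => exact DFunLike.congr_fun (map_smul f s a) x
    | ha y z hy hz => rw [smul_add, map_add, hy, hz, map_add]; exact (smul_add _ _ _).symm

@[simp]
theorem liftLinear_tmul {Y : Type w'} [AddCommGroup Y] [Module S Y] (f : A →ₗ[S] X →+ Y)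
    (hf : ∀ a (r : R) x, f (MulOpposite.op r • a) x = f a (r • x)) (a : A) (x : X) :
    liftLinear f hf (tmul R a x) = f a x := rfl

end LeftAction

section RightAction

variable {R : Type u} [Ring R] {R' : Type t} [Ring R']
  {A : Type v} [AddCommGroup A] [Module Rᵐᵒᵖ A]
  {X : Type w} [AddCommGroup X] [Module R X] [Module R'ᵐᵒᵖ X] [SMulCommClass R R'ᵐᵒᵖ X]

/-- If `X` is an `R`-`R'`-bimodule then `R'` acts on the right of `A ⊗_R X` by
`(a ⊗ x) r = a ⊗ (x r)`. -/
@[reducible]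
def rightModule : Module R'ᵐᵒᵖ (BalancedTensor R A X) :=
  let ρ : R'ᵐᵒᵖ → BalancedTensor R A X →+ BalancedTensor R A X := fun r =>
    map LinearMap.id (⟨⟨fun x => r • x, smul_add r⟩, fun s x => (smul_comm s r x).symm⟩ :
      X →ₗ[R] X)
  { smul := fun r z => ρ r z
    smul_zero := fun r => map_zero (ρ r)
    smul_add := fun r => map_add (ρ r)
    one_smul := fun z => by
      refine DFunLike.congr_fun (f := ρ 1) (g := AddMonoidHom.id _) (addHom_ext ?_) z
      intro a x
      simp [ρ]
    mul_smul := fun s s' z => by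
      refine DFunLike.congr_fun (f := ρ (s * s')) (g := (ρ s).comp (ρ s')) (addHom_ext ?_) z
      intro a x
      simp [ρ, mul_smul]
    add_smul := fun s s' z => by
      refine DFunLike.congr_fun (f := ρ (s + s')) (g := ρ s + ρ s') (addHom_ext ?_) z
      intro a x
      simp [ρ, add_smul, tmul_add]
    zero_smul := fun z => by
      refine DFunLike.congr_fun (f := ρ 0) (g := 0) (addHom_ext ?_) z
      intro a x
      simpa [ρ] using tmul_add (R := R) a (0 : X) 0 }

end RightAction

end BalancedTensor

/-- The functor `A ⊗_R - : Mod(R) ⥤ Mod(S)` given by an `S`-`R`-bimodule `A`. -/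
def tensorFunctor (S : Type u) [Ring S] (R : Type u) [Ring R] (A : Type u) [AddCommGroup A]
    [Module S A] [Module Rᵐᵒᵖ A] [SMulCommClass S Rᵐᵒᵖ A] :
    ModuleCat.{u} R ⥤ ModuleCat.{u} S where
  obj X := ModuleCat.of S (BalancedTensor R A X)
  map f := ModuleCat.ofHom (BalancedTensor.lTensor S A f.hom)
  map_id X := by
    ext : 1
    exact BalancedTensor.linearMap_ext fun a x => rfl
  map_comp f g := by
    ext : 1
    exact BalancedTensor.linearMap_ext fun a x => rfl

instance (S : Type u) [Ring S] (R : Type u) [Ring R] (A : Type u) [AddCommGroup A]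
    [Module S A] [Module Rᵐᵒᵖ A] [SMulCommClass S Rᵐᵒᵖ A] :
    (tensorFunctor S R A).Additive where
  map_add {X Y f g} := by
    ext : 1
    exact BalancedTensor.linearMap_ext fun a x => BalancedTensor.tmul_add a (f.hom x) (g.hom x)

/-! ## Tensor powers of a bimodule and the tensor ring -/

/-- An `R`-bimodule. -/
structure RingBimodule (R : Type u) [Ring R] where
  carrier : Type u
  [addCommGroup : AddCommGroup carrier]
  [leftModule : Module R carrier]
  [rightModule : Module Rᵐᵒᵖ carrier]
  [smulCommClass : SMulCommClass R Rᵐᵒᵖ carrier]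

instance (R : Type u) [Ring R] : CoeSort (RingBimodule R) (Type u) := ⟨RingBimodule.carrier⟩

attribute [instance] RingBimodule.addCommGroup RingBimodule.leftModule RingBimodule.rightModule RingBimodule.smulCommClass

section TensorRing

variable (R : Type u) [Ring R] (M : Type u) [AddCommGroup M] [Module R M] [Module Rᵐᵒᵖ M]
  [SMulCommClass R Rᵐᵒᵖ M]

/-- The `R`-bimodule `M ⊗_R X` for an `R`-bimodule `X`. -/
@[reducible]
def RingBimodule.tensorLeft (X : RingBimodule R) : RingBimodule R :=
  letI : Module Rᵐᵒᵖ (BalancedTensor R M X) := BalancedTensor.rightModule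
  { carrier := BalancedTensor R M X
    smulCommClass := ⟨fun r s z => by
      induction z using BalancedTensor.induction_on with
      | h0 => simp only [smul_zero]
      | ht a x => rfl
      | ha y z hy hz => simp only [smul_add, hy, hz]⟩ }

/-- The tensor powers: `M^{⊗0} = R` and `M^{⊗(i+1)} = M ⊗_R M^{⊗i}`. -/
def tensorPow : ℕ → RingBimodule R
  | 0 => ⟨R⟩
  | i + 1 => RingBimodule.tensorLeft R M (tensorPow i)

/-- The underlying group `⨁_i M^{⊗i}` of the tensor ring `T_R(M)`. -/
def TensorRing : Type u := ⨁ i, tensorPow R M i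

namespace TensorRing

instance : AddCommGroup (TensorRing R M) := inferInstanceAs (AddCommGroup (⨁ i, tensorPow R M i))

instance : Module R (TensorRing R M) := inferInstanceAs (Module R (⨁ i, tensorPow R M i))

/-- The inclusion of the summand `M^{⊗i}`. -/
def of (i : ℕ) : tensorPow R M i →ₗ[R] TensorRing R M :=
  DirectSum.lof R ℕ (fun i => tensorPow R M i) i

/-- The pure tensor `m ⊗ y` in `M^{⊗(i+1)} = M ⊗_R M^{⊗i}`. -/
def consPow {i : ℕ} (m : M) (y : tensorPow R M i) : tensorPow R M (i + 1) :=
  BalancedTensor.tmul R m y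

/-- An element of `R`, seen in `M^{⊗0} = R`. -/
def scalarPow (r : R) : tensorPow R M 0 := r

variable {R M}

theorem smul_of_scalarPow (r s : R) :
    r • of R M 0 (scalarPow R M s) = of R M 0 (scalarPow R M (r * s)) :=
  (map_smul (of R M 0) r (scalarPow R M s)).symm

@[elab_as_elim]
theorem of_induction {p : TensorRing R M → Prop} (x : TensorRing R M) (h0 : p 0)
    (hs : ∀ i (y : tensorPow R M i), p (of R M i y)) (ha : ∀ x y, p x → p y → p (x + y)) : p x :=
  DirectSum.induction_on (motive := p) x h0 hs ha

theorem addHom_ext {B : Type v} [AddCommGroup B] {f g : TensorRing R M →+ B}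
    (h : ∀ i y, f (of R M i y) = g (of R M i y)) : f = g :=
  DirectSum.addHom_ext h

@[elab_as_elim]
theorem induction_on {p : TensorRing R M → Prop} (x : TensorRing R M) (h0 : p 0)
    (hs : ∀ r : R, p (of R M 0 (scalarPow R M r)))
    (hc : ∀ i (m : M) (y : tensorPow R M i), p (of R M i y) →
      p (of R M (i + 1) (consPow R M m y)))
    (ha : ∀ x y, p x → p y → p (x + y)) : p x := by
  have key : ∀ i (y : tensorPow R M i), p (of R M i y) := by
    intro i
    induction i with
    | zero => exact hs
    | succ i ih =>
      intro y
      refine BalancedTensor.induction_on (p := fun y => p (of R M (i + 1) y)) y ?_ ?_ ?_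
      · rw [show of R M (i + 1) (0 : BalancedTensor R M (tensorPow R M i)) = 0 from
          map_zero (of R M (i + 1))]
        exact h0
      · exact fun m y => hc i m y (ih y)
      · intro y z hy hz
        rw [show of R M (i + 1) (y + z) = of R M (i + 1) y + of R M (i + 1) z from
          map_add (of R M (i + 1)) y z]
        exact ha _ _ hy hz
  exact of_induction (p := p) x h0 key ha

section Act

variable {X : Type v} [AddCommGroup X] [Module R X] (u : M →ₗ[R] X →+ X)
  (hu : ∀ m (r : R) x, u (MulOpposite.op r • m) x = u m (r • x))

/-- Given a left `R`-module `X` and an `R`-linear map `u : M ⊗_R X → X` (written as a balanced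
map `u m x`), the map `(m ⊗ y) x = u m (y x)` extending an action `φ` of `Y` on `X` to one of
`M ⊗_R Y`. -/
def actStep {Y : Type w} [AddCommGroup Y] [Module R Y] (φ : Y →ₗ[R] X →+ X) :
    BalancedTensor R M Y →ₗ[R] X →+ X :=
  BalancedTensor.liftLinear
    { toFun := fun m => AddMonoidHom.mk' (fun y => (u m).comp (φ y))
        (fun y z => by ext x; simp)
      map_add' := fun m n => by ext y x; simp
      map_smul' := fun r m => by ext y x; simp }
    (fun m r y => by ext x; simp [hu])

/-- The iterated action `(m₁ ⊗ ⋯ ⊗ mᵢ) x = u m₁ (⋯ (u mᵢ x))` of `M^{⊗i}` on `X`. -/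
def actPow : (i : ℕ) → tensorPow R M i →ₗ[R] X →+ X
  | 0 => (show R →ₗ[R] X →+ X from
      { toFun := fun r => DistribSMul.toAddMonoidHom X r
        map_add' := fun r s => by ext x; exact add_smul r s x
        map_smul' := fun r s => by ext x; exact mul_smul r s x })
  | i + 1 => actStep u hu (actPow i)

/-- The action of `⨁_i M^{⊗i}` on `X` extending `actPow`. -/
def act : TensorRing R M →ₗ[R] X →+ X :=
  DirectSum.toModule R ℕ (X →+ X) (actPow u hu)

theorem act_of (i : ℕ) (y : tensorPow R M i) : act u hu (of R M i y) = actPow u hu i y :=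
  DirectSum.toModule_lof (ι := ℕ) (M := fun i => tensorPow R M i) R i y

theorem act_of_zero (r : R) (x : X) : act u hu (of R M 0 (scalarPow R M r)) x = r • x := by
  rw [act_of]; rfl

theorem act_of_cons (i : ℕ) (m : M) (y : tensorPow R M i) (x : X) :
    act u hu (of R M (i + 1) (consPow R M m y)) x = u m (act u hu (of R M i y) x) := by
  rw [act_of, act_of]; rfl

end Act

variable (R M) in
/-- The map `y ↦ m ⊗ y` on `⨁_i M^{⊗i}`, for an element `m` of `M`. -/
def consHom (m : M) : TensorRing R M →+ TensorRing R M :=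
  DirectSum.toAddMonoid fun i => (of R M (i + 1)).toAddMonoidHom.comp
    (AddMonoidHom.mk' (consPow R M m) (BalancedTensor.tmul_add m))

theorem consHom_of (m : M) (i : ℕ) (y : tensorPow R M i) :
    consHom R M m (of R M i y) = of R M (i + 1) (consPow R M m y) :=
  DirectSum.toAddMonoid_of _ _ _

variable (R M) in
/-- `consHom` as an `R`-linear map in `m`. -/
def cons : M →ₗ[R] TensorRing R M →+ TensorRing R M where
  toFun m := consHom R M m
  map_add' m n := addHom_ext fun i y => by
    rw [AddMonoidHom.add_apply, consHom_of, consHom_of, consHom_of, ← map_add]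
    exact congrArg _ (BalancedTensor.add_tmul m n y)
  map_smul' r m := addHom_ext fun i y => by
    refine Eq.trans ?_ (congrArg (r • ·) (consHom_of m i y)).symm
    rw [consHom_of, ← map_smul]
    rfl

theorem cons_of (m : M) (i : ℕ) (y : tensorPow R M i) :
    cons R M m (of R M i y) = of R M (i + 1) (consPow R M m y) :=
  consHom_of m i y

theorem cons_balanced (m : M) (r : R) (x : TensorRing R M) :
    cons R M (MulOpposite.op r • m) x = cons R M m (r • x) := by
  refine of_induction x ?_ (fun i y => ?_) (fun x y hx hy => ?_)
  · rw [smul_zero, map_zero, map_zero]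
  · rw [← map_smul, cons_of, cons_of]
    exact congrArg _ (BalancedTensor.op_smul_tmul m r y)
  · rw [smul_add, map_add, map_add, hx, hy]

instance : Mul (TensorRing R M) := ⟨fun x y => act (cons R M) cons_balanced x y⟩

instance : One (TensorRing R M) := ⟨of R M 0 (scalarPow R M 1)⟩

theorem mul_def (x y : TensorRing R M) : x * y = act (cons R M) cons_balanced x y := rfl

theorem one_def : (1 : TensorRing R M) = of R M 0 (scalarPow R M 1) := rfl

theorem of_zero_mul (r : R) (x : TensorRing R M) : of R M 0 (scalarPow R M r) * x = r • x := act_of_zero _ _ _ _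

theorem of_cons_mul (i : ℕ) (m : M) (y : tensorPow R M i) (x : TensorRing R M) :
    of R M (i + 1) (consPow R M m y) * x = cons R M m (of R M i y * x) := act_of_cons _ _ _ _ _ _

/-- The tensor ring `T_R(M) = ⨁_i M^{⊗i}`, with
`r * y = r y` and `(m ⊗ x) * y = m ⊗ (x * y)` for `r ∈ R`, `m ∈ M`. -/
instance : Ring (TensorRing R M) :=
  { (inferInstance : AddCommGroup (TensorRing R M)),
    (inferInstance : Mul (TensorRing R M)),
    (inferInstance : One (TensorRing R M)) with
    left_distrib := fun x y z => by simp only [mul_def, map_add]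
    right_distrib := fun x y z => by simp only [mul_def, map_add, AddMonoidHom.add_apply]
    zero_mul := fun x => by simp only [mul_def, map_zero, AddMonoidHom.zero_apply]
    mul_zero := fun x => by simp only [mul_def, map_zero]
    one_mul := fun x => by rw [one_def, of_zero_mul, one_smul]
    mul_one := fun x => by
      induction x using induction_on with
      | h0 => simp only [mul_def, map_zero, AddMonoidHom.zero_apply]
      | hs r =>
        rw [of_zero_mul, one_def, smul_of_scalarPow, mul_one]
      | hc i m y ih => rw [of_cons_mul, ih, cons_of]
      | ha x y hx hy =>
        rw [mul_def] at hx hy ⊢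
        rw [map_add, AddMonoidHom.add_apply, hx, hy]
    mul_assoc := fun x y z => by
      induction x using induction_on with
      | h0 => simp only [mul_def, map_zero, AddMonoidHom.zero_apply]
      | hs r =>
        rw [of_zero_mul, of_zero_mul, mul_def, map_smul]
        rfl
      | hc i m x ih =>
        rw [of_cons_mul, of_cons_mul, ← ih]
        generalize of R M i x * y = w
        simp only [mul_def]
        refine of_induction w ?_ (fun j w => ?_) (fun v w hv hw => ?_)
        · simp only [map_zero, AddMonoidHom.zero_apply]
        · rw [cons_of, act_of_cons]
        · simp only [map_add, AddMonoidHom.add_apply, hv, hw]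
      | ha x y hx hy =>
        simp only [mul_def, map_add, AddMonoidHom.add_apply] at hx hy ⊢
        rw [hx, hy] }

variable (R M)

/-- The ring homomorphism `R → T_R(M)` onto the summand `M^{⊗0} = R`. -/
def ofScalar : R →+* TensorRing R M where
  toFun r := of R M 0 (scalarPow R M r)
  map_zero' := map_zero (of R M 0)
  map_add' r s := map_add (of R M 0) (scalarPow R M r) (scalarPow R M s)
  map_one' := rfl
  map_mul' r s := by
    rw [of_zero_mul, smul_of_scalarPow]

/-- The inclusion `M ≅ M ⊗_R R = M^{⊗1} → T_R(M)`, `m ↦ m ⊗ 1`. -/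
def ofBimodule (m : M) : TensorRing R M :=
  of R M 1 (consPow R M m (scalarPow R M 1))

theorem ofBimodule_add (m n : M) :
    ofBimodule R M (m + n) = ofBimodule R M m + ofBimodule R M n := by
  refine Eq.trans (congrArg (of R M 1)
    (BalancedTensor.add_tmul m n (scalarPow R M 1))) ?_
  exact map_add (of R M 1) (consPow R M m (scalarPow R M 1)) (consPow R M n (scalarPow R M 1))

theorem ofBimodule_smul (r : R) (m : M) :
    ofBimodule R M (r • m) = ofScalar R M r * ofBimodule R M m := by
  refine Eq.trans ?_ (of_zero_mul r (ofBimodule R M m)).symm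
  exact map_smul (of R M 1) r (consPow R M m (scalarPow R M 1))

theorem ofBimodule_op_smul (r : R) (m : M) :
    ofBimodule R M (MulOpposite.op r • m) = ofBimodule R M m * ofScalar R M r := by
  refine Eq.trans ?_ (of_cons_mul 0 m (scalarPow R M 1) (ofScalar R M r)).symm
  rw [of_zero_mul, one_smul]
  refine Eq.trans ?_ (cons_of m 0 (scalarPow R M r)).symm
  refine congrArg (of R M 1) ((BalancedTensor.op_smul_tmul m r (1 : R)).trans ?_)
  exact congrArg (BalancedTensor.tmul R m) (mul_one r)

/-- `T_R(M)` as a right `R`-module, through `R → T_R(M)`. -/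
instance : Module Rᵐᵒᵖ (TensorRing R M) :=
  Module.compHom (TensorRing R M) (ofScalar R M).op

instance : SMulCommClass (TensorRing R M) Rᵐᵒᵖ (TensorRing R M) :=
  ⟨fun t r x => (mul_assoc t x (ofScalar R M r.unop)).symm⟩

/-- The right `R`-module structure of `T_R(M)` is that of the bimodules `M^{⊗i}`. -/
theorem op_smul_of (r : R) (i : ℕ) (y : tensorPow R M i) :
    MulOpposite.op r • of R M i y = of R M i (MulOpposite.op r • y) := by
  change of R M i y * of R M 0 (scalarPow R M r) = _
  induction i with
  | zero =>
    exact (of_zero_mul (show R from y) _).trans (smul_of_scalarPow _ _)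
  | succ i ih =>
    refine BalancedTensor.induction_on (p := fun y => of R M (i + 1) y * of R M 0 (scalarPow R M r) =
      of R M (i + 1) (MulOpposite.op r • (show tensorPow R M (i + 1) from y))) y ?_ ?_ ?_
    · change of R M (i + 1) (0 : tensorPow R M (i + 1)) * _ =
        of R M (i + 1) (MulOpposite.op r • (0 : tensorPow R M (i + 1)))
      simp
    · intro m y
      refine (of_cons_mul i m y _).trans ?_
      rw [ih, cons_of]
      rfl
    · intro y z hy hz
      change of R M (i + 1) ((show tensorPow R M (i + 1) from y) + (show tensorPow R M (i + 1) from z)) * _ =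
        of R M (i + 1) (MulOpposite.op r • ((show tensorPow R M (i + 1) from y) + (show tensorPow R M (i + 1) from z)))
      rw [map_add, add_mul, smul_add, map_add]
      exact congrArg₂ _ hy hz

end TensorRing

/-- `M` is `N`-nilpotent: `M^{⊗(N+1)} = 0`. -/
def IsNilpotentBimodule (N : ℕ) : Prop := Subsingleton (tensorPow R M (N + 1))

/-! ## The functors between `Mod(R)` and `Mod(T_R(M))`, and the class `Φ(𝒳)` -/

/-- The forgetful functor `U : Mod(T_R(M)) ⥤ Mod(R)`. -/
abbrev forgetU : ModuleCat.{u} (TensorRing R M) ⥤ ModuleCat.{u} R :=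
  ModuleCat.restrictScalars (TensorRing.ofScalar R M)

/-- The induction functor `Ind = T_R(M) ⊗_R - : Mod(R) ⥤ Mod(T_R(M))`. -/
abbrev Ind : ModuleCat.{u} R ⥤ ModuleCat.{u} (TensorRing R M) :=
  tensorFunctor (TensorRing R M) R (TensorRing R M)

/-- The structure map `u : M ⊗_R X → X`, `m ⊗ x ↦ m x`, of a `T_R(M)`-module, where `X` is its
underlying `R`-module. -/
def structureMap (A : ModuleCat.{u} (TensorRing R M)) :
    BalancedTensor R M ((forgetU R M).obj A) →ₗ[R] (forgetU R M).obj A :=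
  BalancedTensor.liftLinear
    { toFun := fun m => DistribSMul.toAddMonoidHom A (TensorRing.ofBimodule R M m)
      map_add' := fun m n => by
        ext x
        change TensorRing.ofBimodule R M (m + n) • (show A from x) = _
        rw [TensorRing.ofBimodule_add, add_smul]
        rfl
      map_smul' := fun r m => by
        ext x
        change TensorRing.ofBimodule R M (r • m) • (show A from x) =
          TensorRing.ofScalar R M r • TensorRing.ofBimodule R M m • (show A from x)
        rw [TensorRing.ofBimodule_smul, mul_smul] }
    (fun m r x => by
      change TensorRing.ofBimodule R M (MulOpposite.op r • m) • (show A from x) =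
        TensorRing.ofBimodule R M m • TensorRing.ofScalar R M r • (show A from x)
      rw [TensorRing.ofBimodule_op_smul, mul_smul])

theorem structureMap_tmul (A : ModuleCat.{u} (TensorRing R M)) (m : M) (x : A) :
    structureMap R M A (BalancedTensor.tmul R (X := (forgetU R M).obj A) m x) =
      (TensorRing.ofBimodule R M m • x : A) := rfl

/-- The class `Φ(𝒳)` of the `T_R(M)`-modules `(X, u)` such that `u` is a monomorphism and
`coker u` belongs to `𝒳`. -/
def Phi (𝒳 : ObjectProperty (ModuleCat.{u} R)) :
    ObjectProperty (ModuleCat.{u} (TensorRing R M)) := fun A =>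
  Function.Injective (structureMap R M A) ∧
    𝒳 (ModuleCat.of R ((forgetU R M).obj A ⧸ LinearMap.range (structureMap R M A)))

/-- The class `Ind(𝒳)` of the modules (isomorphic to) `Ind(X)` with `X` in `𝒳`. -/
def IndClass (𝒳 : ObjectProperty (ModuleCat.{u} R)) :
    ObjectProperty (ModuleCat.{u} (TensorRing R M)) := fun A =>
  ∃ X : ModuleCat.{u} R, 𝒳 X ∧ Nonempty (A ≅ (Ind R M).obj X)

end TensorRing

/-! ## Gorenstein projective and Ding projective modules -/

section Gorenstein

variable (R : Type u) [Ring R]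

/-- The class `Proj(R)` of projective modules. -/
def projClass : ObjectProperty (ModuleCat.{u} R) := fun P => Module.Projective R P

/-- The class `Flat(R)` of flat left modules: `- ⊗_R X` preserves injectivity of maps of right
`R`-modules. -/
def flatClass : ObjectProperty (ModuleCat.{u} R) := fun X =>
  ∀ (A B : Type u) [AddCommGroup A] [AddCommGroup B] [Module Rᵐᵒᵖ A] [Module Rᵐᵒᵖ B]
    (f : A →ₗ[Rᵐᵒᵖ] B), Function.Injective f →
      Function.Injective (BalancedTensor.map (R := R) f (LinearMap.id : X →ₗ[R] X))

variable {R}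

/-- The complex `P` of `R`-modules is exact. -/
def IsExactComplex (P : CochainComplex (ModuleCat.{u} R) ℤ) : Prop :=
  ∀ i j k : ℤ, i + 1 = j → j + 1 = k → Function.Exact (P.d i j).hom (P.d j k).hom

/-- The complex `Hom_R(P, X)` is exact. -/
def IsHomExact (P : CochainComplex (ModuleCat.{u} R) ℤ) (X : ModuleCat.{u} R) : Prop :=
  ∀ i j k : ℤ, i + 1 = j → j + 1 = k →
    Function.Exact (fun f : P.X k ⟶ X => P.d j k ≫ f) (fun f : P.X j ⟶ X => P.d i j ≫ f)

/-- `P` is an `𝒳`-complete projective resolution: an exact complex of projective modules such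
that `Hom(P, X)` is exact for each `X` in `𝒳`. -/
structure IsCompleteProjectiveResolution (𝒳 : ObjectProperty (ModuleCat.{u} R))
    (P : CochainComplex (ModuleCat.{u} R) ℤ) : Prop where
  projective : ∀ n, Module.Projective R (P.X n)
  exact : IsExactComplex P
  homExact : ∀ X, 𝒳 X → IsHomExact P X

/-- The class of `𝒳`-Gorenstein projective modules: those isomorphic to `Im(P⁻¹ → P⁰)` for an
`𝒳`-complete projective resolution `P`. -/
def gorensteinProjective (𝒳 : ObjectProperty (ModuleCat.{u} R)) :
    ObjectProperty (ModuleCat.{u} R) := fun G =>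
  ∃ P : CochainComplex (ModuleCat.{u} R) ℤ, IsCompleteProjectiveResolution 𝒳 P ∧
    Nonempty (G ≃ₗ[R] LinearMap.range (P.d (-1) 0).hom)

variable (R)

/-- The class of Gorenstein projective `R`-modules. -/
def GP : ObjectProperty (ModuleCat.{u} R) := gorensteinProjective (projClass R)

/-- The class of Ding projective `R`-modules. -/
def DP : ObjectProperty (ModuleCat.{u} R) := gorensteinProjective (flatClass R)

end Gorenstein

/-! ## Compatible and admissible bimodules -/

section Conditions

variable (R : Type u) [Ring R] (M : Type u) [AddCommGroup M] [Module R M] [Module Rᵐᵒᵖ M]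
  [SMulCommClass R Rᵐᵒᵖ M] (𝒳 : ObjectProperty (ModuleCat.{u} R))

/-- `M` is compatible with respect to `𝒳`: for each `Ind(𝒳)`-complete projective resolution `Q` of
`T_R(M)`-modules, the complexes `M ⊗_R U(Q)` and `Hom(Q, Ind(M ⊗_R X))`, `X ∈ 𝒳`, are exact. -/
structure IsCompatible : Prop where
  tensor_exact : ∀ Q : CochainComplex (ModuleCat.{u} (TensorRing R M)) ℤ,
    IsCompleteProjectiveResolution (IndClass R M 𝒳) Q →
      IsExactComplex
        (((forgetU R M ⋙ tensorFunctor R R M).mapHomologicalComplex (ComplexShape.up ℤ)).obj Q)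
  hom_exact : ∀ Q : CochainComplex (ModuleCat.{u} (TensorRing R M)) ℤ,
    IsCompleteProjectiveResolution (IndClass R M 𝒳) Q → ∀ X, 𝒳 X →
      IsHomExact Q ((Ind R M).obj ((tensorFunctor R R M).obj X))

/-- `Tor_1^R(M, X) = 0`, where `Tor_n^R(M, -)` is the `n`-th left derived functor of `M ⊗_R -`. -/
def TorOneVanishes (X : ModuleCat.{u} R) : Prop :=
  Limits.IsZero (((tensorFunctor R R M).leftDerived 1).obj X)

/-- `Ext^1_R(G, Y) = 0`. -/
def ExtOneVanishes {R : Type u} [Ring R] (G Y : ModuleCat.{u} R) : Prop :=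
  Subsingleton (Abelian.Ext.{u} G Y 1)

/-- `M` is admissible with respect to `𝒳`:
`Ext^1_R(G, M^{⊗i} ⊗_R X) = 0 = Tor_1^R(M, M^{⊗i} ⊗_R G)` for all `𝒳`-Gorenstein projective `G`,
all `X ∈ 𝒳` and all `i ≥ 0`. -/
structure IsAdmissible : Prop where
  ext_eq_zero : ∀ G, gorensteinProjective 𝒳 G → ∀ X, 𝒳 X → ∀ i : ℕ,
    ExtOneVanishes G ((tensorFunctor R R (tensorPow R M i)).obj X)
  tor_eq_zero : ∀ G, gorensteinProjective 𝒳 G → ∀ i : ℕ,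
    TorOneVanishes R M ((tensorFunctor R R (tensorPow R M i)).obj G)

end Conditions

end

/-! Write `T` for the tensor ring. A `T`-module is an `R`-module `Y` with a map `u : M ⊗ Y → Y`, and
everything is read off from the functor `(Y, u) ↦ coker u`. It is left adjoint to the exact functor
letting `M` act by zero (`Triv`), and it sends `Ind X` to `X`. The map `u` is a split monomorphism
on every projective `T`-module, such a module being a summand of an induced one, and a pure
monomorphism on every flat one. The cokernel of `u` is again projective, respectively flat.

Gorenstein modules over `T` lie in `Φ` by compatibility (`gorensteinProjective_le_phi`). Let `Q` be
a complete resolution over `T`. Exactness of `M ⊗ Q` and injectivity of the actions on the terms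
make the complex of cokernels exact. Moreover `Hom(coker, X) = Hom(Q, Triv X)`, which is exact
because of the sequence `0 → Ind (M ⊗ X) → Ind X → Triv X → 0` and the hypothesis on `Ind (M ⊗ X)`.
So the cokernels form a complete resolution over `R`, and the same chase identifies the cokernel of
the action on `Im(Q⁻¹ → Q⁰)` with the corresponding image.

Conversely, admissibility and nilpotence put `Φ` inside the Gorenstein class
(`phi_le_gorensteinProjective`). By `le_gorensteinProjective` it is enough to find, for `(Y, u)` in
`Φ` with cokernel `G`, a projective cover-like sequence and a projective embedding that stay inside
`Φ`, and to extend maps into the test modules. The one technique is induction on powers of `M`: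
tensoring with `M` replaces `Y` by `M ⊗ Y` and `G` by `M ⊗ G`, and the process stops because
`M^{⊗(N+1)} ⊗ Y = 0`. It yields Nakayama's lemma (`surjective_of_tensorIter`), the vanishing of
`Tor₁(M, Y)` (`isTorAcyclic_of_tensorIter`), injectivity tested on cokernels
(`injective_of_tensorIter`), and an extension theorem playing the role of `Ext¹_T(Y, W) = 0`
(`exists_extension_of_tensorIter`). For the last, the target `W` is filtered instead of `Y`; this
needs its action to be pure and its cokernel to lie in `𝒳`, which is why projective and flat test
modules both work. -/

noncomputable section

/-! ### Right exactness, purity and associativity of the balanced tensor product. -/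

namespace BalancedTensor

section Exactness

variable {R : Type u} [Ring R] {A : Type v} [AddCommGroup A] [Module Rᵐᵒᵖ A]
  {A' : Type v} [AddCommGroup A'] [Module Rᵐᵒᵖ A']
  {X Y Z : Type w} [AddCommGroup X] [Module R X] [AddCommGroup Y] [Module R Y]
  [AddCommGroup Z] [Module R Z]

theorem tmul_zero (a : A) : tmul R a (0 : X) = 0 := by
  simpa using tmul_add (R := R) a (0 : X) 0

theorem zero_tmul (x : X) : tmul R (0 : A) x = 0 := by
  simpa using add_tmul (R := R) (0 : A) 0 x

/-- The universal property, for a map given as a function of two variables. -/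
def liftMk {B : Type t} [AddCommGroup B] (f : A → X → B)
    (h₁ : ∀ a b x, f (a + b) x = f a x + f b x) (h₂ : ∀ a x y, f a (x + y) = f a x + f a y)
    (h₃ : ∀ a (r : R) x, f (MulOpposite.op r • a) x = f a (r • x)) : BalancedTensor R A X →+ B :=
  lift (AddMonoidHom.mk' (fun a => AddMonoidHom.mk' (f a) (h₂ a)) (fun a b => by
    ext x
    exact h₁ a b x)) h₃

theorem map_add_right (f : A →ₗ[Rᵐᵒᵖ] A') (g g' : X →ₗ[R] Y) :
    map f (g + g') = map f g + map f g' :=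
  addHom_ext fun _ _ => tmul_add _ _ _

theorem map_add_left (f f' : A →ₗ[Rᵐᵒᵖ] A') (g : X →ₗ[R] Y) :
    map (f + f') g = map f g + map f' g :=
  addHom_ext fun _ _ => add_tmul _ _ _

theorem map_id_id (z : BalancedTensor R A X) :
    map (LinearMap.id : A →ₗ[Rᵐᵒᵖ] A) (LinearMap.id : X →ₗ[R] X) z = z :=
  DFunLike.congr_fun (f := map LinearMap.id LinearMap.id) (g := AddMonoidHom.id _)
    (addHom_ext fun _ _ => rfl) z

theorem map_map {A'' : Type v} [AddCommGroup A''] [Module Rᵐᵒᵖ A'']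
    (f : A →ₗ[Rᵐᵒᵖ] A') (f' : A' →ₗ[Rᵐᵒᵖ] A'') (g : X →ₗ[R] Y) (g' : Y →ₗ[R] Z)
    (z : BalancedTensor R A X) :
    map f' g' (map f g z) = map (f' ∘ₗ f) (g' ∘ₗ g) z :=
  DFunLike.congr_fun (f := (map f' g').comp (map f g)) (g := map (f' ∘ₗ f) (g' ∘ₗ g))
    (addHom_ext fun _ _ => rfl) z

theorem map_surjective (g : X →ₗ[R] Y) (hg : Function.Surjective g) :
    Function.Surjective (map (LinearMap.id : A →ₗ[Rᵐᵒᵖ] A) g) := by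
  intro z
  induction z using induction_on with
  | h0 => exact ⟨0, map_zero _⟩
  | ht a y =>
    obtain ⟨x, rfl⟩ := hg y
    exact ⟨tmul R a x, rfl⟩
  | ha y z hy hz =>
    obtain ⟨y', rfl⟩ := hy
    obtain ⟨z', rfl⟩ := hz
    exact ⟨y' + z', map_add _ _ _⟩

/-- The functor `A ⊗_R -` is right exact. -/
theorem map_exact (f : X →ₗ[R] Y) (g : Y →ₗ[R] Z) (h : Function.Exact f g)
    (hg : Function.Surjective g) :
    Function.Exact (map (LinearMap.id : A →ₗ[Rᵐᵒᵖ] A) f)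
      (map (LinearMap.id : A →ₗ[Rᵐᵒᵖ] A) g) := by
  let F := map (LinearMap.id : A →ₗ[Rᵐᵒᵖ] A) f
  let q := QuotientAddGroup.mk' F.range
  -- Modulo the image of `A ⊗ f`, the class of `a ⊗ y` depends only on `g y`. Hence a set-theoretic
  -- section of `g` is enough to define a biadditive balanced map on `A × Z`, giving an inverse to
  -- the map from the cokernel.
  have key : ∀ a y y', g y = g y' → q (tmul R a y) = q (tmul R a y') := by
    intro a y y' e
    obtain ⟨x, hx⟩ := (h (y - y')).1 (by rw [map_sub, e, sub_self])
    have e' : y = y' + f x := by rw [hx]; abel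
    have hF : q (F (tmul R a x)) = 0 := (QuotientAddGroup.eq_zero_iff _).2 ⟨_, rfl⟩
    rw [e', tmul_add, map_add]
    exact (congrArg _ hF).trans (add_zero _)
  let s := Function.surjInv hg
  have hs : ∀ z, g (s z) = z := Function.surjInv_eq hg
  let inv : BalancedTensor R A Z →+ BalancedTensor R A Y ⧸ F.range :=
    lift (AddMonoidHom.mk' (fun a => AddMonoidHom.mk' (fun z => q (tmul R a (s z)))
        (fun z z' => by
          rw [← map_add, ← tmul_add]
          exact key _ _ _ (by rw [map_add, hs, hs, hs])))
        (fun a b => by ext z; simp [add_tmul]))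
      (fun a r z => by
        simp only [AddMonoidHom.mk'_apply, op_smul_tmul]
        exact key _ _ _ (by rw [map_smul, hs, hs]))
  have hinv : ∀ y, inv (map LinearMap.id g y) = q y := fun y =>
    DFunLike.congr_fun (f := inv.comp (map LinearMap.id g)) (g := q)
      (addHom_ext fun a y => key _ _ _ (hs _)) y
  intro y
  constructor
  · intro hy
    have := hinv y
    rw [hy, map_zero] at this
    exact (QuotientAddGroup.eq_zero_iff _).1 this.symm
  · rintro ⟨x, rfl⟩
    rw [map_map, h.linearMap_comp_eq_zero]
    refine DFunLike.congr_fun (f := map (LinearMap.id ∘ₗ LinearMap.id) (0 : X →ₗ[R] Z)) (g := 0)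
      (addHom_ext fun a x => ?_) x
    simp [tmul_zero]

/-- An injection `g` such that `A ⊗ g` is injective for every right module `A`. -/
def IsPure {R : Type u} [Ring R] {X Y : Type u} [AddCommGroup X] [Module R X] [AddCommGroup Y]
    [Module R Y] (g : X →ₗ[R] Y) : Prop :=
  ∀ (A : Type u) [AddCommGroup A] [Module Rᵐᵒᵖ A],
    Function.Injective (map (LinearMap.id : A →ₗ[Rᵐᵒᵖ] A) g)

theorem isPure_of_retraction {R : Type u} [Ring R] {X Y : Type u} [AddCommGroup X] [Module R X]
    [AddCommGroup Y] [Module R Y] (g : X →ₗ[R] Y) (r : Y →ₗ[R] X) (h : r ∘ₗ g = LinearMap.id) :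
    IsPure g := fun A _ _ =>
  Function.LeftInverse.injective (g := map LinearMap.id r) fun z => by
    rw [map_map, h]
    exact map_id_id z

end Exactness

section LTensor

variable {R : Type u} [Ring R] {S : Type t} [Ring S]
  {A : Type v} [AddCommGroup A] [Module S A] [Module Rᵐᵒᵖ A] [SMulCommClass S Rᵐᵒᵖ A]
  {X Y Z : Type w} [AddCommGroup X] [Module R X] [AddCommGroup Y] [Module R Y]
  [AddCommGroup Z] [Module R Z]

theorem lTensor_comp (f : X →ₗ[R] Y) (g : Y →ₗ[R] Z) :
    lTensor S A (g ∘ₗ f) = lTensor S A g ∘ₗ lTensor S A f :=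
  linearMap_ext fun _ _ => rfl

theorem lTensor_lTensor (f : X →ₗ[R] Y) (g : Y →ₗ[R] Z) (z : BalancedTensor R A X) :
    lTensor S A g (lTensor S A f z) = lTensor S A (g ∘ₗ f) z := by
  rw [lTensor_comp]; rfl

theorem lTensor_id : lTensor S A (LinearMap.id : X →ₗ[R] X) = LinearMap.id :=
  linearMap_ext fun _ _ => rfl

theorem lTensor_zero : lTensor S A (0 : X →ₗ[R] Y) = 0 :=
  linearMap_ext fun a _ => tmul_zero a

theorem lTensor_surjective (g : X →ₗ[R] Y) (hg : Function.Surjective g) :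
    Function.Surjective (lTensor S A g) :=
  map_surjective g hg

theorem lTensor_exact (f : X →ₗ[R] Y) (g : Y →ₗ[R] Z) (h : Function.Exact f g)
    (hg : Function.Surjective g) : Function.Exact (lTensor S A f) (lTensor S A g) :=
  map_exact f g h hg

/-- The isomorphism `A ⊗ X ≅ A ⊗ Y` induced by an isomorphism `X ≅ Y`. -/
def lTensorEquiv (S : Type t) [Ring S] (A : Type v) [AddCommGroup A] [Module S A] [Module Rᵐᵒᵖ A]
    [SMulCommClass S Rᵐᵒᵖ A] (e : X ≃ₗ[R] Y) : BalancedTensor R A X ≃ₗ[S] BalancedTensor R A Y :=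
  LinearEquiv.ofLinearMap (lTensor S A e.toLinearMap) (lTensor S A e.symm.toLinearMap)
    (by rw [← lTensor_comp]; simp [lTensor_id]) (by rw [← lTensor_comp]; simp [lTensor_id])

variable (R X) in
/-- The isomorphism `R ⊗_R X ≅ X`. -/
def ringTensorEquiv : BalancedTensor R R X ≃ₗ[R] X :=
  LinearEquiv.ofLinearMap
    (liftLinear
      { toFun := fun r => DistribSMul.toAddMonoidHom X r
        map_add' := fun r s => by ext x; exact add_smul r s x
        map_smul' := fun r s => by ext x; exact mul_smul r s x }
      (fun a r x => mul_smul a r x))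
    { toFun := fun x => tmul R 1 x
      map_add' := tmul_add 1
      map_smul' := fun r x => by
        rw [← op_smul_tmul]
        simp }
    (by ext x; exact one_smul R x)
    (linearMap_ext fun a x => by
      refine (op_smul_tmul (R := R) (1 : R) a x).symm.trans ?_
      simp)

end LTensor

section Assoc

variable {R : Type u} [Ring R]
  {A : Type u} [AddCommGroup A] [Module Rᵐᵒᵖ A]
  {M : Type u} [AddCommGroup M] [Module R M] [Module Rᵐᵒᵖ M] [SMulCommClass R Rᵐᵒᵖ M]
  {X : Type u} [AddCommGroup X] [Module R X] {Y : Type u} [AddCommGroup Y] [Module R Y]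

attribute [local instance] BalancedTensor.rightModule

variable (R M) in
/-- The map `m ↦ m ⊗ x`. -/
def tmulRight (x : X) : M →ₗ[R] BalancedTensor R M X where
  toFun m := tmul R m x
  map_add' m n := add_tmul m n x
  map_smul' _ _ := rfl

variable (R M) in
/-- The map `m ↦ a ⊗ m`. -/
def tmulLeft (a : A) : M →ₗ[Rᵐᵒᵖ] BalancedTensor R A M where
  toFun m := tmul R a m
  map_add' m n := tmul_add a m n
  map_smul' _ _ := rfl

variable (R A M X) in
/-- The associativity `(A ⊗ M) ⊗ X → A ⊗ (M ⊗ X)`. -/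
def assocHom : BalancedTensor R (BalancedTensor R A M) X →+
    BalancedTensor R A (BalancedTensor R M X) :=
  liftMk (fun z x => map LinearMap.id (tmulRight R M x) z)
    (fun y z x => map_add _ y z)
    (fun z x y => by
      rw [← AddMonoidHom.add_apply, ← map_add_right]
      congr 2
      ext m
      exact tmul_add m x y)
    (fun z r x => by
      refine (map_map _ _ _ _ z).trans ?_
      congr 2
      ext m
      exact op_smul_tmul m r x)

variable (R A M X) in
/-- The associativity `A ⊗ (M ⊗ X) → (A ⊗ M) ⊗ X`. -/
def assocInvHom : BalancedTensor R A (BalancedTensor R M X) →+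
    BalancedTensor R (BalancedTensor R A M) X :=
  liftMk (fun a z => map (tmulLeft R M a) LinearMap.id z)
    (fun a b z => by
      rw [← AddMonoidHom.add_apply, ← map_add_left]
      congr 2
      ext m
      exact add_tmul a b m)
    (fun a y z => map_add _ y z)
    (fun a r z => by
      refine Eq.trans ?_ (map_map _ _ _ _ z).symm
      congr 2
      ext m
      exact op_smul_tmul a r m)

theorem assocInvHom_assocHom (z : BalancedTensor R (BalancedTensor R A M) X) :
    assocInvHom R A M X (assocHom R A M X z) = z := by
  refine DFunLike.congr_fun (f := (assocInvHom R A M X).comp (assocHom R A M X))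
    (g := AddMonoidHom.id _) (addHom_ext fun y x => ?_) z
  induction y using induction_on with
  | h0 => simp [zero_tmul]
  | ht a m => rfl
  | ha y z hy hz => rw [add_tmul, map_add, map_add, hy, hz]

theorem assocHom_assocInvHom (z : BalancedTensor R A (BalancedTensor R M X)) :
    assocHom R A M X (assocInvHom R A M X z) = z := by
  refine DFunLike.congr_fun (f := (assocHom R A M X).comp (assocInvHom R A M X))
    (g := AddMonoidHom.id _) (addHom_ext fun a y => ?_) z
  induction y using induction_on with
  | h0 => simp [tmul_zero]
  | ht m x => rfl
  | ha y z hy hz => rw [tmul_add, map_add, map_add, hy, hz]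

theorem assocInvHom_injective : Function.Injective (assocInvHom R A M X) :=
  Function.LeftInverse.injective assocHom_assocInvHom

theorem assocHom_injective : Function.Injective (assocHom R A M X) :=
  Function.LeftInverse.injective assocInvHom_assocHom

theorem assocInvHom_map (g : X →ₗ[R] Y) (z : BalancedTensor R A (BalancedTensor R M X)) :
    assocInvHom R A M Y (map LinearMap.id (lTensor R M g) z) =
      map LinearMap.id g (assocInvHom R A M X z) := by
  refine DFunLike.congr_fun (f := (assocInvHom R A M Y).comp (map LinearMap.id (lTensor R M g)))
    (g := (map LinearMap.id g).comp (assocInvHom R A M X)) (addHom_ext fun a y => ?_) z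
  induction y using induction_on with
  | h0 => simp [tmul_zero]
  | ht m x => rfl
  | ha y z hy hz => rw [tmul_add, map_add, map_add, hy, hz]

theorem IsPure.injective_lTensor {g : X →ₗ[R] Y} (hg : IsPure g) :
    Function.Injective (lTensor R M g) :=
  hg M

/-- By associativity `A ⊗ (M ⊗ g)` is `(A ⊗ M) ⊗ g`, so purity of `g` is applied to the right module
`A ⊗ M`. This stability under `M ⊗ -` is what lets purity survive the inductions on powers of `M`.
-/
theorem IsPure.lTensor {g : X →ₗ[R] Y} (hg : IsPure g) : IsPure (lTensor R M g) :=
  fun A _ _ z z' h => assocInvHom_injective (hg (BalancedTensor R A M)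
    (by rw [← assocInvHom_map, ← assocInvHom_map, h]))

theorem IsPure.injective {g : X →ₗ[R] Y} (hg : IsPure g) : Function.Injective g := by
  intro x y h
  apply (ringTensorEquiv R X).symm.injective
  exact hg R (congrArg (tmul R (1 : R)) h)

end Assoc

end BalancedTensor

/-! ### Projective modules are flat. -/

section FlatOfProjective

variable {R : Type u} [Ring R]

/-- Under `A ⊗ R^(ι) ≅ A^(ι)` the map `f ⊗ 1` becomes `f` applied coordinatewise. Only the left
inverse `χ` of the comparison map `ψ` is needed. -/
theorem flatClass_finsupp (ι : Type u) : flatClass R (ModuleCat.of R (ι →₀ R)) := by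
  intro A B _ _ _ _ f hf
  let ψ (C : Type u) [AddCommGroup C] [Module Rᵐᵒᵖ C] : BalancedTensor R C (ι →₀ R) →+ (ι →₀ C) :=
    BalancedTensor.lift (AddMonoidHom.mk' (fun c => AddMonoidHom.mk'
        (fun x => x.mapRange (fun r => MulOpposite.op r • c) (by simp))
        (fun x y => by ext i; simp [add_smul]))
        (fun c d => by ext x i; simp))
      (fun c r x => by ext i; simp [mul_smul])
  let χ : (ι →₀ A) →+ BalancedTensor R A (ι →₀ R) :=
    Finsupp.liftAddHom fun i => AddMonoidHom.mk' (fun a => BalancedTensor.tmul R a (Finsupp.single i 1))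
      (fun a b => BalancedTensor.add_tmul a b _)
  have hχ : ∀ z, χ (ψ A z) = z := by
    refine fun z => DFunLike.congr_fun (f := χ.comp (ψ A)) (g := AddMonoidHom.id _)
      (BalancedTensor.addHom_ext fun a x => ?_) z
    induction x using Finsupp.induction_linear with
    | zero => simp [BalancedTensor.tmul_zero]
    | add x y hx hy => rw [BalancedTensor.tmul_add, map_add, map_add, hx, hy]
    | single i r =>
      simp only [AddMonoidHom.comp_apply, AddMonoidHom.id_apply, ψ, BalancedTensor.lift_tmul,
        AddMonoidHom.mk'_apply, Finsupp.mapRange_single, χ, Finsupp.liftAddHom_apply_single,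
        BalancedTensor.op_smul_tmul, Finsupp.smul_single, smul_eq_mul, mul_one]
  have hnat : ∀ z, ψ B (BalancedTensor.map f LinearMap.id z) = (ψ A z).mapRange f (map_zero f) := by
    refine fun z => DFunLike.congr_fun (f := (ψ B).comp (BalancedTensor.map f LinearMap.id))
      (g := (Finsupp.mapRange.addMonoidHom f.toAddMonoidHom).comp (ψ A))
      (BalancedTensor.addHom_ext fun a x => ?_) z
    ext i
    simp [ψ]
  intro z z' h
  rw [← hχ z, ← hχ z']
  refine congrArg χ (Finsupp.mapRange_injective f (map_zero f) hf ?_)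
  rw [← hnat, ← hnat]
  exact congrArg _ h

theorem flatClass_of_retract {X Y : Type u} [AddCommGroup X] [Module R X] [AddCommGroup Y]
    [Module R Y] (i : X →ₗ[R] Y) (r : Y →ₗ[R] X) (h : r ∘ₗ i = LinearMap.id)
    (hY : flatClass R (ModuleCat.of R Y)) : flatClass R (ModuleCat.of R X) := by
  intro A B _ _ _ _ f hf z z' e
  have h1 : Function.Injective (BalancedTensor.map (LinearMap.id : A →ₗ[Rᵐᵒᵖ] A) i) :=
    BalancedTensor.isPure_of_retraction i r h A
  apply h1
  apply hY A B f hf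
  have hc : ∀ z : BalancedTensor R A X, BalancedTensor.map f (LinearMap.id : Y →ₗ[R] Y)
      (BalancedTensor.map LinearMap.id i z) =
      BalancedTensor.map LinearMap.id i (BalancedTensor.map f (LinearMap.id : X →ₗ[R] X) z) :=
    fun z => by rw [BalancedTensor.map_map, BalancedTensor.map_map]; rfl
  exact (hc z).trans ((congrArg _ e).trans (hc z').symm)

/-- In the Ding case the coresolution is built from projective modules, to which the `Ext` condition
for the flat class must apply. -/
theorem projClass_le_flatClass : projClass R ≤ flatClass R := by
  intro P hP
  have : Module.Projective R P := hP
  obtain ⟨s, hs⟩ := Module.projective_def'.1 this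
  exact flatClass_of_retract s _ hs (flatClass_finsupp P)

theorem flatClass_of_linearEquiv {X Y : Type u} [AddCommGroup X] [Module R X] [AddCommGroup Y]
    [Module R Y] (e : X ≃ₗ[R] Y) (hY : flatClass R (ModuleCat.of R Y)) :
    flatClass R (ModuleCat.of R X) :=
  flatClass_of_retract e.toLinearMap e.symm.toLinearMap (by ext; simp) hY

end FlatOfProjective

/-! ### Modules over the tensor ring as modules with an action of `M`; induced modules. -/

namespace TensorRing

variable {R : Type u} [Ring R] {M : Type u} [AddCommGroup M] [Module R M] [Module Rᵐᵒᵖ M]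
  [SMulCommClass R Rᵐᵒᵖ M]

theorem ofScalar_mul (r : R) (t : TensorRing R M) : ofScalar R M r * t = r • t :=
  of_zero_mul r t

theorem ofBimodule_mul (m : M) (t : TensorRing R M) : ofBimodule R M m * t = cons R M m t := by
  refine (of_cons_mul 0 m (scalarPow R M 1) t).trans ?_
  rw [of_zero_mul, one_smul]

theorem ofBimodule_mul_of (m : M) (i : ℕ) (y : tensorPow R M i) :
    ofBimodule R M m * of R M i y = of R M (i + 1) (consPow R M m y) := by
  rw [ofBimodule_mul, cons_of]

/-- The tensor ring is generated by `R` and `M`. -/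
@[elab_as_elim]
theorem mul_induction_on {p : TensorRing R M → Prop} (x : TensorRing R M) (h0 : p 0)
    (hs : ∀ r : R, p (ofScalar R M r)) (hc : ∀ m y, p y → p (ofBimodule R M m * y))
    (ha : ∀ x y, p x → p y → p (x + y)) : p x := by
  induction x using induction_on with
  | h0 => exact h0
  | hs r => exact hs r
  | hc i m y ih =>
    rw [← ofBimodule_mul_of]
    exact hc m _ ih
  | ha x y hx hy => exact ha x y hx hy

instance : IsScalarTower R (TensorRing R M) (TensorRing R M) :=
  ⟨fun r t t' => by
    rw [← ofScalar_mul, ← ofScalar_mul, smul_eq_mul, smul_eq_mul, mul_assoc]⟩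

instance (X : Type u) [AddCommGroup X] [Module R X] :
    Module R (BalancedTensor R (TensorRing R M) X) :=
  Module.compHom _ (ofScalar R M)

theorem isScalarTower_of_ofScalar_smul {W : Type u} [AddCommGroup W] [Module R W]
    [Module (TensorRing R M) W] (h : ∀ (r : R) (w : W), ofScalar R M r • w = r • w) :
    IsScalarTower R (TensorRing R M) W :=
  ⟨fun r t w => by rw [← h, ← ofScalar_mul, mul_smul]⟩

instance (X : Type u) [AddCommGroup X] [Module R X] :
    IsScalarTower R (TensorRing R M) (BalancedTensor R (TensorRing R M) X) :=
  isScalarTower_of_ofScalar_smul fun _ _ => rfl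

section Modules

variable {W : Type u} [AddCommGroup W] [Module R W] [Module (TensorRing R M) W]
  [IsScalarTower R (TensorRing R M) W]
  {W' : Type u} [AddCommGroup W'] [Module R W'] [Module (TensorRing R M) W']
  [IsScalarTower R (TensorRing R M) W']

theorem ofScalar_smul (r : R) (w : W) : ofScalar R M r • w = r • w := by
  rw [← mul_one (ofScalar R M r), ofScalar_mul, smul_assoc, one_smul]

variable (R M W) in
/-- The map `M ⊗ W → W` given by the action of `M` on a module over the tensor ring. -/
def actionMap : BalancedTensor R M W →ₗ[R] W :=
  BalancedTensor.liftLinear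
    { toFun := fun m => DistribSMul.toAddMonoidHom W (ofBimodule R M m)
      map_add' := fun m n => by
        ext w
        simp [ofBimodule_add, add_smul]
      map_smul' := fun r m => by
        ext w
        simp [ofBimodule_smul, mul_smul, ofScalar_smul] }
    (fun m r w => by simp [ofBimodule_op_smul, mul_smul, ofScalar_smul])

@[simp]
theorem actionMap_tmul (m : M) (w : W) :
    actionMap R M W (BalancedTensor.tmul R m w) = ofBimodule R M m • w := rfl

theorem actionMap_natural (f : W →ₗ[TensorRing R M] W') :
    actionMap R M W' ∘ₗ BalancedTensor.lTensor R M (f.restrictScalars R) =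
      f.restrictScalars R ∘ₗ actionMap R M W :=
  BalancedTensor.linearMap_ext fun m w => (map_smul f (ofBimodule R M m) w).symm

theorem actionMap_natural_apply (f : W →ₗ[TensorRing R M] W') (z : BalancedTensor R M W) :
    actionMap R M W' (BalancedTensor.lTensor R M (f.restrictScalars R) z) =
      f (actionMap R M W z) :=
  LinearMap.congr_fun (actionMap_natural f) z

/-- An `R`-linear map commuting with the action of `M` is linear over the tensor ring. -/
def linearMapOfComm (f : W →ₗ[R] W')
    (h : actionMap R M W' ∘ₗ BalancedTensor.lTensor R M f = f ∘ₗ actionMap R M W) :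
    W →ₗ[TensorRing R M] W' where
  toFun := f
  map_add' := map_add f
  map_smul' t w := by
    rw [RingHom.id_apply]
    induction t using mul_induction_on with
    | h0 => simp
    | hs r => rw [ofScalar_smul, ofScalar_smul, map_smul]
    | hc m y ih =>
      rw [mul_smul, mul_smul, ← ih]
      exact (LinearMap.congr_fun h (BalancedTensor.tmul R m (y • w))).symm
    | ha x y hx hy => rw [add_smul, add_smul, map_add, hx, hy]

end Modules

section Induced

variable {X : Type u} [AddCommGroup X] [Module R X]

/-- Induction on `Ind X`. -/
@[elab_as_elim]
theorem ind_induction_on {p : BalancedTensor R (TensorRing R M) X → Prop}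
    (z : BalancedTensor R (TensorRing R M) X) (h0 : p 0)
    (h1 : ∀ x, p (BalancedTensor.tmul R 1 x))
    (hm : ∀ (m : M) z, p z → p (ofBimodule R M m • z))
    (ha : ∀ y z, p y → p z → p (y + z)) : p z := by
  induction z using BalancedTensor.induction_on with
  | h0 => exact h0
  | ht t x =>
    induction t using mul_induction_on with
    | h0 => rw [BalancedTensor.zero_tmul]; exact h0
    | hs r =>
      rw [show ofScalar R M r = MulOpposite.op r • (1 : TensorRing R M) from (one_mul _).symm,
        BalancedTensor.op_smul_tmul]
      exact h1 _
    | hc m y ih => exact hm m _ ih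
    | ha y z hy hz => rw [BalancedTensor.add_tmul]; exact ha _ _ hy hz
  | ha y z hy hz => exact ha y z hy hz

variable (R M X) in
/-- The unit `X → Ind X`. -/
def indUnit : X →ₗ[R] BalancedTensor R (TensorRing R M) X where
  toFun x := BalancedTensor.tmul R 1 x
  map_add' := BalancedTensor.tmul_add _
  map_smul' r x := by
    rw [← BalancedTensor.op_smul_tmul]
    exact congrArg (fun t => BalancedTensor.tmul R t x) ((one_mul _).trans (mul_one _).symm)

variable {E : Type u} [AddCommGroup E] [Module R E]

/-- The universal property of `Ind X`: an `R`-linear map from `X` to an `R`-module `E` with a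
map `u : M ⊗ E → E` extends to `Ind X`. -/
theorem exists_ind_lift (u : BalancedTensor R M E →ₗ[R] E) (f : X →ₗ[R] E) :
    ∃ φ : BalancedTensor R (TensorRing R M) X →ₗ[R] E,
      u ∘ₗ BalancedTensor.lTensor R M φ = φ ∘ₗ actionMap R M _ ∧ φ ∘ₗ indUnit R M X = f := by
  let u' : M →ₗ[R] E →+ E :=
    { toFun := fun m => AddMonoidHom.mk' (fun e => u (BalancedTensor.tmul R m e))
        (fun e e' => by rw [BalancedTensor.tmul_add, map_add])
      map_add' := fun m n => by
        ext e
        exact (congrArg u (BalancedTensor.add_tmul m n e)).trans (map_add u _ _)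
      map_smul' := fun r m => by
        ext e
        exact map_smul u r (BalancedTensor.tmul R m e) }
  have hu' : ∀ m (r : R) e, u' (MulOpposite.op r • m) e = u' m (r • e) := fun m r e =>
    congrArg u (BalancedTensor.op_smul_tmul m r e)
  have act_cons : ∀ m t e, act u' hu' (ofBimodule R M m * t) e = u' m (act u' hu' t e) := by
    intro m t e
    refine of_induction t ?_ (fun j w => ?_) (fun v w hv hw => ?_)
    · simp
    · rw [ofBimodule_mul_of, act_of_cons]
    · simp only [mul_add, map_add, AddMonoidHom.add_apply, hv, hw]
  have act_scalar : ∀ r e, act u' hu' (ofScalar R M r) e = r • e := fun r e =>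
    act_of_zero u' hu' r e
  have act_mul_scalar : ∀ t r e, act u' hu' (t * ofScalar R M r) e = act u' hu' t (r • e) := by
    intro t r e
    induction t using mul_induction_on with
    | h0 => simp
    | hs s => rw [← map_mul, act_scalar, act_scalar, mul_smul]
    | hc m y ih => rw [mul_assoc, act_cons, act_cons, ih]
    | ha x y hx hy => simp only [add_mul, map_add, AddMonoidHom.add_apply, hx, hy]
  let φ₀ : BalancedTensor R (TensorRing R M) X →+ E :=
    BalancedTensor.liftMk (fun t x => act u' hu' t (f x))
      (fun a b x => by rw [map_add, AddMonoidHom.add_apply])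
      (fun a x y => by rw [map_add, map_add])
      (fun t r x => (act_mul_scalar t r (f x)).trans (by rw [map_smul f r x]))
  have hr : ∀ (r : R) z, φ₀ (r • z) = r • φ₀ z := by
    intro r z
    induction z using BalancedTensor.induction_on with
    | h0 => rw [smul_zero, map_zero, smul_zero]
    | ht t x =>
      change act u' hu' (ofScalar R M r * t) (f x) = r • act u' hu' t (f x)
      rw [ofScalar_mul, map_smul]
      rfl
    | ha y z hy hz => rw [smul_add, map_add, map_add, smul_add, hy, hz]
  refine ⟨{ φ₀ with map_smul' := hr }, BalancedTensor.linearMap_ext fun m z => ?_, ?_⟩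
  · change u (BalancedTensor.tmul R m (φ₀ z)) = φ₀ (ofBimodule R M m • z)
    induction z using BalancedTensor.induction_on with
    | h0 => rw [smul_zero, map_zero, BalancedTensor.tmul_zero, map_zero]
    | ht t x => exact (act_cons m t (f x)).symm
    | ha y z hy hz => rw [smul_add, map_add, map_add, BalancedTensor.tmul_add, map_add, hy, hz]
  · ext x
    change act u' hu' (ofScalar R M 1) (f x) = f x
    rw [act_scalar, one_smul]

/-- `Ind X` is generated by `X` under the action of `M`, so this is the uniqueness half of the
universal property. As in the existence half, the target is any pair `(E, u)` and need not be
presented as a `T`-module. -/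
theorem ind_hom_ext {u : BalancedTensor R M E →ₗ[R] E}
    {φ ψ : BalancedTensor R (TensorRing R M) X →ₗ[R] E}
    (hφ : u ∘ₗ BalancedTensor.lTensor R M φ = φ ∘ₗ actionMap R M _)
    (hψ : u ∘ₗ BalancedTensor.lTensor R M ψ = ψ ∘ₗ actionMap R M _)
    (h : φ ∘ₗ indUnit R M X = ψ ∘ₗ indUnit R M X) : φ = ψ := by
  ext z
  induction z using ind_induction_on with
  | h0 => simp
  | h1 x => exact LinearMap.congr_fun h x
  | hm m z ih =>
    have h1 := LinearMap.congr_fun hφ (BalancedTensor.tmul R m z)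
    have h2 := LinearMap.congr_fun hψ (BalancedTensor.tmul R m z)
    simp only [LinearMap.comp_apply, BalancedTensor.lTensor_tmul, actionMap_tmul] at h1 h2
    rw [← h1, ← h2, ih]
  | ha y z hy hz => rw [map_add, map_add, hy, hz]

variable (R M X) in
/-- The projection `Ind X → X`, the cokernel of `M ⊗ Ind X → Ind X`. -/
def indCounit : BalancedTensor R (TensorRing R M) X →ₗ[R] X :=
  (exists_ind_lift (0 : BalancedTensor R M X →ₗ[R] X) LinearMap.id).choose

theorem indCounit_comp_actionMap : indCounit R M X ∘ₗ actionMap R M _ = 0 := by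
  rw [indCounit, ← (exists_ind_lift (0 : BalancedTensor R M X →ₗ[R] X)
    LinearMap.id).choose_spec.1, LinearMap.zero_comp]

theorem indCounit_comp_indUnit : indCounit R M X ∘ₗ indUnit R M X = LinearMap.id :=
  (exists_ind_lift (0 : BalancedTensor R M X →ₗ[R] X) LinearMap.id).choose_spec.2

theorem indCounit_surjective : Function.Surjective (indCounit R M X) := fun x =>
  ⟨indUnit R M X x, LinearMap.congr_fun indCounit_comp_indUnit x⟩

theorem exists_indUnit_add_actionMap (z : BalancedTensor R (TensorRing R M) X) :
    ∃ x y, z = indUnit R M X x + actionMap R M _ y := by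
  induction z using ind_induction_on with
  | h0 => exact ⟨0, 0, by simp⟩
  | h1 x => exact ⟨x, 0, by rw [map_zero, add_zero]; rfl⟩
  | hm m z ih => exact ⟨0, BalancedTensor.tmul R m z, by simp⟩
  | ha y z hy hz =>
    obtain ⟨x, y, rfl⟩ := hy
    obtain ⟨x', y', rfl⟩ := hz
    exact ⟨x + x', y + y', by rw [map_add, map_add]; abel⟩

/-- `Ind X` is the sum of `X` and the image of the action; the projection is the identity on the
first summand and zero on the second. -/
theorem actionMap_indCounit_exact :
    Function.Exact (actionMap R M (BalancedTensor R (TensorRing R M) X)) (indCounit R M X) := by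
  intro z
  constructor
  · intro hz
    obtain ⟨x, y, rfl⟩ := exists_indUnit_add_actionMap z
    have h1 := LinearMap.congr_fun (indCounit_comp_indUnit (R := R) (M := M)) x
    have h2 := LinearMap.congr_fun (indCounit_comp_actionMap (R := R) (M := M)) y
    simp only [LinearMap.comp_apply, LinearMap.id_apply, LinearMap.zero_apply] at h1 h2
    rw [map_add, h1, h2, add_zero] at hz
    exact ⟨y, by rw [hz, map_zero, zero_add]⟩
  · rintro ⟨y, rfl⟩
    exact LinearMap.congr_fun indCounit_comp_actionMap y

/-- `M ⊗ Ind X → Ind X` is a split monomorphism of `R`-modules. -/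
theorem exists_retraction_actionMap_ind :
    ∃ r : BalancedTensor R (TensorRing R M) X →ₗ[R]
      BalancedTensor R M (BalancedTensor R (TensorRing R M) X),
      r ∘ₗ actionMap R M _ = LinearMap.id := by
  let I := BalancedTensor R (TensorRing R M) X
  -- This is Lambek's argument: `Ind X` is the initial algebra for `E ↦ (M ⊗ E) × X`, so its
  -- structure map `ψ` is invertible. The algebra structure `u` on `(M ⊗ I) × X` makes `ψ` a
  -- morphism, and `φ` is the morphism out of the initial object.
  let ψ : BalancedTensor R M I × X →ₗ[R] I :=
    (actionMap R M I).coprod (indUnit R M X)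
  let u : BalancedTensor R M (BalancedTensor R M I × X) →ₗ[R] BalancedTensor R M I × X :=
    LinearMap.inl R _ _ ∘ₗ BalancedTensor.lTensor R M ψ
  obtain ⟨φ, hφ, hφ1⟩ := exists_ind_lift u (LinearMap.inr R (BalancedTensor R M I) X)
  -- Both sides are endomorphisms of the pair `Ind X` that agree on `X`.
  have hψ : ψ ∘ₗ φ = LinearMap.id := by
    refine ind_hom_ext (u := actionMap R M I) ?_ ?_ ?_
    · rw [LinearMap.comp_assoc, ← hφ]
      ext z
      simp [ψ, u, BalancedTensor.lTensor_comp]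
    · rw [BalancedTensor.lTensor_id]
      rfl
    · rw [LinearMap.comp_assoc, hφ1]
      ext x
      simp [ψ]
  refine ⟨LinearMap.fst R _ _ ∘ₗ φ, ?_⟩
  rw [LinearMap.comp_assoc, ← hφ]
  ext z
  simp only [u, LinearMap.comp_apply, LinearMap.fst_apply, LinearMap.inl_apply]
  rw [BalancedTensor.lTensor_lTensor, hψ, BalancedTensor.lTensor_id]

theorem isPure_actionMap_ind :
    BalancedTensor.IsPure (actionMap R M (BalancedTensor R (TensorRing R M) X)) := by
  obtain ⟨r, hr⟩ := exists_retraction_actionMap_ind (R := R) (M := M) (X := X)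
  exact BalancedTensor.isPure_of_retraction _ r hr

/-- `Ind P` has the lifting property for maps commuting with the action of `M`, when `P` is
projective. -/
theorem exists_ind_factorization [Module.Projective R X] {E' : Type u} [AddCommGroup E']
    [Module R E'] (u : BalancedTensor R M E →ₗ[R] E) (u' : BalancedTensor R M E' →ₗ[R] E')
    (p : E →ₗ[R] E') (hp : u' ∘ₗ BalancedTensor.lTensor R M p = p ∘ₗ u)
    (hs : Function.Surjective p) (g : BalancedTensor R (TensorRing R M) X →ₗ[R] E')
    (hg : u' ∘ₗ BalancedTensor.lTensor R M g = g ∘ₗ actionMap R M _) :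
    ∃ φ : BalancedTensor R (TensorRing R M) X →ₗ[R] E,
      u ∘ₗ BalancedTensor.lTensor R M φ = φ ∘ₗ actionMap R M _ ∧ p ∘ₗ φ = g := by
  obtain ⟨f, hf⟩ := Module.projective_lifting_property p (g ∘ₗ indUnit R M X) hs
  obtain ⟨φ, hφ, hφ1⟩ := exists_ind_lift u f
  refine ⟨φ, hφ, ind_hom_ext (u := u') ?_ hg ?_⟩
  · rw [BalancedTensor.lTensor_comp, ← LinearMap.comp_assoc, hp, LinearMap.comp_assoc, hφ,
      LinearMap.comp_assoc]
  · rw [LinearMap.comp_assoc, hφ1, hf]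

theorem ind_linearMap_ext {W : Type u} [AddCommGroup W] [Module (TensorRing R M) W]
    {φ ψ : BalancedTensor R (TensorRing R M) X →ₗ[TensorRing R M] W}
    (h : ∀ x, φ (indUnit R M X x) = ψ (indUnit R M X x)) : φ = ψ :=
  BalancedTensor.linearMap_ext fun t x => by
    have := congrArg (t • ·) (h x)
    simpa [indUnit, ← map_smul] using this

variable {W : Type u} [AddCommGroup W] [Module R W] [Module (TensorRing R M) W]
  [IsScalarTower R (TensorRing R M) W]

theorem exists_ind_linearMap (f : X →ₗ[R] W) :
    ∃ φ : BalancedTensor R (TensorRing R M) X →ₗ[TensorRing R M] W,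
      ∀ x, φ (indUnit R M X x) = f x := by
  obtain ⟨φ, hφ, hφ1⟩ := exists_ind_lift (actionMap R M W) f
  exact ⟨linearMapOfComm φ hφ, fun x => LinearMap.congr_fun hφ1 x⟩

end Induced

end TensorRing

/-! ### The augmentation, trivial actions, and the cokernel of the action on projective modules. -/

namespace TensorRing

variable {R : Type u} [Ring R] {M : Type u} [AddCommGroup M] [Module R M] [Module Rᵐᵒᵖ M]
  [SMulCommClass R Rᵐᵒᵖ M]

section Augmentation

variable (R M) in
/-- The projection of the tensor ring onto `M^{⊗0} = R`, as a linear map. -/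
def augmentationLinear : TensorRing R M →ₗ[R] R :=
  DirectSum.component R ℕ (fun i => tensorPow R M i) 0

theorem augmentationLinear_ofScalar (r : R) : augmentationLinear R M (ofScalar R M r) = r :=
  DirectSum.component.lof_self (ι := ℕ) (M := fun i => tensorPow R M i) R 0 (scalarPow R M r)

theorem augmentationLinear_of_succ (i : ℕ) (y : tensorPow R M (i + 1)) :
    augmentationLinear R M (of R M (i + 1) y) = 0 :=
  DirectSum.of_eq_of_ne (β := fun i => tensorPow R M i) (i + 1) 0 y (Nat.succ_ne_zero i).symm

theorem augmentationLinear_ofBimodule_mul (m : M) (t : TensorRing R M) :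
    augmentationLinear R M (ofBimodule R M m * t) = 0 := by
  refine of_induction t ?_ (fun j w => ?_) (fun v w hv hw => ?_)
  · simp
  · rw [ofBimodule_mul_of, augmentationLinear_of_succ]
  · rw [mul_add, map_add, hv, hw, add_zero]

variable (R M) in
/-- The augmentation `T_R(M) → R`, with kernel generated by `M`. -/
def augmentation : TensorRing R M →+* R where
  toFun := augmentationLinear R M
  map_zero' := map_zero _
  map_add' := map_add _
  map_one' := augmentationLinear_ofScalar (1 : R)
  map_mul' x y := by
    induction x using mul_induction_on with
    | h0 => simp
    | hs r => rw [ofScalar_mul, map_smul, augmentationLinear_ofScalar, smul_eq_mul]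
    | hc m x ih =>
      rw [mul_assoc, augmentationLinear_ofBimodule_mul, augmentationLinear_ofBimodule_mul, zero_mul]
    | ha x y hx hy => rw [add_mul, map_add, map_add, add_mul, hx, hy]

theorem augmentation_ofScalar (r : R) : augmentation R M (ofScalar R M r) = r :=
  augmentationLinear_ofScalar (M := M) r

theorem augmentation_ofBimodule (m : M) : augmentation R M (ofBimodule R M m) = 0 :=
  augmentationLinear_of_succ 0 (consPow R M m (scalarPow R M 1))

variable (M) in
/-- An `R`-module, as a module over the tensor ring on which `M` acts by zero. -/
def Triv (X : Type u) : Type u := let _ := M; X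

variable {X : Type u} [AddCommGroup X] [Module R X]

instance : AddCommGroup (Triv M X) := inferInstanceAs (AddCommGroup X)

instance : Module R (Triv M X) := inferInstanceAs (Module R X)

instance : Module (TensorRing R M) (Triv M X) := Module.compHom X (augmentation R M)

/-- The `R`-module underlying `Triv X` is `X`. -/
def trivEquiv : Triv M X ≃ₗ[R] X := LinearEquiv.refl R X

theorem triv_smul (t : TensorRing R M) (x : Triv M X) : t • x = augmentation R M t • x := rfl

instance : IsScalarTower R (TensorRing R M) (Triv M X) :=
  isScalarTower_of_ofScalar_smul (M := M) fun r x => by rw [triv_smul, augmentation_ofScalar]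

theorem actionMap_triv : actionMap R M (Triv M X) = 0 :=
  BalancedTensor.linearMap_ext fun m x => by
    rw [actionMap_tmul, triv_smul, augmentation_ofBimodule, zero_smul, LinearMap.zero_apply]

variable {W : Type u} [AddCommGroup W] [Module R W] [Module (TensorRing R M) W]
  [IsScalarTower R (TensorRing R M) W]

/-- Linear maps to `Triv X` are the `R`-linear maps vanishing on the image of `M ⊗ W → W`. -/
def toTriv (f : W →ₗ[R] X) (h : f ∘ₗ actionMap R M W = 0) : W →ₗ[TensorRing R M] Triv M X :=
  linearMapOfComm (W' := Triv M X) ((trivEquiv (M := M) (X := X)).symm.toLinearMap ∘ₗ f) (by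
    rw [actionMap_triv, LinearMap.zero_comp, LinearMap.comp_assoc, h, LinearMap.comp_zero])

theorem linearMap_triv_actionMap (f : W →ₗ[TensorRing R M] Triv M X) (z : BalancedTensor R M W) :
    f (actionMap R M W z) = 0 := by
  rw [← actionMap_natural_apply, actionMap_triv, LinearMap.zero_apply]

end Augmentation

section IndTensor

variable (X : Type u) [AddCommGroup X] [Module R X]

/-- The short exact sequence `0 → Ind (M ⊗ X) → Ind X → X → 0`, where `M` acts by zero on `X`. -/
theorem exists_exact_ind_tensor :
    ∃ j : BalancedTensor R (TensorRing R M) (BalancedTensor R M X) →ₗ[TensorRing R M]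
        BalancedTensor R (TensorRing R M) X,
      Function.Injective j ∧ Function.Exact j (indCounit R M X) := by
  let I := BalancedTensor R (TensorRing R M) X
  let I' := BalancedTensor R (TensorRing R M) (BalancedTensor R M X)
  obtain ⟨j, hj⟩ := exists_ind_linearMap (M := M) (W := I)
    (actionMap R M I ∘ₗ BalancedTensor.lTensor R M (indUnit R M X))
  have hj' : ∀ m x, j (indUnit R M _ (BalancedTensor.tmul R m x)) =
      ofBimodule R M m • indUnit R M X x := fun m x => hj _
  -- The action on `Ind (M ⊗ X) × X` transported from `Ind X`: an element `m` sends `x` in `X` to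
  -- the generator `m ⊗ x` of the first factor, and no value has a component in `X`. The induced `φ
  -- : Ind X → Ind (M ⊗ X) × X` restricts to the inclusion of the first factor along `j`, whence `j`
  -- is injective.
  let u : BalancedTensor R M (I' × X) →ₗ[R] I' × X :=
    LinearMap.inl R I' X ∘ₗ
      (actionMap R M I' ∘ₗ BalancedTensor.lTensor R M (LinearMap.fst R I' X) +
        indUnit R M _ ∘ₗ BalancedTensor.lTensor R M (LinearMap.snd R I' X))
  have hu : ∀ m (e : I' × X), u (BalancedTensor.tmul R m e) =
      (ofBimodule R M m • e.1 + indUnit R M _ (BalancedTensor.tmul R m e.2), 0) := fun m e => rfl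
  obtain ⟨φ, hφ, hφ1⟩ := exists_ind_lift u (LinearMap.inr R I' X)
  have hφm : ∀ (m : M) z, φ (ofBimodule R M m • z) = u (BalancedTensor.tmul R m (φ z)) :=
    fun m z => (LinearMap.congr_fun hφ (BalancedTensor.tmul R m z)).symm
  have hφ1' : ∀ x, φ (indUnit R M X x) = (0, x) := fun x => LinearMap.congr_fun hφ1 x
  have key : ∀ z, φ (j z) = (z, 0) := by
    intro z
    induction z using ind_induction_on with
    | h0 => rw [map_zero, map_zero]; rfl
    | h1 y =>
      change φ (j (indUnit R M _ y)) = (indUnit R M _ y, 0)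
      induction y using BalancedTensor.induction_on with
      | h0 => rw [map_zero, map_zero, map_zero]; rfl
      | ht m x => rw [hj', hφm, hφ1', hu]; simp
      | ha y z hy hz => rw [map_add, map_add, map_add, hy, hz, Prod.mk_add_mk, add_zero]
    | hm m z ih =>
      rw [map_smul, hφm, ih, hu]
      simp [BalancedTensor.tmul_zero]
    | ha y z hy hz => rw [map_add, map_add, hy, hz, Prod.mk_add_mk, add_zero]
  have hcj : ∀ z, indCounit R M X (j z) = 0 := by
    intro z
    rw [actionMap_indCounit_exact]
    induction z using ind_induction_on with
    | h0 => exact ⟨0, by simp⟩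
    | h1 y => exact ⟨_, (hj y).symm⟩
    | hm m z ih => exact ⟨BalancedTensor.tmul R m (j z), (map_smul j _ _).symm⟩
    | ha y z hy hz =>
      obtain ⟨a, ha⟩ := hy
      obtain ⟨b, hb⟩ := hz
      exact ⟨a + b, by rw [map_add, map_add, ha, hb]⟩
  -- The sum of `X` and the image of `j` contains the generators and is stable under `M`, so it is
  -- all of `Ind X`. The projection then has kernel exactly the image of `j`.
  have hspan : ∀ z : I, ∃ x y, z = indUnit R M X x + j y := by
    intro z
    induction z using ind_induction_on with
    | h0 => exact ⟨0, 0, by simp⟩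
    | h1 x => exact ⟨x, 0, by rw [map_zero, add_zero]; rfl⟩
    | hm m z ih =>
      obtain ⟨x, y, rfl⟩ := ih
      exact ⟨0, indUnit R M _ (BalancedTensor.tmul R m x) + ofBimodule R M m • y, by
        rw [map_zero, zero_add, map_add, hj', map_smul, smul_add]⟩
    | ha y z hy hz =>
      obtain ⟨x, y, rfl⟩ := hy
      obtain ⟨x', y', rfl⟩ := hz
      exact ⟨x + x', y + y', by rw [map_add, map_add]; abel⟩
  refine ⟨j, fun a b h => ?_, fun z => ⟨fun hz => ?_, ?_⟩⟩
  · exact congrArg Prod.fst ((key a).symm.trans ((congrArg φ h).trans (key b)))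
  · obtain ⟨x, y, rfl⟩ := hspan z
    have h1 := LinearMap.congr_fun (indCounit_comp_indUnit (R := R) (M := M)) x
    simp only [LinearMap.comp_apply, LinearMap.id_apply] at h1
    rw [map_add, h1, hcj, add_zero] at hz
    exact ⟨y, by rw [hz, map_zero, zero_add]⟩
  · rintro ⟨y, rfl⟩
    exact hcj y

end IndTensor

section ProjectiveFlat

variable {X : Type u} [AddCommGroup X] [Module R X]

/-- `Ind` is left adjoint to restriction of scalars, which preserves surjections. -/
theorem projective_ind [Module.Projective R X] :
    Module.Projective (TensorRing R M) (BalancedTensor R (TensorRing R M) X) := by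
  refine Module.Projective.of_lifting_property fun {A B} _ _ _ _ f g hf => ?_
  let : Module R A := Module.compHom A (ofScalar R M)
  let : Module R B := Module.compHom B (ofScalar R M)
  have : IsScalarTower R (TensorRing R M) A := isScalarTower_of_ofScalar_smul (M := M) fun _ _ => rfl
  have : IsScalarTower R (TensorRing R M) B := isScalarTower_of_ofScalar_smul (M := M) fun _ _ => rfl
  obtain ⟨h, hh⟩ := Module.projective_lifting_property (f.restrictScalars R)
    (g.restrictScalars R ∘ₗ indUnit R M X) hf
  obtain ⟨φ, hφ⟩ := exists_ind_linearMap (M := M) h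
  refine ⟨φ, ind_linearMap_ext fun x => ?_⟩
  rw [LinearMap.comp_apply, hφ]
  exact LinearMap.congr_fun hh x

theorem flatClass_ind (hX : flatClass R (ModuleCat.of R X)) :
    flatClass (TensorRing R M)
      (ModuleCat.of (TensorRing R M) (BalancedTensor R (TensorRing R M) X)) := by
  intro A B _ _ _ _ f hf
  let T := TensorRing R M
  let : Module Rᵐᵒᵖ A := Module.compHom A (ofScalar R M).op
  let : Module Rᵐᵒᵖ B := Module.compHom B (ofScalar R M).op
  let f' : A →ₗ[Rᵐᵒᵖ] B := { f with map_smul' := fun r a => map_smul f _ a }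
  have h1 := hX A B f' hf
  -- The isomorphism `C ⊗_T Ind X ≅ C ⊗_R X`, given by `c ⊗ (t ⊗ x) ↦ ct ⊗ x`. Its naturality and
  -- the left inverse `η` reduce flatness over `T` to flatness of `X` over `R`.
  let θ (C : Type u) [AddCommGroup C] [Module Tᵐᵒᵖ C] [Module Rᵐᵒᵖ C]
      (hC : ∀ (r : R) (c : C), MulOpposite.op r • c = MulOpposite.op (ofScalar R M r) • c) :
      BalancedTensor T C (BalancedTensor R T X) →+ BalancedTensor R C X :=
    BalancedTensor.liftMk
      (fun c z => BalancedTensor.map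
        ({ toFun := fun t => MulOpposite.op t • c
           map_add' := fun s t => add_smul (MulOpposite.op s) (MulOpposite.op t) c
           map_smul' := fun r t => by
            refine Eq.trans ?_ (hC r.unop _).symm
            rw [smul_smul]
            rfl } : T →ₗ[Rᵐᵒᵖ] C) LinearMap.id z)
      (fun a b z => by
        rw [← AddMonoidHom.add_apply, ← BalancedTensor.map_add_left]
        congr 2
        ext t
        exact smul_add _ a b)
      (fun a y z => map_add _ y z)
      (fun a t z => by
        refine Eq.trans ?_ (BalancedTensor.map_map
          (⟨⟨fun s => t • s, smul_add t⟩, fun r a => smul_comm t r a⟩ : T →ₗ[Rᵐᵒᵖ] T)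
            _ LinearMap.id _ z).symm
        congr 2
        ext s
        exact (mul_smul (MulOpposite.op s) (MulOpposite.op t) a).symm)
  let η : BalancedTensor R A X →+ BalancedTensor T A (BalancedTensor R T X) :=
    BalancedTensor.liftMk (fun a x => BalancedTensor.tmul T a (indUnit R M X x))
      (fun a b x => BalancedTensor.add_tmul _ _ _)
      (fun a x y => by rw [map_add, BalancedTensor.tmul_add])
      (fun a r x => by
        rw [map_smul]
        exact BalancedTensor.op_smul_tmul a (ofScalar R M r) (indUnit R M X x))
  have hη : ∀ z, η (θ A (fun _ _ => rfl) z) = z := by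
    refine fun z => DFunLike.congr_fun (f := η.comp (θ A fun _ _ => rfl))
      (g := AddMonoidHom.id _) (BalancedTensor.addHom_ext fun a y => ?_) z
    induction y using BalancedTensor.induction_on with
    | h0 => simp [BalancedTensor.tmul_zero]
    | ht t x =>
      refine (BalancedTensor.op_smul_tmul a t (indUnit R M X x)).trans ?_
      refine congrArg (BalancedTensor.tmul T a) ?_
      exact congrArg (fun s => BalancedTensor.tmul R s x) (mul_one t)
    | ha y z hy hz => rw [BalancedTensor.tmul_add, map_add, map_add, hy, hz]
  have hnat : ∀ z, θ B (fun _ _ => rfl) (BalancedTensor.map f LinearMap.id z) =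
      BalancedTensor.map f' LinearMap.id (θ A (fun _ _ => rfl) z) := by
    refine fun z => DFunLike.congr_fun
      (f := (θ B (fun _ _ => rfl)).comp (BalancedTensor.map f LinearMap.id))
      (g := (BalancedTensor.map f' LinearMap.id).comp (θ A (fun _ _ => rfl)))
      (BalancedTensor.addHom_ext fun a y => ?_) z
    induction y using BalancedTensor.induction_on with
    | h0 => simp [BalancedTensor.tmul_zero]
    | ht t x =>
      exact congrArg (fun b => BalancedTensor.tmul R b x) (map_smul f (MulOpposite.op t) a).symm
    | ha y z hy hz => rw [BalancedTensor.tmul_add, map_add, map_add, hy, hz]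
  intro z z' e
  rw [← hη z, ← hη z']
  refine congrArg η (h1 ?_)
  exact (hnat z).symm.trans ((congrArg _ e).trans (hnat z'))

variable {W : Type u} [AddCommGroup W] [Module R W] [Module (TensorRing R M) W]
  [IsScalarTower R (TensorRing R M) W]

/-- The canonical surjection `π : Ind W → W` splits over `T`, so a retraction for `Ind W` transports
to `W` by naturality of the action. -/
theorem exists_retraction_actionMap [Module.Projective (TensorRing R M) W] :
    ∃ r : W →ₗ[R] BalancedTensor R M W, r ∘ₗ actionMap R M W = LinearMap.id := by
  obtain ⟨π, hπ⟩ := exists_ind_linearMap (M := M) (LinearMap.id : W →ₗ[R] W)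
  obtain ⟨s, hs⟩ := Module.projective_lifting_property π LinearMap.id (fun w => ⟨_, hπ w⟩)
  obtain ⟨r, hr⟩ := exists_retraction_actionMap_ind (R := R) (M := M) (X := W)
  refine ⟨BalancedTensor.lTensor R M (π.restrictScalars R) ∘ₗ r ∘ₗ s.restrictScalars R, ?_⟩
  rw [LinearMap.comp_assoc, LinearMap.comp_assoc, ← actionMap_natural, ← LinearMap.comp_assoc _ _ r,
    hr, LinearMap.id_comp, ← BalancedTensor.lTensor_comp, ← BalancedTensor.lTensor_id]
  congr 1
  ext w
  exact LinearMap.congr_fun hs w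

theorem isPure_actionMap_of_projective [Module.Projective (TensorRing R M) W] :
    BalancedTensor.IsPure (actionMap R M W) := by
  obtain ⟨r, hr⟩ := exists_retraction_actionMap (R := R) (M := M) (W := W)
  exact BalancedTensor.isPure_of_retraction _ r hr

/-- The cokernel of `M ⊗ W → W` is projective if `W` is. -/
theorem projective_of_exact_actionMap [Module.Projective (TensorRing R M) W] (c : W →ₗ[R] X)
    (hc : Function.Exact (actionMap R M W) c) (hs : Function.Surjective c) :
    Module.Projective R X := by
  refine Module.Projective.of_lifting_property fun {A B} _ _ _ _ f g hf => ?_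
  -- The lifting problem over `R` is moved to `T` by letting `M` act by zero on `A` and `B`: the
  -- cokernel is left adjoint to this exact functor. The lift kills the image of the action and so
  -- descends to `X`.
  obtain ⟨h, hh⟩ := Module.projective_lifting_property
    (toTriv (f ∘ₗ (trivEquiv (M := M) (X := A)).toLinearMap) (by
      rw [actionMap_triv, LinearMap.comp_zero]))
    (toTriv (M := M) (g ∘ₗ c) (by
      rw [LinearMap.comp_assoc, hc.linearMap_comp_eq_zero, LinearMap.comp_zero]))
    ((trivEquiv (R := R) (M := M) (X := B)).symm.surjective.comp
      (hf.comp (trivEquiv (R := R) (M := M) (X := A)).surjective))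
  let h' : W →ₗ[R] A := (trivEquiv (M := M) (X := A)).toLinearMap ∘ₗ h.restrictScalars R
  have hk : LinearMap.ker c ≤ LinearMap.ker h' := by
    intro w hw
    obtain ⟨z, rfl⟩ := (hc w).1 hw
    exact (congrArg (trivEquiv (R := R) (M := M) (X := A)) (linearMap_triv_actionMap h z)).trans (map_zero _)
  let e := c.quotKerEquivOfSurjective hs
  refine ⟨(LinearMap.ker c).liftQ h' hk ∘ₗ e.symm.toLinearMap, ?_⟩
  ext x
  obtain ⟨w, rfl⟩ := hs x
  have he : e.symm (c w) = (LinearMap.ker c).mkQ w := by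
    rw [LinearEquiv.symm_apply_eq]
    rfl
  simp only [LinearMap.comp_apply, LinearEquiv.coe_coe, he]
  exact LinearMap.congr_fun hh w

end ProjectiveFlat

end TensorRing

/-! ### Purity and flat cokernels of the action on flat modules. -/

namespace TensorRing

variable {R : Type u} [Ring R] {M : Type u} [AddCommGroup M] [Module R M] [Module Rᵐᵒᵖ M]
  [SMulCommClass R Rᵐᵒᵖ M]

section Flat

attribute [local instance] BalancedTensor.rightModule

variable {W : Type u} [AddCommGroup W] [Module R W] [Module (TensorRing R M) W]
  [IsScalarTower R (TensorRing R M) W]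
  {A : Type u} [AddCommGroup A] [Module Rᵐᵒᵖ A] {X : Type u} [AddCommGroup X] [Module R X]

variable (M) in
/-- The map `A ⊗_R W → (A ⊗_R T) ⊗_T W`. -/
def toExtended (A : Type u) [AddCommGroup A] [Module Rᵐᵒᵖ A] (W : Type u) [AddCommGroup W]
    [Module R W] [Module (TensorRing R M) W] [IsScalarTower R (TensorRing R M) W] :
    BalancedTensor R A W →+
      BalancedTensor (TensorRing R M) (BalancedTensor R A (TensorRing R M)) W :=
  BalancedTensor.liftMk (fun a w => BalancedTensor.tmul _ (BalancedTensor.tmul R a 1) w)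
    (fun a b w => by rw [BalancedTensor.add_tmul, BalancedTensor.add_tmul])
    (fun a w w' => BalancedTensor.tmul_add _ _ _)
    (fun a r w => by
      rw [← ofScalar_smul (M := M) r w, ← BalancedTensor.op_smul_tmul, BalancedTensor.op_smul_tmul]
      refine congrArg (fun s => BalancedTensor.tmul _ (BalancedTensor.tmul R a s) w)
        (?_ : r • 1 = 1 * ofScalar R M r)
      rw [← ofScalar_mul, mul_one, one_mul])

/-- The left inverse is `(a ⊗ t) ⊗ w ↦ a ⊗ tw`. -/
theorem toExtended_injective : Function.Injective (toExtended (R := R) M A W) := by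
  let ρ (w : W) : TensorRing R M →ₗ[R] W :=
    (LinearMap.toSpanSingleton (TensorRing R M) W w).restrictScalars R
  let β : BalancedTensor (TensorRing R M) (BalancedTensor R A (TensorRing R M)) W →+
      BalancedTensor R A W :=
    BalancedTensor.liftMk (fun z w => BalancedTensor.map LinearMap.id (ρ w) z)
      (fun y z w => map_add _ y z)
      (fun z w w' => by
        rw [← AddMonoidHom.add_apply, ← BalancedTensor.map_add_right]
        congr 2
        ext t
        exact smul_add t w w')
      (fun z t w => by
        refine (BalancedTensor.map_map _ _ _ _ z).trans ?_
        congr 2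
        ext s
        exact mul_smul s t w)
  refine Function.LeftInverse.injective (g := β) fun z => ?_
  refine DFunLike.congr_fun (f := β.comp (toExtended M A W)) (g := AddMonoidHom.id _)
    (BalancedTensor.addHom_ext fun a w => ?_) z
  exact congrArg (BalancedTensor.tmul R a) (one_smul _ w)

/-- The map `A ⊗ M ⊗ W → A ⊗ W` is obtained from `A ⊗ M ⊗ T → A ⊗ T` by applying `- ⊗_T W`. The
latter is injective, because `T` is projective over itself, and is right `T`-linear, so flatness of
`W` applies. -/
theorem isPure_actionMap_of_flat
    (hW : flatClass (TensorRing R M) (ModuleCat.of (TensorRing R M) W)) :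
    BalancedTensor.IsPure (actionMap R M W) := by
  intro A _ _
  let T := TensorRing R M
  let φ₀ : BalancedTensor R (BalancedTensor R A M) T →+ BalancedTensor R A T :=
    (BalancedTensor.map LinearMap.id (actionMap R M T)).comp (BalancedTensor.assocHom R A M T)
  have hlin : ∀ (t : Tᵐᵒᵖ) z, φ₀ (t • z) = t • φ₀ z := by
    intro t z
    refine DFunLike.congr_fun (f := φ₀.comp (DistribSMul.toAddMonoidHom _ t))
      (g := (DistribSMul.toAddMonoidHom _ t).comp φ₀) (BalancedTensor.addHom_ext fun y s => ?_) z
    induction y using BalancedTensor.induction_on with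
    | h0 => simp [BalancedTensor.zero_tmul]
    | ht a m =>
      change BalancedTensor.tmul R a (ofBimodule R M m * (s * t.unop)) =
        BalancedTensor.tmul R a ((ofBimodule R M m * s) * t.unop)
      rw [mul_assoc]
    | ha y z hy hz => rw [BalancedTensor.add_tmul, map_add, map_add, hy, hz]
  let φ : BalancedTensor R (BalancedTensor R A M) T →ₗ[Tᵐᵒᵖ] BalancedTensor R A T :=
    { φ₀ with map_smul' := hlin }
  have hφ : Function.Injective φ :=
    (isPure_actionMap_of_projective (W := T) A).comp BalancedTensor.assocHom_injective
  -- Flatness is used here, on the injection `φ` of right `T`-modules.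
  have key := (hW _ _ φ hφ).comp (toExtended_injective (R := R) (M := M) (A := BalancedTensor R A M) (W := W))
  have hnat : ∀ z, BalancedTensor.map φ LinearMap.id
        (toExtended M (BalancedTensor R A M) W (BalancedTensor.assocInvHom R A M W z)) =
      toExtended M A W (BalancedTensor.map LinearMap.id (actionMap R M W) z) := by
    refine fun z => DFunLike.congr_fun
      (f := ((BalancedTensor.map φ LinearMap.id).comp (toExtended M _ W)).comp
        (BalancedTensor.assocInvHom R A M W))
      (g := (toExtended M A W).comp (BalancedTensor.map LinearMap.id (actionMap R M W)))
      (BalancedTensor.addHom_ext fun a y => ?_) z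
    induction y using BalancedTensor.induction_on with
    | h0 => simp [BalancedTensor.tmul_zero]
    | ht m w =>
      refine Eq.trans (?_ : _ = BalancedTensor.tmul T
        (BalancedTensor.tmul R a (1 * ofBimodule R M m)) w) ?_
      · rw [one_mul, ← mul_one (ofBimodule R M m)]
        rfl
      · exact BalancedTensor.op_smul_tmul (BalancedTensor.tmul R a (1 : T)) (ofBimodule R M m) w
    | ha y z hy hz => rw [BalancedTensor.tmul_add, map_add, map_add, hy, hz]
  intro z z' h
  apply BalancedTensor.assocInvHom_injective
  apply key
  exact (hnat z).trans ((congrArg _ h).trans (hnat z').symm)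

/-- The cokernel of `M ⊗ W → W` is flat if `W` is. -/
theorem flatClass_of_exact_actionMap
    (hW : flatClass (TensorRing R M) (ModuleCat.of (TensorRing R M) W)) (c : W →ₗ[R] X)
    (hc : Function.Exact (actionMap R M W) c) (hs : Function.Surjective c) :
    flatClass R (ModuleCat.of R X) := by
  intro A B _ _ _ _ f hf
  let T := TensorRing R M
  let : Module Tᵐᵒᵖ A := Module.compHom A (augmentation R M).op
  let : Module Tᵐᵒᵖ B := Module.compHom B (augmentation R M).op
  let f' : A →ₗ[Tᵐᵒᵖ] B := { f with map_smul' := fun r a => map_smul f _ a }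
  have hct : ∀ (t : T) w, c (t • w) = augmentation R M t • c w := by
    intro t w
    exact (congrArg (trivEquiv (R := R) (M := M) (X := X)) (map_smul (toTriv (M := M) c hc.linearMap_comp_eq_zero) t w) :)
  -- With `T` acting on `C` through the augmentation, `C ⊗_R X` is `C ⊗_T W`. The map `q` from `C
  -- ⊗_R W` kills the image of `C ⊗ (M ⊗ W)`, since `M` acts on `C` by zero, and `δ` below compares
  -- back with `A ⊗_R X`.
  let q (C : Type u) [AddCommGroup C] [Module Tᵐᵒᵖ C] [Module Rᵐᵒᵖ C]
      (hC : ∀ (t : T) (c : C), MulOpposite.op t • c = MulOpposite.op (augmentation R M t) • c) :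
      BalancedTensor R C W →+ BalancedTensor T C W :=
    BalancedTensor.liftMk (fun c w => BalancedTensor.tmul T c w)
      (fun a b w => BalancedTensor.add_tmul _ _ _)
      (fun a w w' => BalancedTensor.tmul_add _ _ _)
      (fun a r w => by
        rw [← ofScalar_smul (M := M) r w, ← BalancedTensor.op_smul_tmul, hC, augmentation_ofScalar])
  have hq : ∀ (C : Type u) [AddCommGroup C] [Module Tᵐᵒᵖ C] [Module Rᵐᵒᵖ C]
      (hC : ∀ (t : T) (c : C), MulOpposite.op t • c = MulOpposite.op (augmentation R M t) • c) z,
      q C hC (BalancedTensor.map LinearMap.id (actionMap R M W) z) = 0 := by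
    intro C _ _ _ hC z
    refine DFunLike.congr_fun (f := (q C hC).comp (BalancedTensor.map LinearMap.id
      (actionMap R M W))) (g := 0) (BalancedTensor.addHom_ext fun a y => ?_) z
    induction y using BalancedTensor.induction_on with
    | h0 => simp [BalancedTensor.tmul_zero]
    | ht m w =>
      refine (BalancedTensor.op_smul_tmul a (ofBimodule R M m) w).symm.trans ?_
      rw [hC, augmentation_ofBimodule, MulOpposite.op_zero, zero_smul, BalancedTensor.zero_tmul]
      rfl
    | ha y z hy hz => rw [BalancedTensor.tmul_add, map_add, map_add, hy, hz]
  let δ : BalancedTensor T A W →+ BalancedTensor R A X :=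
    BalancedTensor.liftMk (fun a w => BalancedTensor.tmul R a (c w))
      (fun a b w => BalancedTensor.add_tmul _ _ _)
      (fun a w w' => by rw [map_add, BalancedTensor.tmul_add])
      (fun a t w => by
        rw [hct, ← BalancedTensor.op_smul_tmul]
        rfl)
  rw [injective_iff_map_eq_zero]
  intro z hz
  obtain ⟨z', rfl⟩ := BalancedTensor.map_surjective c hs z
  -- A lift `z'` of `z` to `A ⊗ W` is carried by `f` into the kernel of `B ⊗ c`, hence into the
  -- image of `B ⊗ (M ⊗ W)`. So its class in `B ⊗_T W` vanishes, and by flatness so does its class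
  -- in `A ⊗_T W`.
  have h1 : BalancedTensor.map LinearMap.id c
      (BalancedTensor.map f (LinearMap.id : W →ₗ[R] W) z') = 0 := by
    rw [← hz, BalancedTensor.map_map]
    exact (BalancedTensor.map_map LinearMap.id f c LinearMap.id z').symm
  obtain ⟨y, hy⟩ := (BalancedTensor.map_exact _ c hc hs _).1 h1
  have h2 : BalancedTensor.map f' (LinearMap.id : W →ₗ[T] W) (q A (fun _ _ => rfl) z') = 0 := by
    rw [← hq B (fun _ _ => rfl) y, hy]
    exact DFunLike.congr_fun (f := (BalancedTensor.map f' LinearMap.id).comp (q A fun _ _ => rfl))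
      (g := (q B fun _ _ => rfl).comp (BalancedTensor.map f LinearMap.id))
      (BalancedTensor.addHom_ext fun a w => rfl) z'
  have h3 : q A (fun _ _ => rfl) z' = 0 :=
    (injective_iff_map_eq_zero _).1 (hW A B f' hf) _ h2
  have h4 : BalancedTensor.map LinearMap.id c z' = δ (q A (fun _ _ => rfl) z') :=
    DFunLike.congr_fun (f := BalancedTensor.map LinearMap.id c) (g := δ.comp (q A fun _ _ => rfl))
      (BalancedTensor.addHom_ext fun a w => rfl) z'
  exact h4.trans (by rw [h3, map_zero])

end Flat

end TensorRing

/-! ### Short exact sequences and vanishing of `Ext¹` as extension of maps. -/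

section ShortExact

variable {R : Type u} [Ring R]

/-- The sequence `0 → K → B → C → 0` is exact. -/
structure IsShortExact {K B C : Type u} [AddCommGroup K] [AddCommGroup B] [AddCommGroup C]
    [Module R K] [Module R B] [Module R C] (ι : K →ₗ[R] B) (π : B →ₗ[R] C) : Prop where
  injective : Function.Injective ι
  exact : Function.Exact ι π
  surjective : Function.Surjective π

variable {K B C : Type u} [AddCommGroup K] [AddCommGroup B] [AddCommGroup C]
    [Module R K] [Module R B] [Module R C]

namespace IsShortExact

variable {ι : K →ₗ[R] B} {π : B →ₗ[R] C} (h : IsShortExact ι π)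
include h

theorem apply_apply (k : K) : π (ι k) = 0 := h.exact.apply_apply_eq_zero k

theorem eq_zero {k : K} (hk : ι k = 0) : k = 0 := h.injective (hk.trans (map_zero ι).symm)

end IsShortExact

theorem exists_factorization_of_exact {D : Type u} [AddCommGroup D] [Module R D]
    {ι : K →ₗ[R] B} {π : B →ₗ[R] C} (hι : Function.Injective ι) (hex : Function.Exact ι π)
    (f : D →ₗ[R] B) (hf : ∀ d, π (f d) = 0) : ∃ g : D →ₗ[R] K, ∀ d, ι (g d) = f d := by
  let e := LinearEquiv.ofInjective ι hι
  let f' : D →ₗ[R] LinearMap.range ι := f.codRestrict _ fun d => (hex (f d)).1 (hf d)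
  refine ⟨e.symm.toLinearMap ∘ₗ f', fun d => ?_⟩
  have : (e (e.symm (f' d)) : B) = f d := by rw [e.apply_symm_apply]; rfl
  exact this

theorem exists_desc_of_exact {D : Type u} [AddCommGroup D] [Module R D]
    {ι : K →ₗ[R] B} {π : B →ₗ[R] C} (hex : Function.Exact ι π) (hs : Function.Surjective π)
    (f : B →ₗ[R] D) (hf : ∀ k, f (ι k) = 0) : ∃ g : C →ₗ[R] D, ∀ b, g (π b) = f b := by
  have hk : LinearMap.ker π ≤ LinearMap.ker f := by
    intro b hb
    obtain ⟨k, rfl⟩ := (hex b).1 hb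
    exact hf k
  let e := π.quotKerEquivOfSurjective hs
  refine ⟨(LinearMap.ker π).liftQ f hk ∘ₗ e.symm.toLinearMap, fun b => ?_⟩
  have he : e.symm (π b) = (LinearMap.ker π).mkQ b := by
    rw [LinearEquiv.symm_apply_eq]
    rfl
  simp only [LinearMap.comp_apply, LinearEquiv.coe_coe, he]
  rfl

variable (R) in
/-- `Ext¹(G, A) = 0`, in terms of extensions of maps. -/
def ExtendsTo (G A : Type u) [AddCommGroup G] [Module R G] [AddCommGroup A] [Module R A] : Prop :=
  ∀ (K B : Type u) [AddCommGroup K] [AddCommGroup B] [Module R K] [Module R B]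
    (ι : K →ₗ[R] B) (π : B →ₗ[R] G), IsShortExact ι π →
      ∀ f : K →ₗ[R] A, ∃ g : B →ₗ[R] A, ∀ k, g (ι k) = f k

theorem ExtendsTo.of_linearEquiv {G A G' A' : Type u} [AddCommGroup G] [Module R G]
    [AddCommGroup A] [Module R A] [AddCommGroup G'] [Module R G'] [AddCommGroup A'] [Module R A']
    (h : ExtendsTo R G A) (e : G' ≃ₗ[R] G) (e' : A ≃ₗ[R] A') : ExtendsTo R G' A' := by
  intro K B _ _ _ _ ι π hse f
  obtain ⟨g, hg⟩ := h K B ι (e.toLinearMap ∘ₗ π)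
    ⟨hse.injective, fun b => by
      rw [← hse.exact b, LinearMap.comp_apply]
      exact e.map_eq_zero_iff, e.surjective.comp hse.surjective⟩ (e'.symm.toLinearMap ∘ₗ f)
  refine ⟨e'.toLinearMap ∘ₗ g, fun k => ?_⟩
  simp [hg]

theorem ExtOneVanishes.extendsTo {G A : ModuleCat.{u} R} (h : ExtOneVanishes G A) :
    ExtendsTo R G A := by
  intro K B _ _ _ _ ι π hse f
  let S : ShortComplex (ModuleCat.{u} R) :=
    ShortComplex.mk (ModuleCat.ofHom ι) (ModuleCat.ofHom π : ModuleCat.of R B ⟶ G) (by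
      ext k
      exact hse.apply_apply k)
  have hS : S.ShortExact :=
    { exact := (ShortComplex.ShortExact.moduleCat_exact_iff_function_exact S).2 hse.exact
      mono_f := (ModuleCat.mono_iff_injective _).2 hse.injective
      epi_g := (ModuleCat.epi_iff_surjective _).2 hse.surjective }
  have : Subsingleton (Abelian.Ext.{u} S.X₃ A 1) := h
  -- In the long exact sequence the obstruction to extending `f` lies in `Ext¹(G, A)`.
  obtain ⟨x, hx⟩ := Abelian.Ext.contravariant_sequence_exact₁ hS A
    (Abelian.Ext.mk₀ (ModuleCat.ofHom f : S.X₁ ⟶ A)) (add_zero 1) (Subsingleton.elim _ _)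
  obtain ⟨g, rfl⟩ := (Abelian.Ext.mk₀_bijective S.X₂ A).2 x
  rw [Abelian.Ext.mk₀_comp_mk₀] at hx
  have := (Abelian.Ext.mk₀_bijective S.X₁ A).1 hx
  exact ⟨g.hom, fun k => LinearMap.congr_fun (congrArg ModuleCat.Hom.hom this) k⟩

end ShortExact

/-! ### Vanishing of `Tor₁(M, -)` through short exact sequences. -/

section TorAcyclic

open BalancedTensor

variable {R : Type u} [Ring R] {M : Type u} [AddCommGroup M] [Module R M] [Module Rᵐᵒᵖ M]
  [SMulCommClass R Rᵐᵒᵖ M]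

variable (R M) in
/-- `Tor₁(M, X) = 0`, in terms of short exact sequences ending in `X`. -/
def IsTorAcyclic (X : Type u) [AddCommGroup X] [Module R X] : Prop :=
  ∀ (K B : Type u) [AddCommGroup K] [AddCommGroup B] [Module R K] [Module R B]
    (ι : K →ₗ[R] B) (π : B →ₗ[R] X), IsShortExact ι π →
      Function.Injective (lTensor R M ι)

theorem IsTorAcyclic.of_linearEquiv {X Y : Type u} [AddCommGroup X] [Module R X] [AddCommGroup Y]
    [Module R Y] (h : IsTorAcyclic R M X) (e : Y ≃ₗ[R] X) : IsTorAcyclic R M Y := by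
  intro K B _ _ _ _ ι π hse
  exact h K B ι (e.toLinearMap ∘ₗ π)
    ⟨hse.injective, fun b => by
      rw [← hse.exact b, LinearMap.comp_apply]
      exact e.map_eq_zero_iff, e.surjective.comp hse.surjective⟩

/-- Exactness of `M ⊗ P` in degree one gives injectivity of `M ⊗ ker ε → M ⊗ P₀`, for the one
sequence coming from the resolution. A Schanuel-type comparison passes to an arbitrary short exact
sequence ending in `X`. -/
theorem isTorAcyclic_of_exact {P₂ P₁ P₀ X : Type u} [AddCommGroup P₂] [Module R P₂]
    [AddCommGroup P₁] [Module R P₁] [AddCommGroup P₀] [Module R P₀] [AddCommGroup X] [Module R X]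
    [Module.Projective R P₀] (d₂ : P₂ →ₗ[R] P₁) (d₁ : P₁ →ₗ[R] P₀) (ε : P₀ →ₗ[R] X)
    (h21 : ∀ x, d₁ (d₂ x) = 0) (h10 : Function.Exact d₁ ε) (hε : Function.Surjective ε)
    (hM : Function.Exact (lTensor R M d₂) (lTensor R M d₁)) : IsTorAcyclic R M X := by
  let s := (LinearMap.ker ε).subtype
  have hs : Function.Injective (lTensor R M s) := by
    let d : P₁ →ₗ[R] LinearMap.ker ε := d₁.codRestrict _ h10.apply_apply_eq_zero
    have hd : Function.Surjective d := fun x => by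
      obtain ⟨y, hy⟩ := (h10 x).1 x.2
      exact ⟨y, Subtype.ext hy⟩
    rw [injective_iff_map_eq_zero]
    intro z hz
    obtain ⟨z, rfl⟩ := lTensor_surjective (S := R) (A := M) d hd z
    rw [lTensor_lTensor] at hz
    obtain ⟨y, rfl⟩ := (hM z).1 hz
    rw [lTensor_lTensor, show d ∘ₗ d₂ = 0 from LinearMap.ext fun x => Subtype.ext (h21 x),
      lTensor_zero, LinearMap.zero_apply]
  intro K B _ _ _ _ ι π hse
  obtain ⟨h, hh⟩ := Module.projective_lifting_property π ε hse.surjective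
  have hh' : ∀ q, π (h q) = ε q := fun q => LinearMap.congr_fun hh q
  obtain ⟨φ, hφ⟩ := exists_factorization_of_exact hse.injective hse.exact (h ∘ₗ s)
    (fun q => (hh' _).trans q.2)
  -- A lift `h` of `ε` to `B` gives the short exact sequence `0 → ker ε → K × P₀ → B → 0`. If `x` in
  -- `M ⊗ K` dies in `M ⊗ B`, then `(x, 0)` comes from some `y` in `M ⊗ ker ε`. The second
  -- coordinate forces `y = 0`, and the first then gives `x = 0`.
  let σ : K × P₀ →ₗ[R] B := ι.coprod h
  let τ : LinearMap.ker ε →ₗ[R] K × P₀ := (-φ).prod s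
  have hσ : Function.Surjective σ := by
    intro b
    obtain ⟨q, hq⟩ := hε (π b)
    obtain ⟨k, hk⟩ := (hse.exact (b - h q)).1 (by rw [map_sub, hh', hq, sub_self])
    exact ⟨(k, q), by simp [σ, hk]⟩
  have hτσ : Function.Exact τ σ := by
    rintro ⟨k, q⟩
    constructor
    · intro hkq
      have e : ι k + h q = 0 := by simpa [σ] using hkq
      have hq : ε q = 0 := by
        have := congrArg π e
        rwa [map_add, hse.apply_apply, hh', zero_add, map_zero] at this
      refine ⟨⟨q, hq⟩, Prod.ext (hse.injective ?_) rfl⟩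
      have := hφ ⟨q, hq⟩
      change ι (-φ _) = ι k
      rw [map_neg, this]
      exact (eq_neg_of_add_eq_zero_left e).symm
    · rintro ⟨x, hx⟩
      rw [← hx]
      have := hφ x
      change ι (-φ x) + h (s x) = 0
      rw [map_neg, this]
      exact neg_add_cancel _
  rw [injective_iff_map_eq_zero]
  intro x hx
  have h1 : lTensor R M σ (lTensor R M (LinearMap.inl R K P₀) x) = 0 := by
    rw [lTensor_lTensor, LinearMap.coprod_inl, hx]
  obtain ⟨y, hy⟩ := (lTensor_exact (S := R) (A := M) τ σ hτσ hσ _).1 h1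
  have h2 : lTensor R M s y = 0 := by
    have := congrArg (lTensor R M (LinearMap.snd R K P₀)) hy
    rw [lTensor_lTensor, lTensor_lTensor, LinearMap.snd_comp_inl, lTensor_zero] at this
    exact this
  have h3 : y = 0 := (injective_iff_map_eq_zero _).1 hs y h2
  have := congrArg (lTensor R M (LinearMap.fst R K P₀)) hy
  rw [h3, map_zero, map_zero, lTensor_lTensor, LinearMap.fst_comp_inl, lTensor_id] at this
  exact this.symm

theorem TorOneVanishes.isTorAcyclic {X : ModuleCat.{u} R} (h : TorOneVanishes R M X) :
    IsTorAcyclic R M X := by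
  let P := ProjectiveResolution.of X
  have hz : Limits.IsZero ((((tensorFunctor R R M).mapHomologicalComplex
      (ComplexShape.down ℕ)).obj P.complex).homology 1) :=
    h.of_iso (P.isoLeftDerivedObj (tensorFunctor R R M) 1).symm
  rw [← HomologicalComplex.exactAt_iff_isZero_homology,
    HomologicalComplex.exactAt_iff' _ 2 1 0 (by simp) (by simp),
    ShortComplex.ShortExact.moduleCat_exact_iff_function_exact] at hz
  have : Module.Projective R (P.complex.X 0) :=
    (IsProjective.iff_projective _).2 (P.projective 0)
  have h0 := (ShortComplex.ShortExact.moduleCat_exact_iff_function_exact _).1 P.exact₀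
  exact isTorAcyclic_of_exact (P.complex.d 2 1).hom (P.complex.d 1 0).hom (P.π.f 0).hom
    (fun x => LinearMap.congr_fun (congrArg ModuleCat.Hom.hom (P.complex.d_comp_d 2 1 0)) x) h0
    ((ModuleCat.epi_iff_surjective _).1 inferInstance) hz

/-- An extension of modules with vanishing `Tor₁(M, -)` has vanishing `Tor₁(M, -)`. -/
theorem IsTorAcyclic.of_extension {X Y Z : Type u} [AddCommGroup X] [Module R X] [AddCommGroup Y]
    [Module R Y] [AddCommGroup Z] [Module R Z] (f : X →ₗ[R] Y) (g : Y →ₗ[R] Z)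
    (hfg : IsShortExact f g) (hX : IsTorAcyclic R M X) (hZ : IsTorAcyclic R M Z) :
    IsTorAcyclic R M Y := by
  intro K B _ _ _ _ ι π hse
  -- The preimage of `X` in `B`. The inclusion `K → B` factors as `K → B' → B` with quotients `X`
  -- and `Z`.
  let B' := LinearMap.ker (g ∘ₗ π)
  obtain ⟨p, hp⟩ := exists_factorization_of_exact hfg.injective hfg.exact (π ∘ₗ B'.subtype)
    fun b => b.2
  let ι' : K →ₗ[R] B' := ι.codRestrict _ fun k => by
    rw [LinearMap.mem_ker, LinearMap.comp_apply, hse.apply_apply, map_zero]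
  have h1 : IsShortExact ι' p := by
    refine ⟨fun a b h => hse.injective (congrArg Subtype.val h), fun b => ?_, fun x => ?_⟩
    · rw [← map_eq_zero_iff f hfg.injective, hp]
      refine (hse.exact b).trans ⟨?_, ?_⟩
      · rintro ⟨k, hk⟩
        exact ⟨k, Subtype.ext hk⟩
      · rintro ⟨k, rfl⟩
        exact ⟨k, rfl⟩
    · obtain ⟨b, hb⟩ := hse.surjective (f x)
      refine ⟨⟨b, ?_⟩, hfg.injective ?_⟩
      · rw [LinearMap.mem_ker, LinearMap.comp_apply, hb, hfg.apply_apply]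
      · rw [hp]
        exact hb
  have h2 : IsShortExact B'.subtype (g ∘ₗ π) :=
    ⟨Subtype.val_injective, LinearMap.exact_subtype_ker_map _,
      hfg.surjective.comp hse.surjective⟩
  have h3 := (hZ _ _ _ _ h2).comp (hX _ _ _ _ h1)
  intro a b hab
  apply h3
  change lTensor R M _ (lTensor R M _ a) = lTensor R M _ (lTensor R M _ b)
  rw [lTensor_lTensor, lTensor_lTensor]
  exact hab

end TorAcyclic

/-! ### Tensor powers as iterated tensor products; nilpotence. -/

section TensorIter

open BalancedTensor

variable {R : Type u} [Ring R] {M : Type u} [AddCommGroup M] [Module R M] [Module Rᵐᵒᵖ M]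
  [SMulCommClass R Rᵐᵒᵖ M]

variable (R M) in
/-- The iterated tensor product `M ⊗ (M ⊗ ⋯ (M ⊗ X))`. -/
def tensorIter (i : ℕ) (X : ModuleCat.{u} R) : ModuleCat.{u} R := (tensorFunctor R R M).obj^[i] X

theorem tensorIter_succ' (i : ℕ) (X : ModuleCat.{u} R) : tensorIter R M (i + 1) X =
    (tensorFunctor R R M).obj (tensorIter R M i X) :=
  Function.iterate_succ_apply' _ _ _

/-- The associativity `M^{⊗(i+1)} ⊗ X ≅ M ⊗ (M^{⊗i} ⊗ X)`. -/
theorem nonempty_tensorPow_succ_equiv (i : ℕ) (X : Type u) [AddCommGroup X] [Module R X] :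
    Nonempty (BalancedTensor R (tensorPow R M (i + 1)) X ≃ₗ[R]
      BalancedTensor R M (BalancedTensor R (tensorPow R M i) X)) := by
  let α : BalancedTensor R (tensorPow R M (i + 1)) X →+
    BalancedTensor R M (BalancedTensor R (tensorPow R M i) X) := assocHom R M (tensorPow R M i) X
  have hα : ∀ m y x, α (tmul R (TensorRing.consPow R M m y) x) = tmul R m (tmul R y x) :=
    fun m y x => rfl
  have hlin : ∀ (r : R) z, α (r • z) = r • α z := by
    refine fun r z => DFunLike.congr_fun (f := α.comp (DistribSMul.toAddMonoidHom _ r))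
      (g := (DistribSMul.toAddMonoidHom _ r).comp α) (addHom_ext fun y x => ?_) z
    let β : tensorPow R M (i + 1) →+ BalancedTensor R M (BalancedTensor R (tensorPow R M i) X) :=
      AddMonoidHom.mk' (fun y => α (r • tmul R y x))
        (fun y z => by rw [BalancedTensor.add_tmul, smul_add, map_add])
    let γ : tensorPow R M (i + 1) →+ BalancedTensor R M (BalancedTensor R (tensorPow R M i) X) :=
      AddMonoidHom.mk' (fun y => r • α (tmul R y x))
        (fun y z => by rw [BalancedTensor.add_tmul, map_add, smul_add])
    have : β = γ := addHom_ext (A := M) (X := tensorPow R M i) (f := β) (g := γ) fun m y => rfl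
    exact DFunLike.congr_fun this y
  exact ⟨LinearEquiv.ofBijective { α with map_smul' := hlin }
    ⟨assocHom_injective, fun z => ⟨assocInvHom R M (tensorPow R M i) X z, assocHom_assocInvHom z⟩⟩⟩

/-- The hypotheses are stated with `M^{⊗i} ⊗ X`, whereas the inductions tensor with one copy of `M`
at a time. -/
theorem nonempty_tensorPow_equiv_tensorIter (i : ℕ) (X : ModuleCat.{u} R) :
    Nonempty ((tensorFunctor R R (tensorPow R M i)).obj X ≃ₗ[R] tensorIter R M i X) := by
  induction i with
  | zero => exact ⟨ringTensorEquiv (R := R) (X := X)⟩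
  | succ i ih =>
    obtain ⟨e⟩ := ih
    obtain ⟨e'⟩ := nonempty_tensorPow_succ_equiv (R := R) (M := M) i X
    rw [tensorIter_succ']
    exact ⟨e'.trans (lTensorEquiv R M e)⟩

theorem subsingleton_tensorIter {N : ℕ} (hN : IsNilpotentBimodule R M N) (X : ModuleCat.{u} R) :
    Subsingleton (tensorIter R M (N + 1) X) := by
  obtain ⟨e⟩ := nonempty_tensorPow_equiv_tensorIter (M := M) (N + 1) X
  have : Subsingleton (tensorPow R M (N + 1)) := hN
  refine e.symm.toEquiv.subsingleton_congr.2 (subsingleton_of_forall_eq 0 fun z => ?_)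
  refine induction_on z rfl (fun a x => ?_) (fun y z hy hz => ?_)
  · rw [Subsingleton.elim a 0, BalancedTensor.zero_tmul]
    rfl
  · exact (congrArg₂ _ hy hz).trans (add_zero _)

end TensorIter

/-! ### Induction on powers of `M` for modules with an `M`-action. -/

section Pairs

open BalancedTensor

variable {R : Type u} [Ring R] {M : Type u} [AddCommGroup M] [Module R M] [Module Rᵐᵒᵖ M]
  [SMulCommClass R Rᵐᵒᵖ M]
  {K Q Y : Type u} [AddCommGroup K] [Module R K] [AddCommGroup Q] [Module R Q]
  [AddCommGroup Y] [Module R Y]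

theorem isTorAcyclic_of_subsingleton [Subsingleton Y] : IsTorAcyclic R M Y := by
  intro K B _ _ _ _ ι π hse
  have hs : Function.Surjective ι := fun b => (hse.exact b).1 (Subsingleton.elim _ _)
  let e := LinearEquiv.ofBijective ι ⟨hse.injective, hs⟩
  exact (lTensorEquiv R M e).injective

theorem IsShortExact.lTensor {A B C : Type u} [AddCommGroup A] [Module R A] [AddCommGroup B]
    [Module R B] [AddCommGroup C] [Module R C] {f : A →ₗ[R] B} {g : B →ₗ[R] C}
    (h : IsShortExact f g) (hC : IsTorAcyclic R M C) :
    IsShortExact (lTensor R M f) (lTensor R M g) :=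
  ⟨hC _ _ _ _ h, lTensor_exact _ _ h.exact h.surjective, lTensor_surjective _ h.surjective⟩

theorem IsShortExact.lTensor_of_isPure {A B C : Type u} [AddCommGroup A] [Module R A]
    [AddCommGroup B] [Module R B] [AddCommGroup C] [Module R C] {f : A →ₗ[R] B} {g : B →ₗ[R] C}
    (h : IsShortExact f g) (hf : IsPure f) :
    IsShortExact (BalancedTensor.lTensor R M f) (BalancedTensor.lTensor R M g) :=
  ⟨hf.injective_lTensor, lTensor_exact _ _ h.exact h.surjective,
    lTensor_surjective _ h.surjective⟩

/-- If `u : M ⊗ Y → Y` is a monomorphism whose cokernel `G` satisfies `Tor₁(M, M^{⊗i} ⊗ G) = 0`,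
and `M` is nilpotent on `Y`, then `Tor₁(M, Y) = 0`. -/
theorem isTorAcyclic_of_tensorIter (k : ℕ) : ∀ (Y G : Type u) [AddCommGroup Y] [Module R Y]
    [AddCommGroup G] [Module R G] (u : BalancedTensor R M Y →ₗ[R] Y) (c : Y →ₗ[R] G),
    IsShortExact u c → (∀ i, IsTorAcyclic R M (tensorIter R M i (ModuleCat.of R G))) →
    Subsingleton (tensorIter R M k (ModuleCat.of R Y)) → IsTorAcyclic R M Y := by
  induction k with
  | zero =>
    intro Y G _ _ _ _ u c _ _ hk
    have : Subsingleton Y := hk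
    exact isTorAcyclic_of_subsingleton
  | succ k ih =>
    intro Y G _ _ _ _ u c hse hG hk
    -- `Y` is an extension of `G` by `M ⊗ Y`. The latter is again a module of this kind, with
    -- cokernel `M ⊗ G`, since `Tor₁(M, G) = 0` keeps the sequence exact after tensoring.
    exact IsTorAcyclic.of_extension u c hse
      (ih _ (BalancedTensor R M G) _ _ (hse.lTensor (hG 0)) (fun i => hG (i + 1)) hk) (hG 0)

/-- A map commuting with the actions of `M` is injective if it is injective on cokernels, under
suitable acyclicity and nilpotency assumptions. -/
theorem injective_of_tensorIter (k : ℕ) : ∀ (Y Q G P D : Type u) [AddCommGroup Y] [Module R Y]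
    [AddCommGroup Q] [Module R Q] [AddCommGroup G] [Module R G] [AddCommGroup P] [Module R P]
    [AddCommGroup D] [Module R D] (u : BalancedTensor R M Y →ₗ[R] Y)
    (v : BalancedTensor R M Q →ₗ[R] Q) (c : Y →ₗ[R] G) (d : Q →ₗ[R] P) (f : Y →ₗ[R] Q)
    (j : G →ₗ[R] P) (p : P →ₗ[R] D),
    IsShortExact u c → IsShortExact v d → IsPure v → IsShortExact j p →
    v ∘ₗ lTensor R M f = f ∘ₗ u → d ∘ₗ f = j ∘ₗ c →
    (∀ i, IsTorAcyclic R M (tensorIter R M i (ModuleCat.of R G))) →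
    (∀ i, IsTorAcyclic R M (tensorIter R M i (ModuleCat.of R D))) →
    Subsingleton (tensorIter R M k (ModuleCat.of R Y)) → Function.Injective f := by
  induction k with
  | zero =>
    intro Y Q G P D _ _ _ _ _ _ _ _ _ _ u v c d f j p _ _ _ _ _ _ _ _ hk
    have : Subsingleton Y := hk
    exact Function.injective_of_subsingleton _
  | succ k ih =>
    intro Y Q G P D _ _ _ _ _ _ _ _ _ _ u v c d f j p huc hvd hv hjp hf hc hG hD hk
    -- The whole diagram is tensored with `M`: vanishing `Tor₁` preserves the sequences ending in
    -- `G` and `D`, and purity preserves the one for `Q`. An element of `ker f` dies in `G`, hence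
    -- comes from `M ⊗ Y`, where `M ⊗ f` is injective.
    have h := ih _ _ _ _ _ (lTensor R M u) (lTensor R M v) (lTensor R M c) (lTensor R M d)
      (lTensor R M f) (lTensor R M j) (lTensor R M p) (huc.lTensor (hG 0))
      (hvd.lTensor_of_isPure hv) hv.lTensor (hjp.lTensor (hD 0))
      (by rw [← lTensor_comp, hf, lTensor_comp]) (by rw [← lTensor_comp, hc, lTensor_comp])
      (fun i => hG (i + 1)) (fun i => hD (i + 1)) hk
    rw [injective_iff_map_eq_zero]
    intro y hy
    have h1 : c y = 0 := by
      apply hjp.eq_zero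
      rw [← LinearMap.comp_apply, ← hc, LinearMap.comp_apply, hy, map_zero]
    obtain ⟨z, rfl⟩ := (huc.exact y).1 h1
    have h2 : v (lTensor R M f z) = 0 := (LinearMap.congr_fun hf z).trans hy
    have h3 := hvd.eq_zero h2
    rw [(injective_iff_map_eq_zero _).1 h z h3, map_zero]

variable {u : BalancedTensor R M K →ₗ[R] K} {v : BalancedTensor R M Q →ₗ[R] Q}
  {w : BalancedTensor R M Y →ₗ[R] Y} {ι : K →ₗ[R] Q} {π : Q →ₗ[R] Y}
  {C P G : Type u} [AddCommGroup C] [Module R C] [AddCommGroup P] [Module R P]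
  [AddCommGroup G] [Module R G] {a : K →ₗ[R] C} {b : Q →ₗ[R] P} {c : Y →ₗ[R] G}

/-- The cokernels of the actions of `M` form a short exact sequence if the last action is a
monomorphism. -/
theorem exists_isShortExact_coker (h : IsShortExact ι π) (hι : v ∘ₗ lTensor R M ι = ι ∘ₗ u)
    (hπ : w ∘ₗ lTensor R M π = π ∘ₗ v) (ha : Function.Exact u a) (has : Function.Surjective a)
    (hb : Function.Exact v b) (hbs : Function.Surjective b) (hc : IsShortExact w c) :
    ∃ (i : C →ₗ[R] P) (p : P →ₗ[R] G), IsShortExact i p ∧ (∀ k, i (a k) = b (ι k)) ∧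
      ∀ q, p (b q) = c (π q) := by
  have hι' : ∀ z, v (lTensor R M ι z) = ι (u z) := LinearMap.congr_fun hι
  have hπ' : ∀ z, w (lTensor R M π z) = π (v z) := LinearMap.congr_fun hπ
  obtain ⟨i, hi⟩ := exists_desc_of_exact ha has (b ∘ₗ ι) (fun z => by
    rw [LinearMap.comp_apply, ← hι', hb.apply_apply_eq_zero])
  obtain ⟨p, hp⟩ := exists_desc_of_exact hb hbs (c ∘ₗ π) (fun z => by
    rw [LinearMap.comp_apply, ← hπ', hc.apply_apply])
  refine ⟨i, p, ⟨?_, ?_, ?_⟩, hi, hp⟩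
  · rw [injective_iff_map_eq_zero]
    intro x hx
    obtain ⟨k, rfl⟩ := has x
    rw [hi, LinearMap.comp_apply] at hx
    obtain ⟨z, hz⟩ := (hb _).1 hx
    have h1 : lTensor R M π z = 0 := by
      apply hc.eq_zero
      rw [hπ', hz, h.apply_apply]
    obtain ⟨z', rfl⟩ := (lTensor_exact (S := R) (A := M) ι π h.exact h.surjective z).1 h1
    rw [hι'] at hz
    rw [← h.injective hz, ha.apply_apply_eq_zero]
  · intro x
    obtain ⟨q, rfl⟩ := hbs x
    rw [hp, LinearMap.comp_apply]
    constructor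
    · intro hq
      obtain ⟨z, hz⟩ := (hc.exact _).1 hq
      obtain ⟨z, rfl⟩ := lTensor_surjective (S := R) (A := M) π h.surjective z
      rw [hπ'] at hz
      obtain ⟨k, hk⟩ := (h.exact (q - v z)).1 (by rw [map_sub, hz, sub_self])
      refine ⟨a k, ?_⟩
      rw [hi, LinearMap.comp_apply, hk, map_sub, hb.apply_apply_eq_zero, sub_zero]
    · rintro ⟨y, hy⟩
      obtain ⟨k, rfl⟩ := has y
      rw [hi, LinearMap.comp_apply] at hy
      obtain ⟨z, hz⟩ := (hb (q - ι k)).1 (by rw [map_sub, hy, sub_self])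
      rw [← sub_add_cancel q (ι k), ← hz, map_add, h.apply_apply, add_zero, ← hπ', hc.apply_apply]
  · intro x
    obtain ⟨y, rfl⟩ := hc.surjective x
    obtain ⟨q, rfl⟩ := h.surjective y
    exact ⟨b q, hp q⟩

/-- The action of `M` on a quotient is a monomorphism if the induced map on cokernels is. -/
theorem isShortExact_quotient {D : Type u} [AddCommGroup D] [Module R D]
    {j : C →ₗ[R] P} {p : P →ₗ[R] D} (h : IsShortExact ι π) (hι : v ∘ₗ lTensor R M ι = ι ∘ₗ u)
    (hπ : w ∘ₗ lTensor R M π = π ∘ₗ v) (ha : IsShortExact u a)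
    (hb : IsShortExact v b) (hjp : IsShortExact j p) (hbj : b ∘ₗ ι = j ∘ₗ a) :
    ∃ c : Y →ₗ[R] D, IsShortExact w c := by
  have hι' : ∀ z, v (lTensor R M ι z) = ι (u z) := LinearMap.congr_fun hι
  have hπ' : ∀ z, w (lTensor R M π z) = π (v z) := LinearMap.congr_fun hπ
  have hbj' : ∀ k, b (ι k) = j (a k) := LinearMap.congr_fun hbj
  obtain ⟨c, hc⟩ := exists_desc_of_exact h.exact h.surjective (p ∘ₗ b) (fun k => by
    rw [LinearMap.comp_apply, hbj', hjp.apply_apply])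
  refine ⟨c, ?_, ?_, ?_⟩
  · rw [injective_iff_map_eq_zero]
    intro z hz
    obtain ⟨z, rfl⟩ := lTensor_surjective (S := R) (A := M) π h.surjective z
    rw [hπ'] at hz
    obtain ⟨k, hk⟩ := (h.exact _).1 hz
    have h1 : a k = 0 := by
      apply hjp.eq_zero
      rw [← hbj', hk, hb.apply_apply]
    obtain ⟨y, rfl⟩ := (ha.exact k).1 h1
    rw [← hι'] at hk
    rw [← hb.injective hk, lTensor_lTensor, h.exact.linearMap_comp_eq_zero, lTensor_zero,
      LinearMap.zero_apply]
  · intro y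
    obtain ⟨q, rfl⟩ := h.surjective y
    rw [hc, LinearMap.comp_apply]
    constructor
    · intro hq
      obtain ⟨x, hx⟩ := (hjp.exact _).1 hq
      obtain ⟨k, rfl⟩ := ha.surjective x
      obtain ⟨z, hz⟩ := (hb.exact (q - ι k)).1 (by rw [map_sub, hbj', hx, sub_self])
      exact ⟨lTensor R M π z, by rw [hπ', hz, map_sub, h.apply_apply, sub_zero]⟩
    · rintro ⟨z, hz⟩
      obtain ⟨z, rfl⟩ := lTensor_surjective (S := R) (A := M) π h.surjective z
      rw [hπ'] at hz
      obtain ⟨k, hk⟩ := (h.exact (q - v z)).1 (by rw [map_sub, hz, sub_self])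
      rw [← sub_add_cancel q (v z), ← hk, map_add, hb.apply_apply, add_zero, hbj', hjp.apply_apply]
  · intro x
    obtain ⟨y, rfl⟩ := hjp.surjective x
    obtain ⟨q, rfl⟩ := hb.surjective y
    exact ⟨π q, hc q⟩

variable (v) in
/-- `(Q, v)` is projective in the category of modules `E` with a map `M ⊗ E → E`. -/
def IsProjectivePair : Prop :=
  ∀ (E E' : Type u) [AddCommGroup E] [Module R E] [AddCommGroup E'] [Module R E']
    (e : BalancedTensor R M E →ₗ[R] E) (e' : BalancedTensor R M E' →ₗ[R] E') (p : E →ₗ[R] E')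
    (g : Q →ₗ[R] E'), e' ∘ₗ lTensor R M p = p ∘ₗ e → Function.Surjective p →
    e' ∘ₗ lTensor R M g = g ∘ₗ v →
    ∃ φ : Q →ₗ[R] E, e ∘ₗ lTensor R M φ = φ ∘ₗ v ∧ p ∘ₗ φ = g

/-- Maps to a filtered object extend along `ι : K → Q`, if the cokernel `G` of the action of `M`
on `Q / K` satisfies `Ext¹(G, M^{⊗i} ⊗ B) = 0` where `B` is the cokernel of the action of `M` on the
target. -/
theorem exists_extension_of_tensorIter (h : IsShortExact ι π)
    (hι : v ∘ₗ lTensor R M ι = ι ∘ₗ u) (hπ : w ∘ₗ lTensor R M π = π ∘ₗ v)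
    (hc : IsShortExact w c) (hv : IsProjectivePair v) (k : ℕ) :
    ∀ (W B : Type u) [AddCommGroup W] [Module R W] [AddCommGroup B] [Module R B]
      (x : BalancedTensor R M W →ₗ[R] W) (d : W →ₗ[R] B), IsShortExact x d → IsPure x →
      (∀ i, ExtendsTo R G (tensorIter R M i (ModuleCat.of R B))) →
      Subsingleton (tensorIter R M k (ModuleCat.of R W)) →
      ∀ f : K →ₗ[R] W, x ∘ₗ lTensor R M f = f ∘ₗ u →
      ∃ g : Q →ₗ[R] W, x ∘ₗ lTensor R M g = g ∘ₗ v ∧ g ∘ₗ ι = f := by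
  induction k with
  | zero =>
    intro W B _ _ _ _ x d _ _ _ hk f _
    have : Subsingleton W := hk
    exact ⟨0, Subsingleton.elim _ _, Subsingleton.elim _ _⟩
  | succ k ih =>
    intro W B _ _ _ _ x d hxd hx hB hk f hf
    have hf' : ∀ z, x (lTensor R M f z) = f (u z) := LinearMap.congr_fun hf
    obtain ⟨i, p, hip, hi, hp⟩ := exists_isShortExact_coker h hι hπ
      (LinearMap.exact_map_mkQ_range u) (Submodule.mkQ_surjective _)
      (LinearMap.exact_map_mkQ_range v) (Submodule.mkQ_surjective _) hc
    obtain ⟨f₁, hf₁⟩ := exists_desc_of_exact (LinearMap.exact_map_mkQ_range u)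
      (Submodule.mkQ_surjective _) (d ∘ₗ f) (fun z => by
        rw [LinearMap.comp_apply, ← hf', hxd.apply_apply])
    have hB₀ : ExtendsTo R G B := hB 0
    -- The map is first extended on cokernels, by `Ext¹(G, B) = 0`, and then lifted to `φ : Q → W`
    -- by projectivity, with `M` acting by zero on `B`.
    obtain ⟨g₁, hg₁⟩ := hB₀ _ _ i p hip f₁
    obtain ⟨φ, hφ, hφg⟩ := hv W B x 0 d (g₁ ∘ₗ (LinearMap.range v).mkQ)
      (by rw [hxd.exact.linearMap_comp_eq_zero, LinearMap.zero_comp]) hxd.surjective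
      (by
        rw [LinearMap.comp_assoc, (LinearMap.exact_map_mkQ_range v).linearMap_comp_eq_zero,
          LinearMap.comp_zero, LinearMap.zero_comp])
    have hφ' : ∀ z, x (lTensor R M φ z) = φ (v z) := LinearMap.congr_fun hφ
    have hι' : ∀ z, v (lTensor R M ι z) = ι (u z) := LinearMap.congr_fun hι
    -- The error of `φ` vanishes in `B`, so it is a map into `M ⊗ W`. That module has cokernel `M ⊗
    -- B` and a pure action, and one power of `M` fewer kills it, so the induction hypothesis
    -- extends the error over `Q`.
    obtain ⟨f₂, hf₂⟩ := exists_factorization_of_exact hxd.injective hxd.exact (f - φ ∘ₗ ι)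
      (fun k => by
        have h1 := LinearMap.congr_fun hφg (ι k)
        simp only [LinearMap.comp_apply] at h1
        rw [LinearMap.sub_apply, map_sub, LinearMap.comp_apply, h1, ← hi, hg₁, hf₁,
          LinearMap.comp_apply, sub_self])
    have hxf : x ∘ₗ f₂ = f - φ ∘ₗ ι := LinearMap.ext hf₂
    obtain ⟨g₂, hg₂, hg₂f⟩ := ih (BalancedTensor R M W) (BalancedTensor R M B) (lTensor R M x)
      (lTensor R M d) (hxd.lTensor_of_isPure hx) hx.lTensor (fun i => hB (i + 1)) hk f₂ (by
        ext z
        apply hxd.injective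
        simp only [LinearMap.comp_apply]
        rw [hf₂, lTensor_lTensor, hxf, LinearMap.sub_apply, LinearMap.comp_apply, ← hι', ← hφ',
          ← hf', lTensor_lTensor, ← map_sub]
        congr 1
        induction z using BalancedTensor.induction_on with
        | h0 => simp
        | ht m k => simp [eq_sub_iff_add_eq, ← BalancedTensor.tmul_add]
        | ha y z hy hz => rw [map_add, hy, hz, map_add, map_add]; abel)
    refine ⟨φ + x ∘ₗ g₂, ?_, ?_⟩
    · refine BalancedTensor.linearMap_ext fun m q => ?_
      have h1 := hφ' (tmul R m q)
      have h2 := congrArg x (LinearMap.congr_fun hg₂ (tmul R m q))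
      simp only [LinearMap.comp_apply, lTensor_tmul, LinearMap.add_apply] at h1 h2 ⊢
      rw [BalancedTensor.tmul_add, map_add, h1, h2]
    · rw [LinearMap.add_comp, LinearMap.comp_assoc, hg₂f, hxf]
      exact add_sub_cancel _ _

end Pairs

/-! ### Projective modules over the tensor ring as projective pairs. -/

namespace TensorRing

variable {R : Type u} [Ring R] {M : Type u} [AddCommGroup M] [Module R M] [Module Rᵐᵒᵖ M]
  [SMulCommClass R Rᵐᵒᵖ M]
  {W : Type u} [AddCommGroup W] [Module R W] [Module (TensorRing R M) W]
  [IsScalarTower R (TensorRing R M) W]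

/-- The pairs to lift against carry no `T`-module structure. `W` is a `T`-summand of `Ind` of the
free `R`-module on the set `W`, which lifts against arbitrary pairs by its universal property. -/
theorem isProjectivePair_actionMap [Module.Projective (TensorRing R M) W] :
    IsProjectivePair (actionMap R M W) := by
  intro E E' _ _ _ _ e e' p g hp hs hg
  obtain ⟨r, hr⟩ := exists_ind_linearMap (M := M)
    (Finsupp.linearCombination R (id : W → W))
  obtain ⟨s, hs'⟩ := Module.projective_lifting_property r LinearMap.id (fun w =>
    ⟨indUnit R M _ (Finsupp.single w 1), by rw [hr]; simp⟩)
  have hrs : r.restrictScalars R ∘ₗ s.restrictScalars R = LinearMap.id :=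
    LinearMap.ext fun w => LinearMap.congr_fun hs' w
  obtain ⟨φ, hφ, hφg⟩ := exists_ind_factorization e e' p hp hs (g ∘ₗ r.restrictScalars R) (by
    rw [BalancedTensor.lTensor_comp, ← LinearMap.comp_assoc, hg, LinearMap.comp_assoc,
      actionMap_natural, LinearMap.comp_assoc])
  refine ⟨φ ∘ₗ s.restrictScalars R, ?_, ?_⟩
  · rw [BalancedTensor.lTensor_comp, ← LinearMap.comp_assoc, hφ, LinearMap.comp_assoc,
      actionMap_natural, LinearMap.comp_assoc]
  · rw [← LinearMap.comp_assoc, hφg, LinearMap.comp_assoc, hrs, LinearMap.comp_id]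

end TensorRing

/-! ### Complete projective resolutions: syzygies and splicing. -/

section CompleteResolutions

variable {S : Type u} [Ring S] {𝒴 : ObjectProperty (ModuleCat.{u} S)}

theorem gorensteinProjective_of_linearEquiv {G G' : ModuleCat.{u} S}
    (h : gorensteinProjective 𝒴 G) (e : G' ≃ₗ[S] G) : gorensteinProjective 𝒴 G' := by
  obtain ⟨P, hP, ⟨e'⟩⟩ := h
  exact ⟨P, hP, ⟨e.trans e'⟩⟩

/-- The complex `P` with degrees shifted by `n`. -/
def translateComplex (P : CochainComplex (ModuleCat.{u} S) ℤ) (n : ℤ) :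
    CochainComplex (ModuleCat.{u} S) ℤ where
  X i := P.X (i + n)
  d i j := P.d (i + n) (j + n)
  shape i j hij := P.shape _ _ fun h => hij (by
    change i + n + 1 = j + n at h
    change i + 1 = j
    omega)
  d_comp_d' i j k _ _ := P.d_comp_d _ _ _

theorem IsCompleteProjectiveResolution.translate {P : CochainComplex (ModuleCat.{u} S) ℤ}
    (hP : IsCompleteProjectiveResolution 𝒴 P) (n : ℤ) :
    IsCompleteProjectiveResolution 𝒴 (translateComplex P n) where
  projective i := hP.projective (i + n)
  exact i j k hij hjk := hP.exact (i + n) (j + n) (k + n) (by omega) (by omega)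
  homExact X hX i j k hij hjk :=
    hP.homExact X hX (i + n) (j + n) (k + n) (by omega) (by omega)

theorem IsCompleteProjectiveResolution.gorensteinProjective_range
    {P : CochainComplex (ModuleCat.{u} S) ℤ} (hP : IsCompleteProjectiveResolution 𝒴 P)
    (i j : ℤ) (hij : i + 1 = j) :
    gorensteinProjective 𝒴 (ModuleCat.of S (LinearMap.range (P.d i j).hom)) := by
  refine ⟨translateComplex P j, hP.translate j, ?_⟩
  -- The differential of the translated complex sits at indices `-1 + j` and `0 + j`, equal to `i`
  -- and `j` only propositionally.
  have key : ∀ i' j' : ℤ, i' = i → j' = j →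
      Nonempty (LinearMap.range (P.d i j).hom ≃ₗ[S] LinearMap.range (P.d i' j').hom) := by
    rintro _ _ rfl rfl
    exact ⟨LinearEquiv.refl _ _⟩
  exact key (-1 + j) (0 + j) (by omega) (by omega)

theorem gorensteinProjective.exists_coresolution {G : ModuleCat.{u} S}
    (h : gorensteinProjective 𝒴 G) :
    ∃ (Q G' : ModuleCat.{u} S) (ι : G →ₗ[S] Q) (π : Q →ₗ[S] G'), Module.Projective S Q ∧
      gorensteinProjective 𝒴 G' ∧ IsShortExact ι π := by
  obtain ⟨P, hP, ⟨e⟩⟩ := h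
  refine ⟨P.X 0, ModuleCat.of S (LinearMap.range (P.d 0 1).hom),
    (LinearMap.range (P.d (-1) 0).hom).subtype ∘ₗ e.toLinearMap, (P.d 0 1).hom.rangeRestrict,
    hP.projective 0, hP.gorensteinProjective_range 0 1 (by omega),
    Subtype.val_injective.comp e.injective, fun x => ?_, LinearMap.surjective_rangeRestrict _⟩
  rw [← Submodule.coe_eq_zero]
  refine (hP.exact (-1) 0 1 (by omega) (by omega) x).trans ⟨fun hx => ?_, ?_⟩
  · exact ⟨e.symm ⟨x, hx⟩, by simp⟩
  · rintro ⟨y, rfl⟩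
    exact (e y).2

theorem gorensteinProjective.exists_resolution {G : ModuleCat.{u} S}
    (h : gorensteinProjective 𝒴 G) :
    ∃ (Q G' : ModuleCat.{u} S) (ι : G' →ₗ[S] Q) (π : Q →ₗ[S] G), Module.Projective S Q ∧
      gorensteinProjective 𝒴 G' ∧ IsShortExact ι π := by
  obtain ⟨P, hP, ⟨e⟩⟩ := h
  refine ⟨P.X (-1), ModuleCat.of S (LinearMap.range (P.d (-2) (-1)).hom),
    (LinearMap.range (P.d (-2) (-1)).hom).subtype,
    e.symm.toLinearMap ∘ₗ (P.d (-1) 0).hom.rangeRestrict,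
    hP.projective (-1), hP.gorensteinProjective_range (-2) (-1) (by omega),
    Subtype.val_injective, fun x => ?_,
    e.symm.surjective.comp (LinearMap.surjective_rangeRestrict _)⟩
  rw [LinearMap.comp_apply, LinearEquiv.coe_coe, e.symm.map_eq_zero_iff, ← Submodule.coe_eq_zero]
  refine (hP.exact (-2) (-1) 0 (by omega) (by omega) x).trans ⟨fun hx => ?_, ?_⟩
  · exact ⟨⟨x, hx⟩, rfl⟩
  · rintro ⟨y, rfl⟩
    exact y.2

/-- A doubly infinite sequence of objects of a class which is closed under the choice of a
successor and of a predecessor. -/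
theorem exists_int_sequence {C : Type v} (p : C → Prop) (r : C → C → Prop)
    (hup : ∀ c, p c → ∃ c', p c' ∧ r c c') (hdown : ∀ c, p c → ∃ c', p c' ∧ r c' c)
    (c : C) (hc : p c) : ∃ s : ℤ → C, s 0 = c ∧ (∀ n, p (s n)) ∧ ∀ n, r (s n) (s (n + 1)) := by
  choose! f hf hf' using hup
  choose! g hg hg' using hdown
  have hfn : ∀ n : ℕ, p (f^[n] c) := by
    intro n
    induction n with
    | zero => exact hc
    | succ n ih =>
      rw [Function.iterate_succ_apply']
      exact hf _ ih
  have hgn : ∀ n : ℕ, p (g^[n] c) := by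
    intro n
    induction n with
    | zero => exact hc
    | succ n ih =>
      rw [Function.iterate_succ_apply']
      exact hg _ ih
  let s : ℤ → C := fun n => match n with
    | Int.ofNat n => f^[n] c
    | Int.negSucc n => g^[n + 1] c
  refine ⟨s, rfl, ?_, ?_⟩
  · rintro (n | n)
    · exact hfn n
    · exact hgn (n + 1)
  · rintro (n | n)
    · change r (f^[n] c) (f^[n + 1] c)
      rw [Function.iterate_succ_apply']
      exact hf' _ (hfn n)
    · have h1 : s (Int.negSucc n + 1) = g^[n] c := by
        cases n with
        | zero => rfl
        | succ n => rfl
      rw [h1]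
      change r (g^[n + 1] c) _
      rw [Function.iterate_succ_apply']
      exact hg' _ (hgn n)

/-- A class of modules with projective resolutions and coresolutions within the class, which is
left orthogonal to `𝒴`, consists of `𝒴`-Gorenstein projective modules. -/
theorem le_gorensteinProjective (𝒢 : ObjectProperty (ModuleCat.{u} S))
    (hup : ∀ Y, 𝒢 Y → ∃ (Q Y' : ModuleCat.{u} S) (ι : Y →ₗ[S] Q) (π : Q →ₗ[S] Y'),
      Module.Projective S Q ∧ 𝒢 Y' ∧ IsShortExact ι π)
    (hdown : ∀ Y, 𝒢 Y → ∃ (Q Y' : ModuleCat.{u} S) (ι : Y' →ₗ[S] Q) (π : Q →ₗ[S] Y),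
      Module.Projective S Q ∧ 𝒢 Y' ∧ IsShortExact ι π)
    (hext : ∀ (K Q Y : ModuleCat.{u} S) (ι : K →ₗ[S] Q) (π : Q →ₗ[S] Y), IsShortExact ι π →
      Module.Projective S Q → 𝒢 Y → ∀ W, 𝒴 W → ∀ f : K →ₗ[S] W, ∃ g : Q →ₗ[S] W, g ∘ₗ ι = f) :
    𝒢 ≤ gorensteinProjective 𝒴 := by
  intro Y hY
  obtain ⟨K, hK0, hK, hstep⟩ := exists_int_sequence 𝒢
    (fun A B => ∃ (Q : ModuleCat.{u} S) (ι : A →ₗ[S] Q) (π : Q →ₗ[S] B),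
      Module.Projective S Q ∧ IsShortExact ι π)
    (fun A hA => by
      obtain ⟨Q, A', ι, π, h1, h2, h3⟩ := hup A hA
      exact ⟨A', h2, Q, ι, π, h1, h3⟩)
    (fun A hA => by
      obtain ⟨Q, A', ι, π, h1, h2, h3⟩ := hdown A hA
      exact ⟨A', h2, Q, ι, π, h1, h3⟩) Y hY
  choose Q ι π hQ hιπ using hstep
  -- The short exact sequences `K n → Q n → K (n + 1)` are spliced, so that `K (n + 1)` is the image
  -- of `d n`.
  let d (n : ℤ) : Q n ⟶ Q (n + 1) := ModuleCat.ofHom (ι (n + 1) ∘ₗ π n)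
  have hd : ∀ n x, (d n).hom x = ι (n + 1) (π n x) := fun n x => rfl
  let P : CochainComplex (ModuleCat.{u} S) ℤ := CochainComplex.of Q d (fun n => by
    ext x
    change ι (n + 1 + 1) (π (n + 1) (ι (n + 1) (π n x))) = 0
    rw [(hιπ (n + 1)).apply_apply, map_zero])
  have hPd : ∀ n, P.d n (n + 1) = d n := fun n => CochainComplex.of_d _ _ n
  have hP : IsCompleteProjectiveResolution 𝒴 P := by
    refine ⟨hQ, ?_, ?_⟩
    · rintro i _ _ rfl rfl
      rw [hPd, hPd]
      intro x
      rw [hd]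
      refine ((map_eq_zero_iff _ (hιπ (i + 1 + 1)).injective).trans ((hιπ (i + 1)).exact x)).trans
        ⟨?_, ?_⟩
      · rintro ⟨y, rfl⟩
        obtain ⟨z, rfl⟩ := (hιπ i).surjective y
        exact ⟨z, rfl⟩
      · rintro ⟨z, rfl⟩
        exact ⟨π i z, rfl⟩
    · rintro W hW i _ _ rfl rfl
      rw [hPd, hPd]
      intro f
      constructor
      · intro hf
        have hf' : ∀ z, f.hom (ι (i + 1) (π i z)) = 0 := fun z =>
          LinearMap.congr_fun (congrArg ModuleCat.Hom.hom hf) z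
        obtain ⟨g, hg⟩ := exists_desc_of_exact (hιπ (i + 1)).exact (hιπ (i + 1)).surjective f.hom
          (fun k => by
            obtain ⟨z, rfl⟩ := (hιπ i).surjective k
            exact hf' z)
        -- A cocycle on `Q (i + 1)` is a map on the syzygy `K (i + 2)`; it is a coboundary once that
        -- map extends to `Q (i + 2)`.
        obtain ⟨g', hg'⟩ := hext _ _ _ _ _ (hιπ (i + 1 + 1)) (hQ _) (hK _) W hW g
        refine ⟨ModuleCat.ofHom g', ?_⟩
        ext x
        exact (LinearMap.congr_fun hg' (π (i + 1) x)).trans (hg x)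
      · rintro ⟨g, rfl⟩
        ext x
        change g.hom (ι (i + 1 + 1) (π (i + 1) (ι (i + 1) (π i x)))) = 0
        rw [(hιπ (i + 1)).apply_apply, map_zero, map_zero]
  refine gorensteinProjective_of_linearEquiv (hP.gorensteinProjective_range (-1) 0 (by omega)) ?_
  have hr : LinearMap.range (P.d (-1) 0).hom = LinearMap.range (ι 0) := by
    have h1 : P.d (-1) 0 = d (-1) := hPd (-1)
    rw [h1]
    exact LinearMap.range_comp_of_range_eq_top _ (LinearMap.range_eq_top.2 (hιπ (-1)).surjective)
  have e : K 0 ≃ₗ[S] LinearMap.range (P.d (-1) 0).hom :=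
    (LinearEquiv.ofInjective (ι 0) (hιπ 0).injective).trans (LinearEquiv.ofEq _ _ hr.symm)
  rw [hK0] at e
  exact e

end CompleteResolutions

/-! ### Kernels and cokernels as short exact sequences. -/

section Kernels

variable {S : Type u} [Ring S]

theorem exists_isShortExact_of_surjective {Q Y : Type u} [AddCommGroup Q] [Module S Q]
    [AddCommGroup Y] [Module S Y] (f : Q →ₗ[S] Y) (hf : Function.Surjective f) :
    ∃ (K : ModuleCat.{u} S) (ι : K →ₗ[S] Q), IsShortExact ι f :=
  ⟨ModuleCat.of S (LinearMap.ker f), (LinearMap.ker f).subtype, Subtype.val_injective,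
    LinearMap.exact_subtype_ker_map f, hf⟩

theorem exists_isShortExact_of_injective {K Q : Type u} [AddCommGroup K] [Module S K]
    [AddCommGroup Q] [Module S Q] (f : K →ₗ[S] Q) (hf : Function.Injective f) :
    ∃ (Y : ModuleCat.{u} S) (π : Q →ₗ[S] Y), IsShortExact f π :=
  ⟨ModuleCat.of S (Q ⧸ LinearMap.range f), (LinearMap.range f).mkQ, hf,
    LinearMap.exact_map_mkQ_range f, Submodule.mkQ_surjective _⟩

theorem IsShortExact.nonempty_linearEquiv {K K' Q Y : Type u} [AddCommGroup K] [Module S K]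
    [AddCommGroup K'] [Module S K'] [AddCommGroup Q] [Module S Q] [AddCommGroup Y] [Module S Y]
    {ι : K →ₗ[S] Q} {ι' : K' →ₗ[S] Q} {π : Q →ₗ[S] Y} (h : IsShortExact ι π)
    (h' : IsShortExact ι' π) : Nonempty (K ≃ₗ[S] K') :=
  ⟨(LinearEquiv.ofInjective ι h.injective).trans ((LinearEquiv.ofEq _ _ (by
    rw [← LinearMap.exact_iff.1 h.exact, ← LinearMap.exact_iff.1 h'.exact])).trans
      (LinearEquiv.ofInjective ι' h'.injective).symm)⟩

end Kernels

/-! ### Nakayama's lemma for a nilpotent action. -/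

section Nakayama

open BalancedTensor

variable {R : Type u} [Ring R] {M : Type u} [AddCommGroup M] [Module R M] [Module Rᵐᵒᵖ M]
  [SMulCommClass R Rᵐᵒᵖ M]

/-- Nakayama's lemma: a map commuting with the nilpotent action of `M` is surjective if it is
surjective onto the cokernel of the action. -/
theorem surjective_of_tensorIter (k : ℕ) : ∀ (Y Q G : Type u) [AddCommGroup Y] [Module R Y]
    [AddCommGroup Q] [Module R Q] [AddCommGroup G] [Module R G] (w : BalancedTensor R M Y →ₗ[R] Y)
    (v : BalancedTensor R M Q →ₗ[R] Q) (c : Y →ₗ[R] G) (f : Q →ₗ[R] Y),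
    Function.Exact w c → w ∘ₗ lTensor R M f = f ∘ₗ v → Function.Surjective (c ∘ₗ f) →
    Subsingleton (tensorIter R M k (ModuleCat.of R Y)) → Function.Surjective f := by
  induction k with
  | zero =>
    intro Y Q G _ _ _ _ _ _ w v c f _ _ _ hk y
    have : Subsingleton Y := hk
    exact ⟨0, Subsingleton.elim _ _⟩
  | succ k ih =>
    intro Y Q G _ _ _ _ _ _ w v c f hwc hf hcf hk y
    have hc : Function.Surjective c := fun g => by
      obtain ⟨q, hq⟩ := hcf g
      exact ⟨f q, hq⟩
    -- Only right exactness of `M ⊗ -` is needed to pass to `M ⊗ Y`. Then `y - f q` lies in the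
    -- image of `w`, hence in `w (M ⊗ f)`, which is contained in the image of `f`.
    have h := ih _ _ _ (lTensor R M w) (lTensor R M v) (lTensor R M c) (lTensor R M f)
      (lTensor_exact _ _ hwc hc) (by rw [← lTensor_comp, hf, lTensor_comp])
      (by
        rw [← lTensor_comp]
        exact lTensor_surjective _ hcf) hk
    obtain ⟨q, hq⟩ := hcf (c y)
    obtain ⟨z, hz⟩ := (hwc (y - f q)).1 (by rw [map_sub, ← hq, LinearMap.comp_apply, sub_self])
    obtain ⟨z, rfl⟩ := h z
    exact ⟨v z + q, by
      rw [map_add, ← LinearMap.comp_apply f v, ← hf, LinearMap.comp_apply, hz, sub_add_cancel]⟩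

end Nakayama

/-! ### Admissibility: `Φ` is contained in the Gorenstein class. -/

namespace TensorRing

variable {R : Type u} [Ring R] {M : Type u} [AddCommGroup M] [Module R M] [Module Rᵐᵒᵖ M]
  [SMulCommClass R Rᵐᵒᵖ M] {𝒳 : ObjectProperty (ModuleCat.{u} R)} {N : ℕ}

/-- The underlying `R`-module of a module over the tensor ring. -/
@[reducible]
def baseModule (A : ModuleCat.{u} (TensorRing R M)) : Module R A :=
  Module.compHom A (ofScalar R M)

attribute [local instance] baseModule

instance isScalarTower_baseModule (A : ModuleCat.{u} (TensorRing R M)) :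
    IsScalarTower R (TensorRing R M) A :=
  isScalarTower_of_ofScalar_smul fun _ _ => rfl

/-- The class `Φ(𝒳)`, for unbundled modules. -/
def IsPhi (M : Type u) [AddCommGroup M] [Module R M] [Module Rᵐᵒᵖ M] [SMulCommClass R Rᵐᵒᵖ M]
    (𝒳 : ObjectProperty (ModuleCat.{u} R)) (W : Type u) [AddCommGroup W] [Module R W]
    [Module (TensorRing R M) W] [IsScalarTower R (TensorRing R M) W] : Prop :=
  ∃ (G : ModuleCat.{u} R) (c : W →ₗ[R] G), 𝒳 G ∧ IsShortExact (actionMap R M W) c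

/-- Being Gorenstein projective is invariant under isomorphism, so any model of the cokernel may be
used. -/
theorem phi_gorensteinProjective_iff (A : ModuleCat.{u} (TensorRing R M)) :
    Phi R M (gorensteinProjective 𝒳) A ↔ IsPhi M (gorensteinProjective 𝒳) A := by
  constructor
  · rintro ⟨h1, h2⟩
    exact ⟨_, (LinearMap.range (actionMap R M A)).mkQ, h2, h1, LinearMap.exact_map_mkQ_range _,
      Submodule.mkQ_surjective _⟩
  · rintro ⟨G, c, hG, hc⟩
    refine ⟨hc.injective, gorensteinProjective_of_linearEquiv hG ?_⟩
    exact (Submodule.quotEquivOfEq _ _ (LinearMap.exact_iff.1 hc.exact).symm).trans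
      (c.quotKerEquivOfSurjective hc.surjective)

variable {K Q Y : Type u} [AddCommGroup K] [Module R K] [Module (TensorRing R M) K]
  [IsScalarTower R (TensorRing R M) K] [AddCommGroup Q] [Module R Q] [Module (TensorRing R M) Q]
  [IsScalarTower R (TensorRing R M) Q] [AddCommGroup Y] [Module R Y] [Module (TensorRing R M) Y]
  [IsScalarTower R (TensorRing R M) Y]
  {W : Type u} [AddCommGroup W] [Module R W] [Module (TensorRing R M) W]
  [IsScalarTower R (TensorRing R M) W]

theorem isShortExact_restrictScalars {ι : K →ₗ[TensorRing R M] Q} {π : Q →ₗ[TensorRing R M] Y}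
    (h : IsShortExact ι π) : IsShortExact (ι.restrictScalars R) (π.restrictScalars R) :=
  ⟨h.injective, h.exact, h.surjective⟩

theorem _root_.IsAdmissible.isTorAcyclic (h : IsAdmissible R M 𝒳) {G : ModuleCat.{u} R}
    (hG : gorensteinProjective 𝒳 G) (i : ℕ) : IsTorAcyclic R M (tensorIter R M i G) := by
  obtain ⟨e⟩ := nonempty_tensorPow_equiv_tensorIter (M := M) i G
  exact (h.tor_eq_zero G hG i).isTorAcyclic.of_linearEquiv e.symm

theorem _root_.IsAdmissible.extendsTo (h : IsAdmissible R M 𝒳) {G : ModuleCat.{u} R}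
    (hG : gorensteinProjective 𝒳 G) {X : ModuleCat.{u} R} (hX : 𝒳 X) (i : ℕ) :
    ExtendsTo R G (tensorIter R M i X) := by
  obtain ⟨e⟩ := nonempty_tensorPow_equiv_tensorIter (M := M) i X
  exact (h.ext_eq_zero G hG X hX i).extendsTo.of_linearEquiv (LinearEquiv.refl R G) e

theorem isTorAcyclic_of_isShortExact (hN : IsNilpotentBimodule R M N) (h : IsAdmissible R M 𝒳)
    {G : ModuleCat.{u} R} (hG : gorensteinProjective 𝒳 G) {c : Y →ₗ[R] G}
    (hc : IsShortExact (actionMap R M Y) c) : IsTorAcyclic R M Y :=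
  isTorAcyclic_of_tensorIter (N + 1) Y G _ c hc (h.isTorAcyclic hG) (subsingleton_tensorIter hN _)

/-- In effect `Ext¹_T(Y, W) = 0` for `Y` in `Φ` and for `W` with pure action and cokernel in `𝒳`;
this gives the `Hom`-exactness of the spliced resolution. -/
theorem exists_extension (hN : IsNilpotentBimodule R M N) (h : IsAdmissible R M 𝒳)
    {G : ModuleCat.{u} R} (hG : gorensteinProjective 𝒳 G) {c : Y →ₗ[R] G}
    (hc : IsShortExact (actionMap R M Y) c) [Module.Projective (TensorRing R M) Q]
    {ι : K →ₗ[TensorRing R M] Q} {π : Q →ₗ[TensorRing R M] Y} (hιπ : IsShortExact ι π)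
    {B : ModuleCat.{u} R} (hB : 𝒳 B) {d : W →ₗ[R] B} (hd : IsShortExact (actionMap R M W) d)
    (hW : BalancedTensor.IsPure (actionMap R M W)) (f : K →ₗ[TensorRing R M] W) :
    ∃ g : Q →ₗ[TensorRing R M] W, g ∘ₗ ι = f := by
  obtain ⟨g, hg, hgι⟩ := exists_extension_of_tensorIter (isShortExact_restrictScalars hιπ)
    (actionMap_natural ι) (actionMap_natural π) hc isProjectivePair_actionMap (N + 1) W B
    (actionMap R M W) d hd hW (h.extendsTo hG hB) (subsingleton_tensorIter hN _)
    (f.restrictScalars R) (actionMap_natural f)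
  exact ⟨linearMapOfComm g hg, LinearMap.ext fun k => LinearMap.congr_fun hgι k⟩

/-- A module in `Φ(𝒢)`, for `𝒢` the class of `𝒳`-Gorenstein projective modules, is a quotient of an
induced projective module, with kernel in `Φ(𝒢)`. -/
theorem IsPhi.exists_resolution (hN : IsNilpotentBimodule R M N) (h : IsAdmissible R M 𝒳)
    (hY : IsPhi M (gorensteinProjective 𝒳) Y) :
    ∃ (Q K : ModuleCat.{u} (TensorRing R M)) (ι : K →ₗ[TensorRing R M] Q)
      (π : Q →ₗ[TensorRing R M] Y), Module.Projective (TensorRing R M) Q ∧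
      IsPhi M (gorensteinProjective 𝒳) K ∧ IsShortExact ι π := by
  obtain ⟨G, c, hG, hc⟩ := hY
  obtain ⟨P, G', i, p, hP, hG', hip⟩ := hG.exists_resolution
  obtain ⟨q, hq⟩ := Module.projective_lifting_property c p hc.surjective
  obtain ⟨π, hπ⟩ := exists_ind_linearMap (M := M) q
  have hcπ : c ∘ₗ π.restrictScalars R = p ∘ₗ indCounit R M P := by
    refine ind_hom_ext (u := (0 : BalancedTensor R M G →ₗ[R] G)) ?_ ?_ ?_
    · rw [LinearMap.comp_assoc, ← actionMap_natural, ← LinearMap.comp_assoc,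
        hc.exact.linearMap_comp_eq_zero, LinearMap.zero_comp, LinearMap.zero_comp]
    · rw [LinearMap.comp_assoc, indCounit_comp_actionMap, LinearMap.zero_comp, LinearMap.comp_zero]
    · rw [LinearMap.comp_assoc, LinearMap.comp_assoc, indCounit_comp_indUnit]
      ext x
      exact (congrArg c (hπ x)).trans (LinearMap.congr_fun hq x)
  have hπs : Function.Surjective π :=
    surjective_of_tensorIter (N + 1) Y _ G (actionMap R M Y) (actionMap R M _) c
      (π.restrictScalars R) hc.exact (actionMap_natural π)
      (by
        rw [hcπ]
        exact hip.surjective.comp indCounit_surjective) (subsingleton_tensorIter hN _)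
  obtain ⟨K, ι, hιπ⟩ := exists_isShortExact_of_surjective π hπs
  refine ⟨ModuleCat.of (TensorRing R M) (BalancedTensor R (TensorRing R M) P), K, ι, π, projective_ind, ?_, hιπ⟩
  -- Since `Tor₁(M, Y) = 0`, the map `M ⊗ K → M ⊗ Ind P` is injective; composing with the injective
  -- action on `Ind P` shows that the action on `K` is injective. Its cokernel is the kernel of `P →
  -- G`, hence isomorphic to `G'`.
  have hι := isTorAcyclic_of_isShortExact hN h hG hc _ _ _ _ (isShortExact_restrictScalars hιπ)
  have huK : Function.Injective (actionMap R M K) := by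
    have h1 : Function.Injective (ι.restrictScalars R ∘ₗ actionMap R M K) := by
      rw [← actionMap_natural]
      exact (isPure_actionMap_ind (M := M) (X := P)).injective.comp hι
    exact Function.Injective.of_comp h1
  obtain ⟨i', p', hip', hi', hp'⟩ := exists_isShortExact_coker (isShortExact_restrictScalars hιπ)
    (actionMap_natural ι) (actionMap_natural π) (LinearMap.exact_map_mkQ_range _)
    (Submodule.mkQ_surjective _) actionMap_indCounit_exact indCounit_surjective hc
  have hp : p' = p := by
    ext x
    obtain ⟨z, rfl⟩ := indCounit_surjective (R := R) (M := M) x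
    rw [hp']
    exact LinearMap.congr_fun hcπ z
  subst hp
  obtain ⟨e⟩ := hip'.nonempty_linearEquiv hip
  exact ⟨ModuleCat.of R _, (LinearMap.range (actionMap R M K)).mkQ,
    gorensteinProjective_of_linearEquiv hG' e, huK, LinearMap.exact_map_mkQ_range _,
    Submodule.mkQ_surjective _⟩

/-- A module in `Φ(𝒢)`, for `𝒢` the class of `𝒳`-Gorenstein projective modules, embeds in an
induced projective module, with cokernel in `Φ(𝒢)`. -/
theorem IsPhi.exists_coresolution (hN : IsNilpotentBimodule R M N) (h : IsAdmissible R M 𝒳)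
    (h𝒳 : projClass R ≤ 𝒳) (hY : IsPhi M (gorensteinProjective 𝒳) Y) :
    ∃ (Q V : ModuleCat.{u} (TensorRing R M)) (ι : Y →ₗ[TensorRing R M] Q)
      (π : Q →ₗ[TensorRing R M] V), Module.Projective (TensorRing R M) Q ∧
      IsPhi M (gorensteinProjective 𝒳) V ∧ IsShortExact ι π := by
  obtain ⟨Q, K, ι, π, hQ, -, hιπ⟩ := hY.exists_resolution hN h
  obtain ⟨G, c, hG, hc⟩ := hY
  obtain ⟨P, D, j, p, hP, hD, hjp⟩ := hG.exists_coresolution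
  let I := BalancedTensor R (TensorRing R M) P
  have hI : IsShortExact (actionMap R M I) (indCounit R M P) :=
    ⟨isPure_actionMap_ind.injective, actionMap_indCounit_exact, indCounit_surjective⟩
  have hιn := actionMap_natural ι
  have hπn := actionMap_natural π
  have hse := isShortExact_restrictScalars hιπ
  -- The goal is a map `Y → Ind P` inducing `j` on cokernels. The obstruction is removed on a
  -- projective presentation `Q → Y` with kernel `K`: the composite `Q → Y → G → P` is lifted to
  -- `Ind P`, and on `K` this lift lands in `M ⊗ Ind P`.
  obtain ⟨φ, hφ, hφc⟩ := isProjectivePair_actionMap (R := R) (M := M) (W := Q) I P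
    (actionMap R M I) 0 (indCounit R M P) (j ∘ₗ c ∘ₗ π.restrictScalars R)
    (by rw [indCounit_comp_actionMap, LinearMap.zero_comp]) indCounit_surjective
    (by
      rw [LinearMap.comp_assoc, LinearMap.comp_assoc, ← hπn, ← LinearMap.comp_assoc _ _ c,
        hc.exact.linearMap_comp_eq_zero, LinearMap.zero_comp, LinearMap.zero_comp,
        LinearMap.comp_zero])
  obtain ⟨φ', hφ'⟩ := exists_factorization_of_exact hI.injective hI.exact
    (φ ∘ₗ ι.restrictScalars R) (fun k => by
      refine (LinearMap.congr_fun hφc (ι k)).trans ?_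
      change j (c (π (ι k))) = 0
      rw [hιπ.apply_apply, map_zero, map_zero])
  have hφ'' : actionMap R M I ∘ₗ φ' = φ ∘ₗ ι.restrictScalars R := LinearMap.ext hφ'
  -- The restriction to `K` extends to `e : Q → M ⊗ Ind P`. The cokernel of the action on this
  -- target is `M ⊗ P`, whence the shift to `i + 1` in the `Ext` condition, applied to `P` as a
  -- member of `𝒳`.
  obtain ⟨e, he, heι⟩ := exists_extension_of_tensorIter hse hιn hπn hc isProjectivePair_actionMap
    (N + 1) (BalancedTensor R M I) (BalancedTensor R M P)
    (BalancedTensor.lTensor R M (actionMap R M I)) (BalancedTensor.lTensor R M (indCounit R M P))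
    (hI.lTensor_of_isPure isPure_actionMap_ind) isPure_actionMap_ind.lTensor
    (fun i => h.extendsTo hG (h𝒳 P hP) (i + 1)) (subsingleton_tensorIter hN _) φ' (by
      ext z
      apply hI.injective
      change actionMap R M I (BalancedTensor.lTensor R M (actionMap R M I)
        (BalancedTensor.lTensor R M φ' z)) = actionMap R M I (φ' (actionMap R M K z))
      rw [BalancedTensor.lTensor_lTensor, hφ'', hφ', BalancedTensor.lTensor_comp,
        LinearMap.comp_apply, ← LinearMap.comp_apply (actionMap R M I), hφ, LinearMap.comp_apply,
        ← LinearMap.comp_apply (actionMap R M Q), hιn]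
      rfl)
  -- The correction makes the map vanish on `K`, so it descends to `Y`, and it does not change the
  -- map on cokernels.
  let ψ : Q →ₗ[R] I := φ - actionMap R M I ∘ₗ e
  have hψ : actionMap R M I ∘ₗ BalancedTensor.lTensor R M ψ = ψ ∘ₗ actionMap R M Q := by
    refine BalancedTensor.linearMap_ext fun m q => ?_
    have h1 := LinearMap.congr_fun hφ (BalancedTensor.tmul R m q)
    have h2 := congrArg (actionMap R M I) (LinearMap.congr_fun he (BalancedTensor.tmul R m q))
    simp only [LinearMap.comp_apply, BalancedTensor.lTensor_tmul, actionMap_tmul] at h1 h2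
    simp only [ψ, LinearMap.comp_apply, BalancedTensor.lTensor_tmul, actionMap_tmul,
      LinearMap.sub_apply, smul_sub, h1, h2]
  have hψι : ∀ k, ψ (ι k) = 0 := fun k => by
    have h1 := LinearMap.congr_fun heι k
    simp only [LinearMap.comp_apply, LinearMap.coe_restrictScalars] at h1
    change φ (ι k) - actionMap R M I (e (ι k)) = 0
    rw [h1, hφ']
    exact sub_self _
  have hψc : indCounit R M P ∘ₗ ψ = j ∘ₗ c ∘ₗ π.restrictScalars R := by
    rw [← hφc]
    ext q
    change indCounit R M P (φ q - actionMap R M I (e q)) = indCounit R M P (φ q)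
    rw [map_sub, hI.apply_apply, sub_zero]
  obtain ⟨f, hf⟩ := exists_desc_of_exact hse.exact hse.surjective ψ hψι
  have hfψ : f ∘ₗ π.restrictScalars R = ψ := LinearMap.ext hf
  have hfn : actionMap R M I ∘ₗ BalancedTensor.lTensor R M f = f ∘ₗ actionMap R M Y := by
    ext z
    obtain ⟨z, rfl⟩ := BalancedTensor.lTensor_surjective (S := R) (A := M)
      (π.restrictScalars R) hse.surjective z
    simp only [LinearMap.comp_apply]
    rw [BalancedTensor.lTensor_lTensor, hfψ, actionMap_natural_apply]
    exact (LinearMap.congr_fun hψ z).trans (hf _).symm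
  have hfc : indCounit R M P ∘ₗ f = j ∘ₗ c := by
    ext y
    obtain ⟨q, rfl⟩ := hse.surjective y
    simp only [LinearMap.comp_apply]
    rw [hf]
    exact LinearMap.congr_fun hψc q
  -- Injectivity is inherited from `j : G → P`. The `Tor` conditions are needed both for `G` and for
  -- the next cosyzygy `D`, which is then the cokernel of the action on the quotient.
  have hfi : Function.Injective f :=
    injective_of_tensorIter (N + 1) Y I G P D _ _ c (indCounit R M P) f j p hc hI
      isPure_actionMap_ind hjp hfn hfc (h.isTorAcyclic hG) (h.isTorAcyclic hD)
      (subsingleton_tensorIter hN _)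
  let F := linearMapOfComm f hfn
  obtain ⟨V, ρ, hFρ⟩ := exists_isShortExact_of_injective F hfi
  refine ⟨ModuleCat.of (TensorRing R M) I, V, F, ρ, projective_ind, ?_, hFρ⟩
  obtain ⟨d, hd⟩ := isShortExact_quotient (isShortExact_restrictScalars hFρ) (actionMap_natural F)
    (actionMap_natural ρ) hc hI hjp hfc
  exact ⟨D, d, hD, hd⟩

/-- Under admissibility, `Φ` of the `𝒳`-Gorenstein projective modules consists of
`𝒴`-Gorenstein projective modules. -/
theorem phi_le_gorensteinProjective (hN : IsNilpotentBimodule R M N) (h : IsAdmissible R M 𝒳)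
    (h𝒳 : projClass R ≤ 𝒳) (𝒴 : ObjectProperty (ModuleCat.{u} (TensorRing R M)))
    (h𝒴 : ∀ W, 𝒴 W → BalancedTensor.IsPure (actionMap R M W))
    (h𝒴' : ∀ W, 𝒴 W → ∀ (X : ModuleCat.{u} R) (c : W →ₗ[R] X),
      IsShortExact (actionMap R M W) c → 𝒳 X) :
    Phi R M (gorensteinProjective 𝒳) ≤ gorensteinProjective 𝒴 := by
  intro A hA
  rw [phi_gorensteinProjective_iff] at hA
  refine le_gorensteinProjective (fun A => IsPhi M (gorensteinProjective 𝒳) A) ?_ ?_ ?_ A hA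
  · exact fun Y hY => hY.exists_coresolution hN h h𝒳
  · exact fun Y hY => hY.exists_resolution hN h
  · rintro K Q Y ι π hιπ hQ ⟨G, c, hG, hc⟩ W hW f
    have hd : IsShortExact (actionMap R M W) (LinearMap.range (actionMap R M W)).mkQ :=
      ⟨(h𝒴 W hW).injective, LinearMap.exact_map_mkQ_range _, Submodule.mkQ_surjective _⟩
    exact exists_extension hN h hG hc hιπ (B := ModuleCat.of R _) (h𝒴' W hW _ _ hd) hd (h𝒴 W hW) f

end TensorRing

/-! ### Compatibility: the Gorenstein class is contained in `Φ`. -/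

namespace TensorRing

open BalancedTensor

variable {R : Type u} [Ring R] {M : Type u} [AddCommGroup M] [Module R M] [Module Rᵐᵒᵖ M]
  [SMulCommClass R Rᵐᵒᵖ M] {𝒳 : ObjectProperty (ModuleCat.{u} R)}
  {𝒴 : ObjectProperty (ModuleCat.{u} (TensorRing R M))}

attribute [local instance] baseModule

/-- The map on cokernels of the actions of `M` induced by a linear map over the tensor ring. -/
def cokerMap {A B : ModuleCat.{u} (TensorRing R M)} (f : A ⟶ B) :
    (A ⧸ LinearMap.range (actionMap R M A)) →ₗ[R] (B ⧸ LinearMap.range (actionMap R M B)) :=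
  Submodule.mapQ _ _ (f.hom.restrictScalars R) (by
    rintro _ ⟨z, rfl⟩
    exact ⟨_, actionMap_natural_apply f.hom z⟩)

/-- The complex of the cokernels of the actions of `M`. -/
def cokerComplex (Q : CochainComplex (ModuleCat.{u} (TensorRing R M)) ℤ) :
    CochainComplex (ModuleCat.{u} R) ℤ where
  X n := ModuleCat.of R (Q.X n ⧸ LinearMap.range (actionMap R M (Q.X n)))
  d i j := ModuleCat.ofHom (cokerMap (Q.d i j))
  shape i j hij := by
    ext x
    have h : (Q.d i j).hom x = 0 :=
      LinearMap.congr_fun (congrArg ModuleCat.Hom.hom (Q.shape i j hij)) x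
    exact (congrArg (LinearMap.range (actionMap R M (Q.X j))).mkQ h).trans (map_zero _)
  d_comp_d' i j k _ _ := by
    ext x
    have h : (Q.d j k).hom ((Q.d i j).hom x) = 0 :=
      LinearMap.congr_fun (congrArg ModuleCat.Hom.hom (Q.d_comp_d i j k)) x
    exact (congrArg (LinearMap.range (actionMap R M (Q.X k))).mkQ h).trans (map_zero _)

theorem cokerComplex_d_mkQ (Q : CochainComplex (ModuleCat.{u} (TensorRing R M)) ℤ) (i j : ℤ)
    (x : Q.X i) : ((cokerComplex Q).d i j).hom
      ((LinearMap.range (actionMap R M (Q.X i))).mkQ x) =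
        (LinearMap.range (actionMap R M (Q.X j))).mkQ ((Q.d i j).hom x) := rfl

/-- If `Hom(Q, X')` and `Hom(Q, X)` are exact then so is `Hom(Q, Z)`, for a short exact sequence
`0 → X' → X → Z → 0` and a complex `Q` of projective modules. -/
theorem _root_.IsHomExact.of_isShortExact {S : Type u} [Ring S]
    {Q : CochainComplex (ModuleCat.{u} S) ℤ} (hQ : ∀ n, Module.Projective S (Q.X n))
    {X' X Z : ModuleCat.{u} S} {f : X' →ₗ[S] X} {g : X →ₗ[S] Z} (h : IsShortExact f g)
    (hX' : IsHomExact Q X') (hX : IsHomExact Q X) : IsHomExact Q Z := by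
  intro i j k hij hjk a
  constructor
  · intro ha
    -- The long exact sequence by hand: `a` lifts to `b` with values in `X`, and `b ∘ d` is a
    -- cocycle `c` in `X'`. Writing `c` as a coboundary of `e` makes `b - f ∘ e` a cocycle in `X`,
    -- hence a coboundary of some `t`, and `g ∘ t` bounds `a`.
    obtain ⟨b, hb⟩ := Module.projective_lifting_property g a.hom h.surjective
    have ha' : ∀ x, a.hom ((Q.d i j).hom x) = 0 := fun x =>
      LinearMap.congr_fun (congrArg ModuleCat.Hom.hom ha) x
    obtain ⟨c, hc⟩ := exists_factorization_of_exact h.injective h.exact (b ∘ₗ (Q.d i j).hom)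
      (fun x => (LinearMap.congr_fun hb _).trans (ha' x))
    obtain ⟨e, he⟩ := (hX' (i - 1) i j (by omega) hij (ModuleCat.ofHom c)).1 (by
      ext x
      apply h.injective
      change f (c ((Q.d (i - 1) i).hom x)) = f 0
      have h0 : (Q.d i j).hom ((Q.d (i - 1) i).hom x) = 0 :=
        LinearMap.congr_fun (congrArg ModuleCat.Hom.hom (Q.d_comp_d (i - 1) i j)) x
      rw [hc, LinearMap.comp_apply, h0, map_zero, map_zero])
    obtain ⟨t, ht⟩ := (hX i j k hij hjk (ModuleCat.ofHom (b - f ∘ₗ e.hom))).1 (by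
      ext x
      have h1 : e.hom ((Q.d i j).hom x) = c x :=
        LinearMap.congr_fun (congrArg ModuleCat.Hom.hom he) x
      change b ((Q.d i j).hom x) - f (e.hom ((Q.d i j).hom x)) = 0
      rw [h1, hc]
      exact sub_self _)
    refine ⟨ModuleCat.ofHom (g ∘ₗ t.hom), ?_⟩
    ext x
    have h1 : t.hom ((Q.d j k).hom x) = b x - f (e.hom x) :=
      LinearMap.congr_fun (congrArg ModuleCat.Hom.hom ht) x
    change g (t.hom ((Q.d j k).hom x)) = a.hom x
    rw [h1, map_sub, h.apply_apply, sub_zero]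
    exact LinearMap.congr_fun hb x
  · rintro ⟨t, rfl⟩
    change Q.d i j ≫ Q.d j k ≫ t = 0
    rw [← Category.assoc, Q.d_comp_d, Limits.zero_comp]

section

variable {Q : CochainComplex (ModuleCat.{u} (TensorRing R M)) ℤ}

theorem lTensor_exact_of_isCompatible (hM : IsCompatible R M 𝒳)
    (hQ : IsCompleteProjectiveResolution (IndClass R M 𝒳) Q) (i j k : ℤ) (hij : i + 1 = j)
    (hjk : j + 1 = k) : Function.Exact (lTensor R M ((Q.d i j).hom.restrictScalars R))
      (lTensor R M ((Q.d j k).hom.restrictScalars R)) :=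
  hM.tensor_exact Q hQ i j k hij hjk

/-- In `0 → Ind (M ⊗ X) → Ind X → Triv X → 0`, compatibility handles the first term and completeness
of `Q` the second. -/
theorem isHomExact_triv (hM : IsCompatible R M 𝒳)
    (hQ : IsCompleteProjectiveResolution (IndClass R M 𝒳) Q) {X : ModuleCat.{u} R} (hX : 𝒳 X) :
    IsHomExact Q (ModuleCat.of (TensorRing R M) (Triv M X)) := by
  obtain ⟨f, hf, hex⟩ := exists_exact_ind_tensor (R := R) (M := M) X
  let c : BalancedTensor R (TensorRing R M) X →ₗ[TensorRing R M] Triv M X :=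
    toTriv (indCounit R M X) indCounit_comp_actionMap
  have hc : IsShortExact f c := ⟨hf, hex, indCounit_surjective (R := R) (M := M) (X := X)⟩
  refine IsHomExact.of_isShortExact hQ.projective
    (X' := ModuleCat.of (TensorRing R M) (BalancedTensor R (TensorRing R M) (BalancedTensor R M X)))
    (X := ModuleCat.of (TensorRing R M) (BalancedTensor R (TensorRing R M) X))
    (f := f) (g := c) hc
    (hM.hom_exact Q hQ X hX) (hQ.homExact _ ⟨X, hX, ⟨Iso.refl _⟩⟩)

/-- The cokernels of the actions of `M` on an `Ind(𝒳)`-complete projective resolution form an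
`𝒳`-complete projective resolution. -/
theorem isCompleteProjectiveResolution_cokerComplex (hM : IsCompatible R M 𝒳)
    (hQ : IsCompleteProjectiveResolution (IndClass R M 𝒳) Q) :
    IsCompleteProjectiveResolution 𝒳 (cokerComplex Q) where
  projective n := by
    have := hQ.projective n
    exact projective_of_exact_actionMap (M := M) (W := Q.X n) _
      (LinearMap.exact_map_mkQ_range (actionMap R M (Q.X n))) (Submodule.mkQ_surjective _)
  exact i j k hij hjk := by
    have hkl := hQ.exact j k (k + 1) hjk rfl
    have hproj := hQ.projective (k + 1)
    have hinj : Function.Injective (actionMap R M (Q.X (k + 1))) :=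
      isPure_actionMap_of_projective.injective
    intro x
    constructor
    · intro hx
      obtain ⟨x, rfl⟩ := Submodule.mkQ_surjective _ x
      obtain ⟨z, hz⟩ : ∃ z, actionMap R M (Q.X k) z = (Q.d j k).hom x :=
        (LinearMap.exact_map_mkQ_range (actionMap R M (Q.X k)) _).1 hx
      -- One step further right, the action on the projective module `Q.X (k + 1)` is injective, so
      -- `z` is a cycle in `M ⊗ Q`. Exactness of that complex allows `x` to be corrected by an
      -- element of the image of the action until it is a cycle in `Q`.
      have h1 : lTensor R M ((Q.d k (k + 1)).hom.restrictScalars R) z = 0 := by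
        apply hinj
        rw [actionMap_natural_apply, hz, map_zero, hkl.apply_apply_eq_zero]
      obtain ⟨z, rfl⟩ := (lTensor_exact_of_isCompatible hM hQ j k (k + 1) hjk rfl z).1 h1
      rw [actionMap_natural_apply] at hz
      obtain ⟨y, hy⟩ := (hQ.exact i j k hij hjk (x - actionMap R M _ z)).1 (by
        rw [map_sub, hz, sub_self])
      refine ⟨(LinearMap.range (actionMap R M (Q.X i))).mkQ y, ?_⟩
      have hs : (LinearMap.range (actionMap R M (Q.X j))).mkQ (x - actionMap R M _ z) =
          (LinearMap.range (actionMap R M (Q.X j))).mkQ x := by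
        rw [map_sub, sub_eq_self]
        exact (Submodule.Quotient.mk_eq_zero _).2 ⟨z, rfl⟩
      exact (congrArg (LinearMap.range (actionMap R M (Q.X j))).mkQ hy).trans hs
    · rintro ⟨y, rfl⟩
      exact LinearMap.congr_fun (congrArg ModuleCat.Hom.hom ((cokerComplex Q).d_comp_d i j k)) y
  homExact X hX i j k hij hjk f := by
    constructor
    · intro hf
      let q (n : ℤ) := (LinearMap.range (actionMap R M (Q.X n))).mkQ
      have hq : ∀ n z, q n (actionMap R M (Q.X n) z) = 0 := fun n =>
        (LinearMap.exact_map_mkQ_range (actionMap R M (Q.X n))).apply_apply_eq_zero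
      -- Maps from the cokernel to `X` are the `T`-linear maps to `Triv M X`, so the question moves
      -- to `Hom(Q, Triv M X)`.
      let f' : Q.X j →ₗ[TensorRing R M] Triv M X := toTriv (f.hom ∘ₗ q j) (by
        ext z
        exact (congrArg f.hom (hq j z)).trans (map_zero _))
      obtain ⟨g, hg⟩ := (isHomExact_triv hM hQ hX i j k hij hjk (ModuleCat.ofHom f')).1 (by
        ext x
        exact LinearMap.congr_fun (congrArg ModuleCat.Hom.hom hf) (q i x))
      let g₁ : Q.X k →ₗ[TensorRing R M] Triv M X := g.hom
      obtain ⟨g', hg'⟩ := exists_desc_of_exact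
        (LinearMap.exact_map_mkQ_range (actionMap R M (Q.X k))) (Submodule.mkQ_surjective _)
        ((trivEquiv (R := R) (M := M) (X := X)).toLinearMap ∘ₗ g₁.restrictScalars R)
        (fun z => (congrArg (trivEquiv (R := R) (M := M) (X := X))
          (linearMap_triv_actionMap g₁ z)).trans (map_zero _))
      refine ⟨ModuleCat.ofHom g', ?_⟩
      ext x
      obtain ⟨x, rfl⟩ := Submodule.mkQ_surjective _ x
      refine (hg' _).trans ?_
      exact LinearMap.congr_fun (congrArg ModuleCat.Hom.hom hg) x
    · rintro ⟨t, rfl⟩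
      change (cokerComplex Q).d i j ≫ (cokerComplex Q).d j k ≫ t = 0
      rw [← Category.assoc, HomologicalComplex.d_comp_d, Limits.zero_comp]

/-- Under compatibility, the `𝒴`-Gorenstein projective modules belong to `Φ` of the class of
`𝒳`-Gorenstein projective modules. -/
theorem gorensteinProjective_le_phi (hM : IsCompatible R M 𝒳) (h𝒴 : IndClass R M 𝒳 ≤ 𝒴) :
    gorensteinProjective 𝒴 ≤ Phi R M (gorensteinProjective 𝒳) := by
  rintro A ⟨Q, hQ𝒴, ⟨e⟩⟩
  have hQ : IsCompleteProjectiveResolution (IndClass R M 𝒳) Q :=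
    ⟨hQ𝒴.projective, hQ𝒴.exact, fun X hX => hQ𝒴.homExact X (h𝒴 X hX)⟩
  have hP := isCompleteProjectiveResolution_cokerComplex hM hQ
  let ι : A →ₗ[TensorRing R M] Q.X 0 := (LinearMap.range (Q.d (-1) 0).hom).subtype ∘ₗ e.toLinearMap
  let π : Q.X (-1) →ₗ[TensorRing R M] A := e.symm.toLinearMap ∘ₗ (Q.d (-1) 0).hom.rangeRestrict
  have hι : Function.Injective ι := Subtype.val_injective.comp e.injective
  have hπ : Function.Surjective π := e.symm.surjective.comp (LinearMap.surjective_rangeRestrict _)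
  have hιπ : ∀ x, ι (π x) = (Q.d (-1) 0).hom x := fun x =>
    congrArg Subtype.val (e.apply_symm_apply _)
  have hιπ' : ι.restrictScalars R ∘ₗ π.restrictScalars R = (Q.d (-1) 0).hom.restrictScalars R :=
    LinearMap.ext hιπ
  have hπd : π.restrictScalars R ∘ₗ (Q.d (-2) (-1)).hom.restrictScalars R = 0 := by
    ext x
    apply hι
    refine (hιπ _).trans (Eq.trans ?_ (map_zero ι).symm)
    exact (hQ.exact (-2) (-1) 0 (by omega) (by omega)).apply_apply_eq_zero x
  have := hQ.projective 0
  have hinj : Function.Injective (actionMap R M (Q.X 0)) :=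
    isPure_actionMap_of_projective.injective
  rw [phi_gorensteinProjective_iff]
  refine ⟨ModuleCat.of R _, (LinearMap.range (actionMap R M A)).mkQ, ?_, ?_,
    LinearMap.exact_map_mkQ_range _, Submodule.mkQ_surjective _⟩
  · refine gorensteinProjective_of_linearEquiv
      (hP.gorensteinProjective_range (-1) 0 (by omega)) ?_
    let ι' := cokerMap (ModuleCat.ofHom ι)
    -- Exactness of the cokernel complex at degree `-1` lets the preimage `x` be changed by a
    -- boundary, which `π` kills, so that it lies in the image of the action. Thus `coker A` embeds
    -- in the cokernel for `Q.X 0`, with image that of the differential.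
    have hι' : Function.Injective ι' := by
      rw [injective_iff_map_eq_zero]
      intro y hy
      obtain ⟨a, rfl⟩ := Submodule.mkQ_surjective _ y
      obtain ⟨x, rfl⟩ := hπ a
      have h1 : ((cokerComplex Q).d (-1) 0).hom
          ((LinearMap.range (actionMap R M (Q.X (-1)))).mkQ x) = 0 := by
        rw [cokerComplex_d_mkQ, ← hιπ]
        exact hy
      obtain ⟨x', hx'⟩ := (hP.exact (-2) (-1) 0 (by omega) (by omega) _).1 h1
      obtain ⟨x', rfl⟩ := Submodule.mkQ_surjective _ x'
      rw [cokerComplex_d_mkQ] at hx'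
      obtain ⟨z, hz⟩ := (LinearMap.exact_map_mkQ_range (actionMap R M (Q.X (-1)))
        (x - (Q.d (-2) (-1)).hom x')).1 (by rw [map_sub, hx', sub_self])
      refine (Submodule.Quotient.mk_eq_zero _).2 ⟨lTensor R M (π.restrictScalars R) z, ?_⟩
      rw [actionMap_natural_apply, hz, map_sub, sub_eq_self]
      exact LinearMap.congr_fun hπd x'
    refine (LinearEquiv.ofInjective ι' hι').trans (LinearEquiv.ofEq _ _ ?_)
    ext y
    constructor
    · rintro ⟨a, rfl⟩
      obtain ⟨a, rfl⟩ := Submodule.mkQ_surjective _ a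
      obtain ⟨x, rfl⟩ := hπ a
      exact ⟨(LinearMap.range (actionMap R M (Q.X (-1)))).mkQ x,
        congrArg (LinearMap.range (actionMap R M (Q.X 0))).mkQ (hιπ x).symm⟩
    · rintro ⟨x, rfl⟩
      obtain ⟨x, rfl⟩ := Submodule.mkQ_surjective _ x
      exact ⟨(LinearMap.range (actionMap R M A)).mkQ (π x),
        congrArg (LinearMap.range (actionMap R M (Q.X 0))).mkQ (hιπ x)⟩
  · rw [injective_iff_map_eq_zero]
    intro z hz
    -- The action on `Q.X 0` is injective, so `z` dies in `M ⊗ Q.X 0`. A lift of `z` to `M ⊗ Q.X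
    -- (-1)` is then a cycle, hence a boundary, and boundaries vanish in `M ⊗ A`.
    have h1 : lTensor R M (ι.restrictScalars R) z = 0 := by
      apply hinj
      rw [actionMap_natural_apply, hz, map_zero, map_zero]
    obtain ⟨z, rfl⟩ := lTensor_surjective (S := R) (A := M) (π.restrictScalars R) hπ z
    rw [lTensor_lTensor, hιπ'] at h1
    obtain ⟨y, rfl⟩ := (lTensor_exact_of_isCompatible hM hQ (-2) (-1) 0 (by omega) (by omega) z).1 h1
    rw [lTensor_lTensor, hπd, lTensor_zero, LinearMap.zero_apply]

end

theorem indClass_projClass_le : IndClass R M (projClass R) ≤ projClass (TensorRing R M) := by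
  rintro A ⟨X, hX, ⟨e⟩⟩
  have : Module.Projective R X := hX
  have : Module.Projective (TensorRing R M) ((Ind R M).obj X) :=
    projective_ind (R := R) (M := M) (X := X)
  exact Module.Projective.of_equiv' e.symm.toLinearEquiv

/-- Ensures that a resolution complete for flat `T`-modules is `Ind`-complete, so that compatibility
applies to it. -/
theorem indClass_flatClass_le : IndClass R M (flatClass R) ≤ flatClass (TensorRing R M) := by
  rintro A ⟨X, hX, ⟨e⟩⟩
  exact flatClass_of_linearEquiv e.toLinearEquiv (flatClass_ind hX)

end TensorRing

end

/-! ### The Gorenstein projective and Ding projective cases. -/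

theorem corollary2p9 {R : Type u} [Ring R] [Nontrivial R] {M : Type u} [AddCommGroup M]
    [Module R M] [Module Rᵐᵒᵖ M] [SMulCommClass R Rᵐᵒᵖ M] (N : ℕ)
    (hN : IsNilpotentBimodule R M N) :
    (IsCompatible R M (projClass R) → IsAdmissible R M (projClass R) →
      GP (TensorRing R M) = Phi R M (GP R)) ∧
    (IsCompatible R M (flatClass R) → IsAdmissible R M (flatClass R) →
      DP (TensorRing R M) = Phi R M (DP R)) := by
  let (A : ModuleCat.{u} (TensorRing R M)) : Module R A := TensorRing.baseModule A
  constructor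
  · intro hM hA
    refine le_antisymm (TensorRing.gorensteinProjective_le_phi hM TensorRing.indClass_projClass_le)
      (TensorRing.phi_le_gorensteinProjective hN hA le_rfl _ (fun W hW => ?_)
        (fun W hW X c hc => ?_))
    · have : Module.Projective (TensorRing R M) W := hW
      exact TensorRing.isPure_actionMap_of_projective
    · have : Module.Projective (TensorRing R M) W := hW
      exact TensorRing.projective_of_exact_actionMap c hc.exact hc.surjective
  · intro hM hA
    refine le_antisymm (TensorRing.gorensteinProjective_le_phi hM TensorRing.indClass_flatClass_le)
      (TensorRing.phi_le_gorensteinProjective hN hA projClass_le_flatClass _ (fun W hW => ?_)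
        (fun W hW X c hc => ?_))
    · exact TensorRing.isPure_actionMap_of_flat hW
    · exact TensorRing.flatClass_of_exact_actionMap hW c hc.exact hc.surjective
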